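/- **Setting.** Let $\mathbb X$ be a Polish space with its Borel $\sigma$-algebra and $\mathbb R_+=(0,\infty)$. Let $\alpha$ be a finite, non-zero, diffuse measure on $\mathbb X$, let $\nu^*$ be a measure on $\mathbb R_+$ with $\int\min\{s,1\}\,\nu^*(ds)<\infty$, let $f$ be a probability density on $\mathbb R_+$, and let $d\ge 1$. Assume $$\int_{\mathbb R_+} z^{-d}\int_{\mathbb R_+^d}\min\{1,\|\boldsymbol s\|\}\prod_{j=1}^d f(s_j/z)\,ds_1\cdots ds_d\,\nu^*(dz)<\infty,\qquad \int_{\mathbb R_+}\int_{\mathbb R_+}z^{-1}f(s/z)\,ds\,\nu^*(dz)=\infty .$$ A completely random measure (CRM) with Lévy intensity $\nu(ds)\alpha(dx)$ is a random measure $\tilde\eta=\sum_{i\ge1}J_i\delta_{\tilde x_i}$ whose points $(J_i,\tilde x_i)$ form a Poisson random measure on $\mathbb R_+\times\mathbb X$ with intensity $\nu\otimes\alpha$. Let $(\tilde\mu_1,\dots,\tilde\mu_d)$ be a vector of compound random measures (CoRM) with i.i.d. scores: $\tilde\mu_j=\sum_{i\ge1}m_{j,i}J_i\delta_{\tilde x_i}$,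 where $\tilde\eta=\sum_{i\ge1}J_i\delta_{\tilde x_i}$ is a CRM with Lévy intensity $\nu^*(ds)\alpha(dx)$ and, given all the $(J_i,\tilde x_i)$, the scores $m_{j,i}$ are i.i.d. with density $f$. Put $\tilde p_j=\tilde\mu_j/\tilde\mu_j(\mathbb X)$. Let $n_1,\dots,n_d\ge1$. Given $(\tilde\mu_1,\dots,\tilde\mu_d)$, let the observations $X_{i,j}$ ($1\le i\le n_j$, $1\le j\le d$) be independent with $X_{i,j}\sim\tilde p_j$, and write $\boldsymbol X_j=(X_{1,j},\dots,X_{n_j,j})$. Let $U_j=\Gamma_{n_j}/\tilde\mu_j(\mathbb X)$, where the $\Gamma_{n_j}\sim\mathrm{Gamma}(n_j,1)$ are independent of each other and jointly independent of the $\tilde\mu_j$ and the $X_{i,j}$. Let $X_1^*,\dots,X_k^*$ be the distinct values among all the observations, and let $n_{\ell,j}\ge0$ be the number of elements of the $j$th sample equal to $X^*_\ell$. **Theorem.** The vector $(\tilde\mu_1,\dots,\tilde\mu_d)$ has a regular conditional distribution given $\{\boldsymbol X_j,U_j\}_{j=1}^d$, and for almost every realization of the conditioning variables it is the law of $$(\tilde\mu_1',\dots,\tilde\mu_d')+\sum_{\ell=1}^k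 (T_{\ell,1},\dots,T_{\ell,d})\,\sigma_\ell\,\delta_{X_\ell^*},$$ where the vector $(\tilde\mu'_1,\dots,\tilde\mu'_d)$ is independent of the family $(\sigma_\ell,T_{\ell,j})_{\ell,j}$ and, $U_j$, $X^*_\ell$ and $n_{\ell,j}$ being fixed at their realized values: (i) $\tilde\mu'_j=\sum_{i\ge1}m'_{j,i}J'_i\delta_{\tilde x'_i}$, where $\tilde\eta'=\sum_{i\ge1}J_i'\delta_{\tilde x_i'}$ is a CRM with Lévy intensity $$\nu'(ds)\,\alpha(dx)=\prod_{j=1}^d\int_{\mathbb R_+}e^{-U_jms}f(m)\,dm\;\nu^*(ds)\,\alpha(dx),$$ and, given all the $(J'_i,\tilde x'_i)$, the scores $m'_{j,i}$ are independent, $m'_{j,i}$ having density proportional to $m\mapsto e^{-U_jmJ_i'}f(m)$ on $\mathbb R_+$; (ii) the vectors $(\sigma_\ell,T_{\ell,1},\dots,T_{\ell,d})$, $\ell=1,\dots,k$, are independent; $\sigma_\ell$ has the probability law on $\mathbb R_+$ proportional to $$\Big(\prod_{j=1}^d s^{n_{\ell,j}}\int_{\mathbb R_+}e^{-U_jms}m^{n_{\ell,j}}f(m)\,dm\Big)\,\nu^*(ds),$$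 and, given $\sigma_\ell=s$, the $T_{\ell,1},\dots,T_{\ell,d}$ are independent, $T_{\ell,j}$ having density proportional to $t\mapsto e^{-sU_jt}t^{n_{\ell,j}}f(t)$ on $\mathbb R_+$. For almost every realization, random elements as in (i) and (ii) exist, and the law of the displayed vector is the same for every choice of them. -/

import Mathlib

open MeasureTheory ProbabilityTheory Set
open scoped ENNReal NNReal

universe u v w

namespace CoRM

noncomputable section

/-- `N` is a Poisson random measure with intensity `Λ`: the mass of a measurable set `B` is Poisson
distributed with mean `Λ B` (almost surely infinite when `Λ B = ∞`), and the masses of pairwise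
disjoint measurable sets are mutually independent. -/
structure IsPoissonRandomMeasure {Ω : Type*} [MeasurableSpace Ω] (P : Measure Ω)
    {E : Type*} [MeasurableSpace E] (N : Ω → Measure E) (Λ : Measure E) : Prop where
  measurable : Measurable N
  law : ∀ B : Set E, MeasurableSet B → Λ B ≠ ∞ →
    P.map (fun ω => N ω B) = (poissonMeasure (Λ B).toNNReal).map (fun k : ℕ => (k : ℝ≥0∞))
  law_top : ∀ B : Set E, MeasurableSet B → Λ B = ∞ → ∀ᵐ ω ∂P, N ω B = ∞
  indep : ∀ (k : ℕ) (B : Fin k → Set E), (∀ i, MeasurableSet (B i)) →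
    Pairwise (fun i i' => Disjoint (B i) (B i')) → iIndepFun (fun i ω => N ω (B i)) P

/-- The random sequences `J i` (heights) and `x i` (locations) are the heights and locations of the
atoms of a completely random measure `η = ∑ i, J i • δ_{x i}` without deterministic drift and without
fixed atoms, with homogeneous Lévy intensity `ν(ds) α(dx)`: the points `(J i, x i)` form
a Poisson random measure with intensity `ν ⊗ α`.
(All the Lévy measures `ν` considered below have infinite mass, so there are infinitely many
points.) -/
structure IsCRMSeries {Ω : Type*} [MeasurableSpace Ω] (P : Measure Ω)
    {𝕏 : Type*} [MeasurableSpace 𝕏] (ν : Measure ℝ) (α : Measure 𝕏)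
    (J : ℕ → Ω → ℝ) (x : ℕ → Ω → 𝕏) : Prop where
  measurable_height : ∀ i, Measurable (J i)
  measurable_location : ∀ i, Measurable (x i)
  poisson : IsPoissonRandomMeasure P
    (fun ω => Measure.sum fun i => Measure.dirac (J i ω, x i ω)) (ν.prod α)

/-- Conditionally on all the heights `J` and locations `x`, the scores `m i j` (`i` the atom, `j` the
group) are mutually independent, and `m i j` has law `G j (J i)`. -/
structure IsScoreArray {Ω : Type*} [MeasurableSpace Ω] (P : Measure Ω)
    {𝕏 : Type*} [MeasurableSpace 𝕏] {d : ℕ} (G : Fin d → ℝ → Measure ℝ)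
    (J : ℕ → Ω → ℝ) (x : ℕ → Ω → 𝕏) (m : ℕ → Fin d → Ω → ℝ) : Prop where
  measurable_score : ∀ i j, Measurable (m i j)
  condLaw : ∀ (C : Set (ℕ → ℝ × 𝕏)), MeasurableSet C →
    ∀ (I : ℕ) (B : ℕ → Fin d → Set ℝ), (∀ i j, MeasurableSet (B i j)) →
      P {ω | (fun i => (J i ω, x i ω)) ∈ C ∧ ∀ i < I, ∀ j, m i j ω ∈ B i j} =
        ∫⁻ ω in {ω | (fun i => (J i ω, x i ω)) ∈ C},
          ∏ i ∈ Finset.range I, ∏ j, G j (J i ω) (B i j) ∂P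

/-- `(μ 1, …, μ d)` is a compound random vector of measures
`μ j = ∑ i, m i j * J i • δ_{x i}`, where `∑ i, J i • δ_{x i}` is a completely random measure with
Lévy intensity `ν(ds) α(dx)` and where, given this measure, the scores `m i j` are independent
with laws `G j (J i)`. If `G j s` does not depend on `j` and `s`, the scores are i.i.d. and this is
a vector of compound random measures. -/
structure IsCompoundVector {Ω : Type*} [MeasurableSpace Ω] (P : Measure Ω)
    {𝕏 : Type*} [MeasurableSpace 𝕏] {d : ℕ} (G : Fin d → ℝ → Measure ℝ)
    (ν : Measure ℝ) (α : Measure 𝕏) (μ : Fin d → Ω → Measure 𝕏) : Prop where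
  measurable : ∀ j, Measurable (μ j)
  series : ∃ (J : ℕ → Ω → ℝ) (x : ℕ → Ω → 𝕏) (m : ℕ → Fin d → Ω → ℝ),
    IsCRMSeries P ν α J x ∧ IsScoreArray P G J x m ∧
      ∀ᵐ ω ∂P, ∀ j, μ j ω =
        Measure.sum fun i => ENNReal.ofReal (m i j ω * J i ω) • Measure.dirac (x i ω)

/-- A measure divided by its total mass. -/
def normalized {E : Type*} [MeasurableSpace E] (ρ : Measure E) : Measure E :=
  (ρ univ)⁻¹ • ρ

/-- The law on `(0, ∞)` with density `f`. -/
def scoreLaw (f : ℝ → ℝ≥0) : Measure ℝ :=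
  (volume.restrict (Ioi 0)).withDensity fun m => (f m : ℝ≥0∞)

/-- The probability law on `(0, ∞)` with density in `t` proportional to `e^{-s u t} t^k f(t)`. -/
def jumpLaw (f : ℝ → ℝ≥0) (u : ℝ) (k : ℕ) (s : ℝ) : Measure ℝ :=
  normalized ((volume.restrict (Ioi 0)).withDensity
    fun t => ENNReal.ofReal (Real.exp (-(s * u * t)) * t ^ k) * (f t : ℝ≥0∞))

/-- The probability law on `(0, ∞)` with density in `m` proportional to `e^{-u m s} f(m)`. -/
def tiltedScoreLaw (f : ℝ → ℝ≥0) (u s : ℝ) : Measure ℝ :=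
  normalized ((volume.restrict (Ioi 0)).withDensity
    fun m => ENNReal.ofReal (Real.exp (-(u * m * s))) * (f m : ℝ≥0∞))

/-- The integral `∫_0^∞ e^{-u m s} m^k f(m) dm`. -/
def scoreIntegral (f : ℝ → ℝ≥0) (u : ℝ) (k : ℕ) (s : ℝ) : ℝ≥0∞ :=
  ∫⁻ m in Ioi (0 : ℝ), ENNReal.ofReal (Real.exp (-(u * m * s)) * m ^ k) * (f m : ℝ≥0∞)

/-- The updated Lévy measure `∏_j (∫_0^∞ e^{-u_j m s} f(m) dm) ν(ds)`. -/
def updatedLevy {d : ℕ} (f : ℝ → ℝ≥0) (ν : Measure ℝ) (u : Fin d → ℝ) : Measure ℝ :=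
  ν.withDensity fun s => ∏ j, scoreIntegral f (u j) 0 s

/-- The probability law proportional to
`∏_j (∫_0^∞ e^{-u_j m s} m^{k_j} f(m) dm) s^{k_j} ν(ds)`. -/
def sigmaLaw {d : ℕ} (f : ℝ → ℝ≥0) (ν : Measure ℝ) (u : Fin d → ℝ) (k : Fin d → ℕ) : Measure ℝ :=
  normalized (ν.withDensity
    fun s => ∏ j, (scoreIntegral f (u j) (k j) s * ENNReal.ofReal (s ^ k j)))

/-- The distinct values in a collection of `d` samples `x j` of sizes `n j`. -/
def distinctValues {𝕏 : Type*} {d : ℕ} {n : Fin d → ℕ} (x : (j : Fin d) → Fin (n j) → 𝕏) :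
    Finset 𝕏 :=
  open Classical in
  Finset.univ.image fun p : (j : Fin d) × Fin (n j) => x p.1 p.2

/-- The number of elements of the `j`th sample that are equal to `a`. -/
def frequency {𝕏 : Type*} {d : ℕ} {n : Fin d → ℕ} (x : (j : Fin d) → Fin (n j) → 𝕏)
    (a : 𝕏) (j : Fin d) : ℕ :=
  open Classical in
  (Finset.univ.filter fun i : Fin (n j) => x j i = a).card

/-- Partially exchangeable samples: conditionally on `(μ 1, …, μ d)`, all the observations `X j i`
are independent, those of the group `j` having law `μ j / μ j (𝕏)`. -/
structure IsSample {Ω : Type*} [MeasurableSpace Ω] (P : Measure Ω)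
    {𝕏 : Type*} [MeasurableSpace 𝕏] {d : ℕ} {n : Fin d → ℕ}
    (μ : Fin d → Ω → Measure 𝕏) (X : (j : Fin d) → Fin (n j) → Ω → 𝕏) : Prop where
  measurable : ∀ j i, Measurable (X j i)
  condLaw : ∀ C : Set (Fin d → Measure 𝕏), MeasurableSet C →
    ∀ B : (j : Fin d) → Fin (n j) → Set 𝕏, (∀ j i, MeasurableSet (B j i)) →
      P {ω | (fun j => μ j ω) ∈ C ∧ ∀ j i, X j i ω ∈ B j i} =
        ∫⁻ ω in {ω | (fun j => μ j ω) ∈ C}, ∏ j, ∏ i, normalized (μ j ω) (B j i) ∂P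

/-- The random elements on the right-hand side of the posterior representation for the observed
samples `x` and the values `u` of the latent variables: `μ' j` is the part without fixed atoms;
`σ a` and `T a j` are the jumps at the observed distinct value `a`. -/
structure IsPosteriorRepresentation {Ω : Type*} [MeasurableSpace Ω] (P : Measure Ω)
    {𝕏 : Type*} [MeasurableSpace 𝕏] {d : ℕ} {n : Fin d → ℕ}
    (f : ℝ → ℝ≥0) (ν : Measure ℝ) (α : Measure 𝕏)
    (x : (j : Fin d) → Fin (n j) → 𝕏) (u : Fin d → ℝ)
    (μ' : Fin d → Ω → Measure 𝕏) (σ : distinctValues x → Ω → ℝ)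
    (T : distinctValues x → Fin d → Ω → ℝ) : Prop where
  compound : IsCompoundVector P (fun j s => tiltedScoreLaw f (u j) s) (updatedLevy f ν u) α μ'
  measurable_sigma : ∀ a, Measurable (σ a)
  measurable_jump : ∀ a j, Measurable (T a j)
  /-- `σ a` has law `sigmaLaw`; given `σ a = s`, the `T a j` are independent with laws `jumpLaw`. -/
  jumps_law : ∀ (a : distinctValues x) (A : Set ℝ) (B : Fin d → Set ℝ), MeasurableSet A →
    (∀ j, MeasurableSet (B j)) →
      P {ω | σ a ω ∈ A ∧ ∀ j, T a j ω ∈ B j} =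
        ∫⁻ s in A, ∏ j, jumpLaw f (u j) (frequency x a j) s (B j)
          ∂(sigmaLaw f ν u (frequency x a))
  jumps_indep : iIndepFun (fun a ω => (σ a ω, fun j => T a j ω)) P
  parts_indep : IndepFun (fun ω j => μ' j ω) (fun ω a => (σ a ω, fun j => T a j ω)) P

/-- The vector with components `μ' j + ∑_a T a j * σ a • δ_a`, the sum being over the distinct
values `a` of the samples `x`. -/
def posteriorVector {Ω : Type*} {𝕏 : Type*} [MeasurableSpace 𝕏] {d : ℕ} {n : Fin d → ℕ}
    (x : (j : Fin d) → Fin (n j) → 𝕏)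
    (μ' : Fin d → Ω → Measure 𝕏) (σ : distinctValues x → Ω → ℝ)
    (T : distinctValues x → Fin d → Ω → ℝ) (ω : Ω) (j : Fin d) : Measure 𝕏 :=
  μ' j ω + ∑ a, ENNReal.ofReal (T a j ω * σ a ω) • Measure.dirac (a : 𝕏)

end

end CoRM

/-! ### Exponentials and Laplace transforms on `[0, ∞]` -/

namespace CoRM

open Filter Topology

noncomputable section

/-! The law of a random vector of measures is determined by its Laplace functional H ↦ E exp(-⟨H,
μ⟩), where ⟨H, μ⟩ = ∑_j ∫ H_j dμ_j and the H_j range over measurable functions with values in [0, ∞]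
(`ext_of_laplace_pairing`). The posterior is therefore identified by computing one conditional
Laplace functional.

Let ρ be the law "ν then d independent scores" of the jump vectors w = (t_1 s, …, t_d s)
(`jumpMeasure`). Integrating out the scores and applying the Laplace functional of a Poisson random
measure gives E exp(-⟨H, μ⟩) = exp(-ψ(H)) with ψ(H) = ∫∫ (1 - e^{-H(x)·w}) ρ(dw) α(dx)
(`laplace_iid`).

Given μ, the density of U_j is a weight in u_j times T_j^{n_j} e^{-u_j T_j}, with T_j = μ_j(𝕏)
(`map_div_gammaMeasure`). The power of T_j cancels the normalization of the n_j observations, and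
the exponential turns ⟨H, μ⟩ into ⟨H + u, μ⟩. What remains is the moment E[exp(-⟨H + u, μ⟩) ∏
μ_j(dx_{j,i})].

These moments have densities with respect to a single measure D on samples that does not depend on H
(`exists_moment_measure`). The density is Φ(x, H) = exp(-ψ(H)) ∏_a M_{k_a}(H(a)), the product over
the distinct values a of x with multiplicities k_a, where M_k(θ) = ∫ w^k e^{-θ·w} ρ(dw). The proof
is by induction on the number of points: a new factor μ_j(B) is a derivative of the Laplace
functional in the direction 1_B. By the product rule, differentiating exp(-ψ) creates a new point
distributed according to α, which is almost surely distinct from the others because α is diffuse,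
while differentiating M_{k_a}(H(a)) repeats the value a.

Hence (X, U) has density weight(u) Φ(x, u) and the conditional Laplace functional is Φ(x, H + u) /
Φ(x, u) (`map_withDensity_expNeg_pairing`). This quotient factorizes. The factor exp(-(ψ(H + u) -
ψ(u))) belongs to the compound vector with tilted scores and updated Lévy measure
(`laplace_tilted`), and each M_k(H(a) + u) / M_k(u) to the jumps at an observed value
(`laplace_jumps`); see `IsPosteriorRepresentation.laplace`. The same formula makes the family of
posterior laws measurable, shows that it disintegrates the joint law, and shows that every
representation has the same law. Existence of a representation comes from reweighting P by exp(-⟨u,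
μ⟩) (`IsCompoundVector.tilt`). -/

/-- The function `a ↦ e^{-a}` on `[0, ∞]`. -/
def expNeg (a : ℝ≥0∞) : ℝ≥0∞ := (EReal.exp a)⁻¹

lemma expNeg_zero : expNeg 0 = 1 := by simp [expNeg]

lemma expNeg_top : expNeg ∞ = 0 := by simp [expNeg]

lemma expNeg_ofReal {r : ℝ} (hr : 0 ≤ r) :
    expNeg (ENNReal.ofReal r) = ENNReal.ofReal (Real.exp (-r)) := by
  rw [expNeg, EReal.coe_ennreal_ofReal, max_eq_left hr, EReal.exp_coe, Real.exp_neg,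
    ENNReal.ofReal_inv_of_pos (Real.exp_pos _)]

lemma expNeg_eq_ofReal {a : ℝ≥0∞} (ha : a ≠ ∞) :
    expNeg a = ENNReal.ofReal (Real.exp (-a.toReal)) := by
  conv_lhs => rw [← ENNReal.ofReal_toReal ha]
  exact expNeg_ofReal ENNReal.toReal_nonneg

lemma continuous_expNeg : Continuous expNeg :=
  continuous_inv.comp (ENNReal.continuous_exp.comp continuous_coe_ennreal_ereal)

@[fun_prop]
lemma measurable_expNeg : Measurable expNeg := continuous_expNeg.measurable

lemma expNeg_strictAnti : StrictAnti expNeg := fun a b h =>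
  ENNReal.inv_lt_inv.2 (EReal.exp_strictMono (by exact_mod_cast h))

lemma expNeg_antitone : Antitone expNeg := expNeg_strictAnti.antitone

lemma expNeg_le_one (a : ℝ≥0∞) : expNeg a ≤ 1 :=
  expNeg_zero ▸ expNeg_antitone zero_le

lemma expNeg_ne_top (a : ℝ≥0∞) : expNeg a ≠ ∞ :=
  ne_top_of_le_ne_top ENNReal.one_ne_top (expNeg_le_one a)

lemma expNeg_eq_zero_iff {a : ℝ≥0∞} : expNeg a = 0 ↔ a = ∞ := by
  rw [← expNeg_top, expNeg_strictAnti.injective.eq_iff]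

lemma expNeg_add (a b : ℝ≥0∞) : expNeg (a + b) = expNeg a * expNeg b := by
  rw [expNeg, EReal.coe_ennreal_add, EReal.exp_add, ENNReal.mul_inv] <;> simp [expNeg]

lemma expNeg_sum {ι : Type*} (s : Finset ι) (a : ι → ℝ≥0∞) :
    expNeg (∑ i ∈ s, a i) = ∏ i ∈ s, expNeg (a i) := by
  classical
  induction s using Finset.induction_on with
  | empty => simp [expNeg_zero]
  | insert i s hi ih => rw [Finset.sum_insert hi, Finset.prod_insert hi, expNeg_add, ih]

lemma tendsto_prod_expNeg (a : ℕ → ℝ≥0∞) :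
    Tendsto (fun I => ∏ i ∈ Finset.range I, expNeg (a i)) atTop (𝓝 (expNeg (∑' i, a i))) := by
  simp_rw [← expNeg_sum]
  exact (continuous_expNeg.tendsto _).comp ENNReal.summable.hasSum.tendsto_sum_nat

/-- The inverse of `expNeg` on `[0, 1]`. -/
def negLog (b : ℝ≥0∞) : ℝ≥0∞ := (ENNReal.log b⁻¹).toENNReal

@[fun_prop]
lemma measurable_negLog : Measurable negLog :=
  (ENNReal.measurable_log.comp measurable_inv).ereal_toENNReal

lemma expNeg_negLog {b : ℝ≥0∞} (hb : b ≤ 1) : expNeg (negLog b) = b := by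
  rw [expNeg, negLog, EReal.coe_toENNReal, ENNReal.exp_log, inv_inv]
  simpa using hb

/-- Tonelli's theorem for products of functions of the coordinates. -/
lemma lintegral_pi_prod {ι : Type*} [Fintype ι] {E : Type*} [MeasurableSpace E]
    (μ : ι → Measure E) [∀ i, SigmaFinite (μ i)] {f : ι → E → ℝ≥0∞} (hf : ∀ i, Measurable (f i)) :
    ∫⁻ x, ∏ i, f i (x i) ∂(Measure.pi μ) = ∏ i, ∫⁻ x, f i x ∂(μ i) := by
  have key : ∀ (n : ℕ) (μ : Fin n → Measure E) [∀ i, SigmaFinite (μ i)] (f : Fin n → E → ℝ≥0∞),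
      (∀ i, Measurable (f i)) →
      ∫⁻ x, ∏ i, f i (x i) ∂(Measure.pi μ) = ∏ i, ∫⁻ x, f i x ∂(μ i) := by
    intro n
    induction n with
    | zero => intro μ _ f hf; simp
    | succ n ih =>
      intro μ _ f hf
      have h := (measurePreserving_piFinSuccAbove μ 0).symm
      rw [← h.lintegral_comp_emb (MeasurableEquiv.measurableEmbedding _)]
      simp_rw [Fin.prod_univ_succ, MeasurableEquiv.piFinSuccAbove_symm_apply,
        Fin.insertNthEquiv, Equiv.coe_fn_mk, Fin.insertNth_zero, Fin.cons_zero, Fin.cons_succ,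
        cast_eq]
      rw [lintegral_prod_mul (f := fun x => f 0 x)
        (g := fun x : Fin n → E => ∏ i, f (Fin.succ i) (x i)) (hf 0).aemeasurable
        (Measurable.aemeasurable (by fun_prop))]
      congr 1
      exact ih (fun j => μ (Fin.succAbove 0 j)) (fun i => f i.succ) fun i => hf _
  let e := (Fintype.equivFin ι).symm
  have h := measurePreserving_piCongrLeft (fun i : ι => μ i) e
  rw [← h.lintegral_comp_emb (MeasurableEquiv.measurableEmbedding _), ← e.prod_comp]
  rw [← key _ _ _ fun i => hf (e i)]
  refine lintegral_congr fun x => ?_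
  rw [← e.prod_comp]
  refine Finset.prod_congr rfl fun i _ => ?_
  congr 1
  exact Equiv.piCongrLeft_apply_apply (fun _ => E) e x i

/-- Ramps of slope `n` ending at `c` decrease to the indicator of `[c, ∞)`; Weierstrass replaces
each by a polynomial within `1 / (n + 1)`. The bound 2 is 1 for the ramp plus 1 for the error, and
serves as a dominating constant later. -/
lemma exists_polynomial_tendsto_indicator (c : ℝ) :
    ∃ p : ℕ → Polynomial ℝ, (∀ n, ∀ x ∈ Icc (0 : ℝ) 1, |(p n).eval x| ≤ 2) ∧
      ∀ x ∈ Icc (0 : ℝ) 1, Tendsto (fun n => (p n).eval x) atTop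
        (𝓝 ((Ici c).indicator (fun _ => 1) x)) := by
  let F : ℕ → ℝ → ℝ := fun n x => max 0 (min 1 (1 - n * (c - x)))
  have hF : ∀ n, Continuous (F n) := fun n => by fun_prop
  have hF0 : ∀ n x, 0 ≤ F n x := fun n x => le_max_left _ _
  have hF1 : ∀ n x, F n x ≤ 1 := fun n x => max_le zero_le_one (min_le_left _ _)
  choose p hp using fun n : ℕ => exists_polynomial_near_of_continuousOn 0 1 (F n)
    (hF n).continuousOn (1 / ((n : ℝ) + 1)) (by positivity)
  refine ⟨p, fun n x hx => ?_, fun x hx => ?_⟩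
  · have h1 := abs_lt.1 (hp n x hx)
    have h2 : 1 / ((n : ℝ) + 1) ≤ 1 := by
      rw [div_le_one (by positivity)]; linarith [n.cast_nonneg (α := ℝ)]
    rw [abs_le]
    constructor <;> linarith [h1.1, h1.2, hF0 n x, hF1 n x]
  · have hlim : Tendsto (fun n => F n x) atTop (𝓝 ((Ici c).indicator (fun _ => 1) x)) := by
      by_cases hc : c ≤ x
      · rw [indicator_of_mem (by exact hc)]
        refine tendsto_const_nhds.congr fun n => ?_
        have : (n : ℝ) * (c - x) ≤ 0 := mul_nonpos_of_nonneg_of_nonpos n.cast_nonneg (by linarith)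
        simp only [F]
        rw [min_eq_left (by linarith), max_eq_right zero_le_one]
      · rw [indicator_of_notMem (by simpa using hc)]
        push Not at hc
        obtain ⟨N, hN⟩ := exists_nat_gt (1 / (c - x))
        refine tendsto_const_nhds.congr' ?_
        filter_upwards [eventually_ge_atTop N] with n hn
        have h1 : 1 / (c - x) < n := hN.trans_le (by exact_mod_cast hn)
        rw [div_lt_iff₀ (by linarith)] at h1
        simp only [F]
        rw [max_eq_left]
        exact (min_le_right _ _).trans (by linarith)
    have hz : Tendsto (fun n => (p n).eval x - F n x) atTop (𝓝 0) :=
      squeeze_zero_norm (fun n => (hp n x hx).le) tendsto_one_div_add_atTop_nhds_zero_nat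
    simpa using hz.add hlim

/-- A family of finite measures depends measurably on a parameter as soon as its Laplace transforms
do, for an additive class of functions that generates the `σ`-algebra. -/
theorem measurable_of_laplace {E T : Type*} [mE : MeasurableSpace E] [MeasurableSpace T]
    (𝒴 : AddSubmonoid (E → ℝ≥0∞)) (hm : ∀ Y ∈ 𝒴, Measurable Y)
    (hgen : mE ≤ ⨆ Y : 𝒴, MeasurableSpace.comap (Y : E → ℝ≥0∞) inferInstance)
    (K : T → Measure E) [∀ t, IsFiniteMeasure (K t)]
    (hK : ∀ Y ∈ 𝒴, Measurable fun t => ∫⁻ y, expNeg (Y y) ∂(K t)) : Measurable K := by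
  classical
  let φ : (E → ℝ≥0∞) → E → ℝ := fun Y y => (expNeg (Y y)).toReal
  have hφm : ∀ Y ∈ 𝒴, Measurable (φ Y) := fun Y hY => by
    have := hm Y hY
    fun_prop
  have hφ0 : ∀ Y y, φ Y y ∈ Icc (0 : ℝ) 1 := fun Y y =>
    ⟨ENNReal.toReal_nonneg, ENNReal.toReal_le_of_le_ofReal zero_le_one (by
      simpa using expNeg_le_one _)⟩
  -- Since the class of the `Y` is additive, the functions `e^{-Y}` are closed under products. The
  -- algebra they generate is thus their linear span, on which measurability of the integrals
  -- extends by linearity.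
  let Sφ : Submonoid (E → ℝ) :=
    { carrier := {g | ∃ Y ∈ 𝒴, g = φ Y}
      mul_mem' := by
        rintro _ _ ⟨Y, hY, rfl⟩ ⟨Z, hZ, rfl⟩
        refine ⟨Y + Z, 𝒴.add_mem hY hZ, ?_⟩
        ext y
        simp [φ, expNeg_add]
      one_mem' := ⟨0, 𝒴.zero_mem, by ext y; simp [φ, expNeg_zero]⟩ }
  let A : Subalgebra ℝ (E → ℝ) := Algebra.adjoin ℝ (Sφ : Set (E → ℝ))
  have hA : ∀ g ∈ A, Measurable g ∧ (∃ C, ∀ y, |g y| ≤ C) ∧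
      Measurable fun t => ∫ y, g y ∂(K t) := by
    intro g hg
    have hg' : g ∈ Submodule.span ℝ (Sφ : Set (E → ℝ)) := by
      have : g ∈ Subalgebra.toSubmodule A := hg
      rwa [Algebra.adjoin_eq_span, Submonoid.closure_eq] at this
    clear hg
    induction hg' using Submodule.span_induction with
    | mem g h =>
      obtain ⟨Y, hY, rfl⟩ := h
      refine ⟨hφm Y hY, ⟨1, fun y => ?_⟩, ?_⟩
      · rw [abs_of_nonneg (hφ0 Y y).1]; exact (hφ0 Y y).2
      · have : ∀ t, ∫ y, φ Y y ∂(K t) = (∫⁻ y, expNeg (Y y) ∂(K t)).toReal := fun t => by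
          refine integral_toReal ?_ (ae_of_all _ fun y => (expNeg_ne_top _).lt_top)
          have := hm Y hY
          fun_prop
        simp_rw [this]
        exact (hK Y hY).ennreal_toReal
    | zero => exact ⟨measurable_zero, ⟨0, fun y => by simp⟩, by simp⟩
    | add g h hg hh ihg ihh =>
      obtain ⟨m1, ⟨C1, b1⟩, i1⟩ := ihg
      obtain ⟨m2, ⟨C2, b2⟩, i2⟩ := ihh
      refine ⟨m1.add m2, ⟨C1 + C2, fun y => (abs_add_le _ _).trans (add_le_add (b1 y) (b2 y))⟩, ?_⟩
      have : ∀ t, ∫ y, (g + h) y ∂(K t) = ∫ y, g y ∂(K t) + ∫ y, h y ∂(K t) := fun t =>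
        integral_add (Integrable.of_bound m1.aestronglyMeasurable C1 (ae_of_all _ b1))
          (Integrable.of_bound m2.aestronglyMeasurable C2 (ae_of_all _ b2))
      simp_rw [this]
      exact i1.add i2
    | smul a g hg ihg =>
      obtain ⟨m1, ⟨C1, b1⟩, i1⟩ := ihg
      refine ⟨m1.const_smul a, ⟨|a| * C1, fun y => ?_⟩, ?_⟩
      · simp only [Pi.smul_apply, smul_eq_mul, abs_mul]
        exact mul_le_mul_of_nonneg_left (b1 y) (abs_nonneg _)
      · have : ∀ t, ∫ y, (a • g) y ∂(K t) = a * ∫ y, g y ∂(K t) := fun t => by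
          simp [integral_const_mul]
        simp_rw [this]
        exact i1.const_mul a
  -- Finite intersections of superlevel sets of the `e^{-Y}` form a generating π-system, because `Y`
  -- is recovered from `e^{-Y}` by `negLog`.
  let π : 𝒴 → Set (Set E) := fun Y => {s | ∃ c : ℝ, s = φ Y ⁻¹' Ici c}
  have hπ : ∀ Y, IsPiSystem (π Y) := by
    rintro Y _ ⟨a, rfl⟩ _ ⟨b, rfl⟩ -
    exact ⟨max a b, by rw [← preimage_inter, Ici_inter_Ici]⟩
  have hπgen : ∀ Y : 𝒴, MeasurableSpace.comap (Y : E → ℝ≥0∞) inferInstance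
      ≤ MeasurableSpace.generateFrom (π Y) := by
    intro Y
    rw [← measurable_iff_comap_le]
    have h1 : @Measurable E ℝ (MeasurableSpace.generateFrom (π Y)) _ (φ Y) := by
      let := MeasurableSpace.generateFrom (π Y)
      refine measurable_of_Ici fun c => ?_
      exact MeasurableSpace.measurableSet_generateFrom ⟨c, rfl⟩
    have h2 : (Y : E → ℝ≥0∞) = fun y => negLog (ENNReal.ofReal (φ Y y)) := by
      ext y
      refine expNeg_strictAnti.injective ?_
      rw [ENNReal.ofReal_toReal (expNeg_ne_top _), expNeg_negLog (expNeg_le_one _)]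
    rw [h2]
    exact measurable_negLog.comp (ENNReal.measurable_ofReal.comp h1)
  have hgen' : mE = MeasurableSpace.generateFrom (piiUnionInter π univ) := by
    refine le_antisymm (hgen.trans (iSup_le fun Y => (hπgen Y).trans ?_)) ?_
    · exact le_generateFrom_piiUnionInter univ (mem_univ Y)
    · refine generateFrom_piiUnionInter_le _ (fun Y => ?_) _
      refine MeasurableSpace.generateFrom_le ?_
      rintro _ ⟨c, rfl⟩
      exact hφm Y Y.2 measurableSet_Ici
  refine Measurable.measure_of_isPiSystem hgen' (isPiSystem_piiUnionInter π hπ univ) ?_ ?_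
  · rintro s ⟨t, -, f, hf, rfl⟩
    have hc : ∀ Y : 𝒴, ∃ c : ℝ, Y ∈ t → f Y = φ Y ⁻¹' Ici c := fun Y => by
      by_cases h : Y ∈ t
      · obtain ⟨c, hc⟩ := hf Y h
        exact ⟨c, fun _ => hc⟩
      · exact ⟨0, fun h' => (h h').elim⟩
    choose c hc using hc
    choose p hp1 hp2 using exists_polynomial_tendsto_indicator
    -- Products of polynomials in the `e^{-Y}` stay in the algebra and converge boundedly to the
    -- indicator of the intersection.
    let g : ℕ → E → ℝ := fun n y => ∏ Y ∈ t, (p (c Y) n).eval (φ Y y)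
    have hgA : ∀ n, g n ∈ A := fun n => by
      have : g n = ∏ Y ∈ t, Polynomial.aeval (φ Y) (p (c Y) n) := by
        ext y
        rw [Finset.prod_apply]
        refine Finset.prod_congr rfl fun Y _ => ?_
        rw [Polynomial.aeval_pi_apply₂, Polynomial.coe_aeval_eq_eval]
      rw [this]
      refine Subalgebra.prod_mem _ fun Y _ => ?_
      refine Algebra.adjoin_mono ?_ (Polynomial.aeval_mem_adjoin_singleton ℝ (φ Y))
      rintro _ rfl
      exact ⟨Y, Y.2, rfl⟩
    have hs : MeasurableSet (⋂ Y ∈ t, f Y) :=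
      Finset.measurableSet_biInter _ fun Y hY => hc Y hY ▸ hφm Y Y.2 measurableSet_Ici
    have hlim : ∀ y, Tendsto (fun n => g n y) atTop
        (𝓝 ((⋂ Y ∈ t, f Y).indicator (fun _ => (1 : ℝ)) y)) := fun y => by
      have h1 : (⋂ Y ∈ t, f Y).indicator (fun _ => (1 : ℝ)) y =
          ∏ Y ∈ t, (Ici (c Y)).indicator (fun _ => 1) (φ Y y) := by
        by_cases hy : y ∈ ⋂ Y ∈ t, f Y
        · rw [indicator_of_mem hy, Finset.prod_eq_one]
          intro Y hY
          have := mem_iInter₂.1 hy Y hY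
          rw [hc Y hY] at this
          rw [indicator_of_mem (by exact this)]
        · rw [indicator_of_notMem hy]
          simp only [mem_iInter, not_forall] at hy
          obtain ⟨Y, hY, hy⟩ := hy
          rw [hc Y hY] at hy
          exact (Finset.prod_eq_zero hY (indicator_of_notMem (by exact hy) _)).symm
      rw [h1]
      exact tendsto_finsetProd _ fun Y _ => hp2 _ _ (hφ0 _ _)
    have hint : Measurable fun a => ∫ y, (⋂ Y ∈ t, f Y).indicator (fun _ => (1 : ℝ)) y ∂(K a) := by
      refine measurable_of_tendsto_metrizable (fun n => (hA _ (hgA n)).2.2)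
        (tendsto_pi_nhds.2 fun a => ?_)
      refine tendsto_integral_of_dominated_convergence (fun _ => 2 ^ t.card)
        (fun n => (hA _ (hgA n)).1.aestronglyMeasurable) (integrable_const _)
        (fun n => ae_of_all _ fun y => ?_) (ae_of_all _ hlim)
      rw [Real.norm_eq_abs, Finset.abs_prod]
      refine (Finset.prod_le_prod (fun _ _ => abs_nonneg _)
        fun Y _ => hp1 (c Y) n _ (hφ0 Y y)).trans ?_
      rw [Finset.prod_const]
    have : (fun a => K a (⋂ Y ∈ t, f Y)) = fun a => ENNReal.ofReal
        (∫ y, (⋂ Y ∈ t, f Y).indicator (fun _ => (1 : ℝ)) y ∂(K a)) := by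
      ext a
      rw [integral_indicator hs, setIntegral_const, smul_eq_mul, mul_one, measureReal_def,
        ENNReal.ofReal_toReal (measure_ne_top _ _)]
    rw [this]
    exact hint.ennreal_ofReal
  · simpa [expNeg_zero] using hK 0 𝒴.zero_mem

/-- Finite measures with equal Laplace transforms on an additive class of functions that generates
the `σ`-algebra are equal. -/
theorem ext_of_laplace {E : Type*} [mE : MeasurableSpace E]
    (𝒴 : AddSubmonoid (E → ℝ≥0∞)) (hm : ∀ Y ∈ 𝒴, Measurable Y)
    (hgen : mE ≤ ⨆ Y : 𝒴, MeasurableSpace.comap (Y : E → ℝ≥0∞) inferInstance)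
    (μ ν : Measure E) [IsFiniteMeasure μ] [IsFiniteMeasure ν]
    (h : ∀ Y ∈ 𝒴, ∫⁻ y, expNeg (Y y) ∂μ = ∫⁻ y, expNeg (Y y) ∂ν) : μ = ν := by
  -- Uniqueness is deduced from measurability: `Bool` carries the trivial σ-algebra, for which the
  -- constant Laplace transforms are measurable. Then `K` is measurable too, so each `K · s` has
  -- trivial level sets and is constant.
  let K : Bool → Measure E := fun b => bif b then μ else ν
  have hfin : ∀ b, IsFiniteMeasure (K b) := by
    intro b; cases b <;> simp only [K, cond_true, cond_false] <;> infer_instance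
  have hK : @Measurable Bool _ ⊥ _ K := by
    refine @measurable_of_laplace E Bool mE ⊥ 𝒴 hm hgen K hfin fun Y hY => ?_
    have : (fun b => ∫⁻ y, expNeg (Y y) ∂(K b)) = fun _ => ∫⁻ y, expNeg (Y y) ∂μ := by
      ext b; cases b <;> simp [K, h Y hY]
    rw [this]
    exact @measurable_const _ _ _ ⊥ _
  ext s hs
  have h1 : @MeasurableSet Bool ⊥ ((fun b => K b s) ⁻¹' {μ s}) :=
    (@Measurable.comp _ _ _ ⊥ _ _ _ _ (Measure.measurable_coe hs) hK) (measurableSet_singleton _)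
  rcases MeasurableSpace.measurableSet_bot_iff.1 h1 with h2 | h2
  · have : true ∈ ((fun b => K b s) ⁻¹' {μ s}) := by simp [K]
    rw [h2] at this
    exact this.elim
  · have : false ∈ ((fun b => K b s) ⁻¹' {μ s}) := by rw [h2]; trivial
    simpa [K] using this.symm

/-- Finite measures on `[0, ∞]^ι` are determined by their Laplace transforms. -/
theorem ext_of_laplace_pi {ι : Type*} [Fintype ι] (μ ν : Measure (ι → ℝ≥0∞))
    [IsFiniteMeasure μ] [IsFiniteMeasure ν]
    (h : ∀ c : ι → ℝ≥0∞, ∫⁻ y, expNeg (∑ i, c i * y i) ∂μ = ∫⁻ y, expNeg (∑ i, c i * y i) ∂ν) :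
    μ = ν := by
  classical
  let 𝒴 : AddSubmonoid ((ι → ℝ≥0∞) → ℝ≥0∞) :=
    { carrier := {Y | ∃ c : ι → ℝ≥0∞, Y = fun y => ∑ i, c i * y i}
      add_mem' := by
        rintro _ _ ⟨c, rfl⟩ ⟨c', rfl⟩
        exact ⟨c + c', by ext y; simp [add_mul, Finset.sum_add_distrib]⟩
      zero_mem' := ⟨0, by ext y; simp⟩ }
  refine ext_of_laplace 𝒴 ?_ ?_ μ ν ?_
  · rintro _ ⟨c, rfl⟩
    fun_prop
  · refine iSup_le fun i => ?_
    refine le_iSup_of_le ⟨fun y => y i, Pi.single i 1, ?_⟩ le_rfl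
    ext y
    simp [Pi.single_apply]
  · rintro _ ⟨c, rfl⟩
    exact h c

end

end CoRM

/-! ### Laplace functionals of vectors of measures -/

namespace CoRM

open Filter Topology

noncomputable section

/-- The integral of `H` with respect to the vector of measures `μ`. -/
def pairing {𝕏 : Type*} [MeasurableSpace 𝕏] {d : ℕ} (H : Fin d → 𝕏 → ℝ≥0∞)
    (μ : Fin d → Measure 𝕏) : ℝ≥0∞ :=
  ∑ j, ∫⁻ x, H j x ∂(μ j)

section pairing

variable {𝕏 : Type*} [MeasurableSpace 𝕏] {d : ℕ}

lemma measurable_pairing {H : Fin d → 𝕏 → ℝ≥0∞} (hH : ∀ j, Measurable (H j)) :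
    Measurable (pairing H) :=
  Finset.measurable_fun_sum _ fun j _ =>
    (Measure.measurable_lintegral (hH j)).comp (measurable_pi_apply j)

lemma pairing_add {H H' : Fin d → 𝕏 → ℝ≥0∞} (hH : ∀ j, Measurable (H j))
    (μ : Fin d → Measure 𝕏) : pairing (H + H') μ = pairing H μ + pairing H' μ := by
  simp only [pairing, Pi.add_apply, ← Finset.sum_add_distrib]
  exact Finset.sum_congr rfl fun j _ => lintegral_add_left (hH j) _

variable (𝕏 d) in
/-- The pairings with measurable functions. -/
def pairings : AddSubmonoid ((Fin d → Measure 𝕏) → ℝ≥0∞) where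
  carrier := {Y | ∃ H : Fin d → 𝕏 → ℝ≥0∞, (∀ j, Measurable (H j)) ∧ Y = pairing H}
  add_mem' := by
    rintro _ _ ⟨H, hH, rfl⟩ ⟨H', hH', rfl⟩
    refine ⟨H + H', fun j => (hH j).add (hH' j), ?_⟩
    ext μ
    exact (pairing_add hH μ).symm
  zero_mem' := ⟨0, fun j => measurable_zero, by ext μ; simp [pairing]⟩

/-- The evaluations `μ ↦ μ j s` generate the σ-algebra, and each is the pairing with the indicator
of `s` in coordinate `j`. -/
lemma le_iSup_comap_pairings :
    (inferInstance : MeasurableSpace (Fin d → Measure 𝕏)) ≤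
      ⨆ Y : pairings 𝕏 d, MeasurableSpace.comap (Y : (Fin d → Measure 𝕏) → ℝ≥0∞) inferInstance := by
  classical
  refine iSup_le fun j => ?_
  rw [← measurable_iff_comap_le]
  refine @Measure.measurable_of_measurable_coe _ _ _ (_) _ fun s hs => ?_
  rw [measurable_iff_comap_le]
  refine le_iSup_of_le ⟨fun μ => μ j s, Pi.single j (s.indicator 1), fun i => ?_, ?_⟩ le_rfl
  · rcases eq_or_ne i j with rfl | h
    · rw [Pi.single_eq_same]
      exact measurable_one.indicator hs
    · rw [Pi.single_eq_of_ne h]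
      exact measurable_zero
  · ext μ
    rw [pairing, Finset.sum_eq_single j]
    · rw [Pi.single_eq_same, lintegral_indicator_one hs]
    · intro i _ h
      simp [Pi.single_eq_of_ne h]
    · simp

theorem measurable_of_laplace_pairing {T : Type*} [MeasurableSpace T]
    (K : T → Measure (Fin d → Measure 𝕏)) [∀ t, IsFiniteMeasure (K t)]
    (hK : ∀ H : Fin d → 𝕏 → ℝ≥0∞, (∀ j, Measurable (H j)) →
      Measurable fun t => ∫⁻ μ, expNeg (pairing H μ) ∂(K t)) : Measurable K := by
  refine measurable_of_laplace (pairings 𝕏 d) ?_ le_iSup_comap_pairings K ?_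
  · rintro _ ⟨H, hH, rfl⟩
    exact measurable_pairing hH
  · rintro _ ⟨H, hH, rfl⟩
    exact hK H hH

theorem ext_of_laplace_pairing (K K' : Measure (Fin d → Measure 𝕏)) [IsFiniteMeasure K]
    [IsFiniteMeasure K'] (h : ∀ H : Fin d → 𝕏 → ℝ≥0∞, (∀ j, Measurable (H j)) →
      ∫⁻ μ, expNeg (pairing H μ) ∂K = ∫⁻ μ, expNeg (pairing H μ) ∂K') : K = K' := by
  refine ext_of_laplace (pairings 𝕏 d) ?_ le_iSup_comap_pairings K K' ?_
  · rintro _ ⟨H, hH, rfl⟩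
    exact measurable_pairing hH
  · rintro _ ⟨H, hH, rfl⟩
    exact h H hH

end pairing

/-! ### Poisson random measures and their Laplace functionals -/

section Poisson

lemma expNeg_mul_nat (c : ℝ≥0∞) (k : ℕ) : expNeg (c * k) = expNeg c ^ k := by
  rw [mul_comm, ← nsmul_eq_mul]
  induction k with
  | zero => simp [expNeg_zero]
  | succ k ih => rw [succ_nsmul, expNeg_add, ih, pow_succ]

/-- With `q = e^{-c}` this is the generating function of the Poisson law, summed by the exponential
series. The value `c = ∞` is covered by `q = 0`. -/
lemma lintegral_expNeg_poissonMeasure (c : ℝ≥0∞) (r : ℝ≥0) :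
    ∫⁻ k : ℕ, expNeg (c * k) ∂(poissonMeasure r) = expNeg ((1 - expNeg c) * r) := by
  lift expNeg c to ℝ≥0 using expNeg_ne_top c with q hq
  have hq1 : q ≤ 1 := by
    have := expNeg_le_one c
    rw [← hq] at this
    exact_mod_cast this
  have hsum : HasSum (fun k : ℕ => (q : ℝ) ^ k * (Real.exp (-r) * (r : ℝ) ^ k / k.factorial))
      (Real.exp (-r) * Real.exp (q * r)) := by
    have h := (NormedSpace.expSeries_div_hasSum_exp ((q : ℝ) * r)).mul_left (Real.exp (-r))
    rw [← Real.exp_eq_exp_ℝ] at h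
    convert! h using 1
    ext k
    rw [mul_pow]
    ring
  have hterm : ∀ k : ℕ, expNeg (c * k) * poissonMeasure r {k} =
      ENNReal.ofReal ((q : ℝ) ^ k * (Real.exp (-r) * (r : ℝ) ^ k / k.factorial)) := fun k => by
    rw [expNeg_mul_nat, ← hq, poissonMeasure_singleton, ENNReal.ofReal_mul (by positivity)]
    congr 1
    rw [ENNReal.ofReal_pow q.coe_nonneg, ENNReal.ofReal_coe_nnreal]
  rw [lintegral_countable']
  simp_rw [hterm]
  rw [← ENNReal.ofReal_tsum_of_nonneg (fun k => by positivity) hsum.summable, hsum.tsum_eq,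
    ← Real.exp_add]
  have h2 : (1 - (q : ℝ≥0∞)) * r = ENNReal.ofReal ((1 - q) * r) := by
    rw [ENNReal.ofReal_mul (by simpa using hq1), ENNReal.ofReal_coe_nnreal,
      ENNReal.ofReal_sub _ q.coe_nonneg, ENNReal.ofReal_one, ENNReal.ofReal_coe_nnreal]
  rw [h2, expNeg_ofReal (mul_nonneg (by simpa using hq1) r.coe_nonneg)]
  congr 2
  ring

variable {Ω : Type*} [MeasurableSpace Ω] {P : Measure Ω} {E : Type*} [MeasurableSpace E]
  {N : Ω → Measure E} {Λ : Measure E}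

lemma IsPoissonRandomMeasure.laplace_set [IsProbabilityMeasure P]
    (hN : IsPoissonRandomMeasure P N Λ) (c : ℝ≥0∞) {B : Set E} (hB : MeasurableSet B) :
    ∫⁻ ω, expNeg (c * N ω B) ∂P = expNeg ((1 - expNeg c) * Λ B) := by
  have hNB : Measurable fun ω => N ω B := (Measure.measurable_coe hB).comp hN.measurable
  by_cases h : Λ B = ∞
  · rcases eq_or_ne c 0 with rfl | hc
    · simp [expNeg_zero]
    · have h1 : ∀ᵐ ω ∂P, expNeg (c * N ω B) = 0 := by
        filter_upwards [hN.law_top B hB h] with ω hω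
        rw [hω, ENNReal.mul_top hc, expNeg_top]
      have h2 : 1 - expNeg c ≠ 0 := by
        rw [Ne, tsub_eq_zero_iff_le, not_le, ← expNeg_zero]
        exact expNeg_strictAnti (pos_iff_ne_zero.2 hc)
      rw [lintegral_congr_ae h1, h, ENNReal.mul_top h2, expNeg_top, lintegral_zero]
  · have h1 : ∫⁻ y, expNeg (c * y) ∂(P.map fun ω => N ω B) = ∫⁻ ω, expNeg (c * N ω B) ∂P :=
      lintegral_map (by fun_prop) hNB
    rw [← h1, hN.law B hB h, lintegral_map (by fun_prop) .of_discrete,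
      lintegral_expNeg_poissonMeasure, ENNReal.coe_toNNReal h]

/-- The fibres of a simple function are disjoint, so their masses are independent and the transform
factorizes over the values. -/
lemma IsPoissonRandomMeasure.laplace_simpleFunc [IsProbabilityMeasure P]
    (hN : IsPoissonRandomMeasure P N Λ) (s : SimpleFunc E ℝ≥0∞) :
    ∫⁻ ω, expNeg (∫⁻ e, s e ∂(N ω)) ∂P = expNeg (∫⁻ e, (1 - expNeg (s e)) ∂Λ) := by
  have hB : ∀ c, MeasurableSet (s ⁻¹' {c}) := fun c => s.measurableSet_fiber c
  let r := s.range
  let e := r.equivFin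
  have hmeas : ∀ i : Fin r.card, Measurable fun ω => N ω (s ⁻¹' {(e.symm i : ℝ≥0∞)}) := fun i =>
    (Measure.measurable_coe (hB _)).comp hN.measurable
  have hind := hN.indep r.card (fun i => s ⁻¹' {(e.symm i : ℝ≥0∞)}) (fun i => hB _) (by
    intro i i' hii
    refine Disjoint.preimage _ (disjoint_singleton.2 fun h => hii ?_)
    exact e.symm.injective (Subtype.ext h))
  have hind2 := hind.comp (fun i y => expNeg ((e.symm i : ℝ≥0∞) * y)) fun i => by fun_prop
  have hreal : ∀ (M : Measure E) (f : ℝ≥0∞ → ℝ≥0∞), ∫⁻ x, f (s x) ∂M =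
      ∑ i : Fin r.card, f (e.symm i : ℝ≥0∞) * M (s ⁻¹' {(e.symm i : ℝ≥0∞)}) := fun M f => by
    have h1 : ∫⁻ x, f (s x) ∂M = (s.map f).lintegral M := by
      rw [← SimpleFunc.lintegral_eq_lintegral]
      rfl
    rw [h1, SimpleFunc.map_lintegral, ← Finset.sum_coe_sort, ← e.symm.sum_comp]
  simp_rw [hreal _ fun c => c, hreal Λ fun c => 1 - expNeg c, expNeg_sum]
  refine (lintegral_prod_eq_prod_lintegral_of_indepFun Finset.univ _ hind2 fun i => ?_).trans ?_
  · have := hmeas i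
    simp only [Function.comp_def]
    fun_prop
  · exact Finset.prod_congr rfl fun i _ => hN.laplace_set _ (hB _)

/-- The Laplace functional of a Poisson random measure. -/
theorem IsPoissonRandomMeasure.laplace [IsProbabilityMeasure P]
    (hN : IsPoissonRandomMeasure P N Λ) {h : E → ℝ≥0∞} (hh : Measurable h) :
    ∫⁻ ω, expNeg (∫⁻ e, h e ∂(N ω)) ∂P = expNeg (∫⁻ e, (1 - expNeg (h e)) ∂Λ) := by
  let s := SimpleFunc.eapprox h
  have hs : ∀ n, Measurable (s n) := fun n => (s n).measurable
  have hmono : ∀ e, Monotone fun n => s n e := fun e n m hnm => SimpleFunc.monotone_eapprox h hnm e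
  have h1 : Tendsto (fun n => ∫⁻ ω, expNeg (∫⁻ e, s n e ∂(N ω)) ∂P) atTop
      (𝓝 (∫⁻ ω, expNeg (∫⁻ e, h e ∂(N ω)) ∂P)) := by
    refine tendsto_lintegral_of_dominated_convergence (fun _ => 1) (fun n => ?_)
      (fun n => ae_of_all _ fun ω => expNeg_le_one _) (by simp) (ae_of_all _ fun ω => ?_)
    · exact measurable_expNeg.comp ((Measure.measurable_lintegral (hs n)).comp hN.measurable)
    · exact (continuous_expNeg.tendsto _).comp (lintegral_tendsto_of_tendsto_of_monotone
        (fun n => (hs n).aemeasurable) (ae_of_all _ fun e => hmono e)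
        (ae_of_all _ fun e => SimpleFunc.tendsto_eapprox hh e))
  have h2 : Tendsto (fun n => expNeg (∫⁻ e, (1 - expNeg (s n e)) ∂Λ)) atTop
      (𝓝 (expNeg (∫⁻ e, (1 - expNeg (h e)) ∂Λ))) := by
    refine (continuous_expNeg.tendsto _).comp (lintegral_tendsto_of_tendsto_of_monotone
      (fun n => ?_) (ae_of_all _ fun e n m hnm => ?_) (ae_of_all _ fun e => ?_))
    · have := hs n
      exact Measurable.aemeasurable (by fun_prop)
    · exact tsub_le_tsub_left (expNeg_antitone (hmono e hnm)) _
    · exact ((ENNReal.continuous_sub_left ENNReal.one_ne_top).tendsto _).comp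
        ((continuous_expNeg.tendsto _).comp (SimpleFunc.tendsto_eapprox hh e))
  refine tendsto_nhds_unique h1 ?_
  simp_rw [s, hN.laplace_simpleFunc]
  exact h2

/-- A random measure with the Laplace functional of a Poisson random measure is Poisson. -/
theorem isPoissonRandomMeasure_of_laplace [IsProbabilityMeasure P] (hm : Measurable N)
    (hN : ∀ h : E → ℝ≥0∞, Measurable h →
      ∫⁻ ω, expNeg (∫⁻ e, h e ∂(N ω)) ∂P = expNeg (∫⁻ e, (1 - expNeg (h e)) ∂Λ)) :
    IsPoissonRandomMeasure P N Λ := by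
  classical
  have hNm : ∀ B, MeasurableSet B → Measurable fun ω => N ω B := fun B hB =>
    (Measure.measurable_coe hB).comp hm
  -- For `h = ∑ c_i 1_{B_i}` with disjoint `B_i`, at most one term is nonzero at each point, so `1 -
  -- e^{-h}` splits into a sum. The joint transform of the masses therefore factorizes, which gives
  -- both the marginal laws and independence.
  have hset : ∀ (k : ℕ) (B : Fin k → Set E), (∀ i, MeasurableSet (B i)) →
      Pairwise (fun i i' => Disjoint (B i) (B i')) → ∀ c : Fin k → ℝ≥0∞,
      ∫⁻ ω, expNeg (∑ i, c i * N ω (B i)) ∂P = ∏ i, expNeg ((1 - expNeg (c i)) * Λ (B i)) := by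
    intro k B hB hdisj c
    have hint : ∀ (M : Measure E) (a : Fin k → ℝ≥0∞),
        ∫⁻ e, ∑ i, (B i).indicator (fun _ => a i) e ∂M = ∑ i, a i * M (B i) := fun M a => by
      rw [lintegral_finsetSum _ fun i _ => measurable_const.indicator (hB i)]
      exact Finset.sum_congr rfl fun i _ => lintegral_indicator_const (hB i) _
    have h1 := hN (fun e => ∑ i, (B i).indicator (fun _ => c i) e)
      (Finset.measurable_fun_sum _ fun i _ => measurable_const.indicator (hB i))
    have h2 : ∀ e, 1 - expNeg (∑ i, (B i).indicator (fun _ => c i) e) =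
        ∑ i, (B i).indicator (fun _ => 1 - expNeg (c i)) e := fun e => by
      by_cases he : ∃ i, e ∈ B i
      · obtain ⟨i, hi⟩ := he
        have hne : ∀ i', i' ≠ i → e ∉ B i' := fun i' h he' => (hdisj h).ne_of_mem he' hi rfl
        rw [Finset.sum_eq_single i, Finset.sum_eq_single i, indicator_of_mem hi,
          indicator_of_mem hi]
        · intro i' _ h; exact indicator_of_notMem (hne i' h) _
        · simp
        · intro i' _ h; exact indicator_of_notMem (hne i' h) _
        · simp
      · push Not at he
        simp [he, expNeg_zero]
    simp_rw [h2, hint] at h1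
    rw [h1, expNeg_sum]
  have hone : ∀ (B : Set E), MeasurableSet B → ∀ c : ℝ≥0∞,
      ∫⁻ ω, expNeg (c * N ω B) ∂P = expNeg ((1 - expNeg c) * Λ B) := fun B hB c => by
    simpa using hset 1 (fun _ => B) (fun _ => hB)
      (fun i i' h => (h (Subsingleton.elim _ _)).elim) fun _ => c
  refine ⟨hm, fun B hB hfin => ?_, fun B hB htop => ?_, fun k B hB hdisj => ?_⟩
  · let 𝒴 : AddSubmonoid (ℝ≥0∞ → ℝ≥0∞) :=
      { carrier := {Y | ∃ c : ℝ≥0∞, Y = fun y => c * y}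
        add_mem' := by
          rintro _ _ ⟨c, rfl⟩ ⟨c', rfl⟩
          exact ⟨c + c', by ext y; simp [add_mul]⟩
        zero_mem' := ⟨0, by ext y; simp⟩ }
    have := Measure.isProbabilityMeasure_map (μ := P) (hNm B hB).aemeasurable
    refine ext_of_laplace 𝒴 ?_ ?_ _ _ ?_
    · rintro _ ⟨c, rfl⟩; fun_prop
    · exact le_iSup_of_le ⟨fun y => y, 1, by simp⟩ (MeasurableSpace.comap_id).ge
    · rintro _ ⟨c, rfl⟩
      rw [lintegral_map (by fun_prop) (hNm B hB), lintegral_map (by fun_prop) .of_discrete,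
        lintegral_expNeg_poissonMeasure, ENNReal.coe_toNNReal hfin, hone B hB]
  -- When `Λ B = ∞` the transform at `c = 1` vanishes, which forces `N B = ∞` almost surely.
  · have h1 := hone B hB 1
    have h2 : 1 - expNeg 1 ≠ 0 := by
      rw [Ne, tsub_eq_zero_iff_le, not_le]
      exact expNeg_zero ▸ expNeg_strictAnti (a := 0) (b := 1) zero_lt_one
    rw [htop, ENNReal.mul_top h2, expNeg_top, lintegral_eq_zero_iff (by
      have := hNm B hB
      fun_prop)] at h1
    filter_upwards [h1] with ω hω
    simpa [expNeg_eq_zero_iff] using hω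
  · rw [iIndepFun_iff_map_fun_eq_pi_map fun i => (hNm _ (hB i)).aemeasurable]
    have hp : ∀ i, IsProbabilityMeasure (P.map fun ω => N ω (B i)) := fun i =>
      Measure.isProbabilityMeasure_map (hNm _ (hB i)).aemeasurable
    have hmeas : Measurable fun ω i => N ω (B i) := measurable_pi_lambda _ fun i => hNm _ (hB i)
    have := Measure.isProbabilityMeasure_map (μ := P) hmeas.aemeasurable
    refine ext_of_laplace_pi _ _ fun c => ?_
    rw [lintegral_map (by fun_prop) hmeas, hset k B hB hdisj]
    simp_rw [expNeg_sum]
    rw [lintegral_pi_prod (f := fun i y => expNeg (c i * y)) _ fun i => by fun_prop]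
    refine Finset.prod_congr rfl fun i _ => ?_
    rw [lintegral_map (by fun_prop) (hNm _ (hB i)), hone _ (hB i)]

end Poisson

end

end CoRM

/-! ### Integrating out the scores; the Laplace functional of a compound vector -/

namespace CoRM

open Filter Topology

noncomputable section

/-- Finite measures on `A × E^ι` are determined by their values on boxes. -/
lemma ext_prod_pi {A ι E : Type*} [MeasurableSpace A] [Fintype ι] [MeasurableSpace E]
    {μ ν : Measure (A × (ι → E))} [IsFiniteMeasure μ]
    (h : ∀ (C : Set A) (B : ι → Set E), MeasurableSet C → (∀ i, MeasurableSet (B i)) →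
      μ (C ×ˢ univ.pi B) = ν (C ×ˢ univ.pi B)) : μ = ν := by
  have hgen : (inferInstance : MeasurableSpace (A × (ι → E))) = MeasurableSpace.generateFrom
      (image2 (· ×ˢ ·) {C : Set A | MeasurableSet C}
        (pi univ '' pi univ fun _ : ι => {B : Set E | MeasurableSet B})) := by
    refine (generateFrom_eq_prod MeasurableSpace.generateFrom_measurableSet generateFrom_pi
      isCountablySpanning_measurableSet ?_).symm
    exact IsCountablySpanning.pi fun _ => isCountablySpanning_measurableSet
  refine ext_of_generate_finite _ hgen (MeasurableSpace.isPiSystem_measurableSet.prod isPiSystem_pi) ?_ ?_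
  · rintro _ ⟨C, hC, _, ⟨B, hB, rfl⟩, rfl⟩
    exact h C B hC fun i => hB i (mem_univ i)
  · simpa using h univ (fun _ => univ) .univ fun _ => .univ

lemma measurable_measure_pi {T ι E : Type*} [MeasurableSpace T] [Fintype ι] [MeasurableSpace E]
    {κ : ι → T → Measure E} [∀ i t, IsProbabilityMeasure (κ i t)] (hκ : ∀ i, Measurable (κ i)) :
    Measurable fun t => Measure.pi fun i => κ i t := by
  refine Measurable.measure_of_isPiSystem_of_isProbabilityMeasure generateFrom_pi.symm
    isPiSystem_pi ?_
  rintro _ ⟨B, hB, rfl⟩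
  simp_rw [Measure.pi_pi]
  exact Finset.measurable_fun_prod _ fun i _ =>
    (Measure.measurable_coe (hB i (mem_univ i))).comp (hκ i)

section Scores

variable {Ω : Type*} [MeasurableSpace Ω] {P : Measure Ω} {𝕏 : Type*} [MeasurableSpace 𝕏] {d : ℕ}
  {J : ℕ → Ω → ℝ} {x : ℕ → Ω → 𝕏} {m : ℕ → Fin d → Ω → ℝ}

/-- The conditional law is given on boxes only. Boxes determine the joint law of all points and the
first `I` rows of scores, which is therefore the law of the points composed with a product kernel;
Tonelli then integrates the scores one by one. -/
lemma IsScoreArray.lintegral_prod [IsProbabilityMeasure P] (G : Fin d → Kernel ℝ ℝ)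
    [∀ j, IsMarkovKernel (G j)] (hm : IsScoreArray P (fun j s => G j s) J x m)
    (hJ : ∀ i, Measurable (J i)) (hx : ∀ i, Measurable (x i))
    {g : (ℕ → ℝ × 𝕏) → ℝ≥0∞} (hg : Measurable g) {a : ℕ → Fin d → ℝ × 𝕏 → ℝ → ℝ≥0∞}
    (ha : ∀ i j, Measurable (Function.uncurry (a i j))) (I : ℕ) :
    ∫⁻ ω, g (fun i => (J i ω, x i ω)) *
        ∏ i ∈ Finset.range I, ∏ j, a i j (J i ω, x i ω) (m i j ω) ∂P =
      ∫⁻ ω, g (fun i => (J i ω, x i ω)) *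
        ∏ i ∈ Finset.range I, ∏ j, ∫⁻ t, a i j (J i ω, x i ω) t ∂(G j (J i ω)) ∂P := by
  let z : Ω → ℕ → ℝ × 𝕏 := fun ω i => (J i ω, x i ω)
  have hz : Measurable z := measurable_pi_lambda _ fun i => (hJ i).prodMk (hx i)
  let S : Kernel (ℕ → ℝ × 𝕏) (Fin I × Fin d → ℝ) :=
    { toFun := fun z => Measure.pi fun p => G p.2 (z p.1).1
      measurable' := measurable_measure_pi (κ := fun (p : Fin I × Fin d) (z : ℕ → ℝ × 𝕏) => G p.2 (z p.1).1)
        fun p => (G p.2).measurable.comp (by fun_prop) }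
  have hS : ∀ z, S z = Measure.pi fun p : Fin I × Fin d => G p.2 (z p.1).1 := fun z => rfl
  have : IsMarkovKernel S := ⟨fun z => by rw [hS]; infer_instance⟩
  let w : Ω → Fin I × Fin d → ℝ := fun ω p => m p.1 p.2 ω
  have hw : Measurable w := measurable_pi_lambda _ fun p => hm.measurable_score _ _
  have hzw : Measurable fun ω => (z ω, w ω) := hz.prodMk hw
  have : IsProbabilityMeasure (P.map z) := Measure.isProbabilityMeasure_map hz.aemeasurable
  have := Measure.isProbabilityMeasure_map (μ := P) hzw.aemeasurable
  have joint : P.map (fun ω => (z ω, w ω)) = (P.map z) ⊗ₘ S := by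
    refine ext_prod_pi fun C B hC hB => ?_
    rw [Measure.compProd_apply_prod hC (MeasurableSet.univ_pi hB),
      Measure.map_apply hzw (hC.prod (MeasurableSet.univ_pi hB)),
      setLIntegral_map hC (S.measurable_coe (MeasurableSet.univ_pi hB)) hz]
    -- The rows beyond `I` are unconstrained, so any measurable set may be put there.
    have h := hm.condLaw C hC I (fun i j => if h : i < I then B (⟨i, h⟩, j) else univ)
      fun i j => by split_ifs <;> [exact hB _; exact .univ]
    have h1 : {ω | (fun i => (J i ω, x i ω)) ∈ C ∧ ∀ i < I, ∀ j,
        m i j ω ∈ if h : i < I then B (⟨i, h⟩, j) else univ} =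
        (fun ω => (z ω, w ω)) ⁻¹' (C ×ˢ univ.pi B) := by
      ext ω
      simp only [mem_ofPred_eq, mem_preimage, mem_prod, mem_univ_pi]
      refine and_congr Iff.rfl ⟨fun h p => ?_, fun h i hi j => ?_⟩
      · simpa using h p.1 p.1.2 p.2
      · rw [dif_pos hi]
        exact h (⟨i, hi⟩, j)
    rw [← h1, h]
    refine lintegral_congr fun ω => ?_
    rw [hS, Measure.pi_pi, Fintype.prod_prod_type, Finset.prod_range]
    refine Finset.prod_congr rfl fun i _ => Finset.prod_congr rfl fun j _ => ?_
    simp [z]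
  let F : (ℕ → ℝ × 𝕏) × (Fin I × Fin d → ℝ) → ℝ≥0∞ := fun q =>
    g q.1 * ∏ p : Fin I × Fin d, a p.1 p.2 (q.1 p.1) (q.2 p)
  have hF : Measurable F := by
    refine (hg.comp measurable_fst).mul (Finset.measurable_fun_prod _ fun p _ => ?_)
    exact (ha p.1 p.2).comp (Measurable.prodMk (by fun_prop) (by fun_prop))
  have h1 := lintegral_map (μ := P) hF hzw
  rw [joint, Measure.lintegral_compProd hF, lintegral_map hF.lintegral_kernel_prod_right' hz] at h1
  refine Eq.trans ?_ (h1.symm.trans ?_)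
  · refine lintegral_congr fun ω => ?_
    simp only [F, Fintype.prod_prod_type, Finset.prod_range]
    rfl
  · refine lintegral_congr fun ω => ?_
    simp only [F]
    rw [lintegral_const_mul _ (by
      refine Finset.measurable_fun_prod _ fun p _ => ?_
      exact (ha p.1 p.2).comp (Measurable.prodMk measurable_const (by fun_prop))), hS,
      lintegral_pi_prod (f := fun (p : Fin I × Fin d) t => a p.1 p.2 (z ω p.1) t) _
        fun p => (ha p.1 p.2).comp (Measurable.prodMk measurable_const measurable_id),
      Fintype.prod_prod_type, Finset.prod_range]

/-- The scores may be integrated out in infinite products of functions with values in `[0, 1]`. -/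
lemma IsScoreArray.lintegral_tendsto_prod [IsProbabilityMeasure P] (G : Fin d → Kernel ℝ ℝ)
    [∀ j, IsMarkovKernel (G j)] (hm : IsScoreArray P (fun j s => G j s) J x m)
    (hJ : ∀ i, Measurable (J i)) (hx : ∀ i, Measurable (x i))
    {g : (ℕ → ℝ × 𝕏) → ℝ≥0∞} (hg : Measurable g) (hg1 : ∀ z, g z ≤ 1)
    {a : ℕ → Fin d → ℝ × 𝕏 → ℝ → ℝ≥0∞} (ha : ∀ i j, Measurable (Function.uncurry (a i j)))
    (ha1 : ∀ i j z t, a i j z t ≤ 1) {A A' : Ω → ℝ≥0∞}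
    (hA : ∀ᵐ ω ∂P, Tendsto (fun I => ∏ i ∈ Finset.range I, ∏ j, a i j (J i ω, x i ω) (m i j ω))
      atTop (𝓝 (A ω)))
    (hA' : ∀ᵐ ω ∂P, Tendsto (fun I => ∏ i ∈ Finset.range I, ∏ j,
      ∫⁻ t, a i j (J i ω, x i ω) t ∂(G j (J i ω))) atTop (𝓝 (A' ω))) :
    ∫⁻ ω, g (fun i => (J i ω, x i ω)) * A ω ∂P = ∫⁻ ω, g (fun i => (J i ω, x i ω)) * A' ω ∂P := by
  have hz : Measurable fun ω i => (J i ω, x i ω) :=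
    measurable_pi_lambda _ fun i => (hJ i).prodMk (hx i)
  have hgt : ∀ z, g z ≠ ∞ := fun z => ne_top_of_le_ne_top ENNReal.one_ne_top (hg1 z)
  have h1 : Tendsto (fun I => ∫⁻ ω, g (fun i => (J i ω, x i ω)) *
      ∏ i ∈ Finset.range I, ∏ j, a i j (J i ω, x i ω) (m i j ω) ∂P) atTop
      (𝓝 (∫⁻ ω, g (fun i => (J i ω, x i ω)) * A ω ∂P)) := by
    refine tendsto_lintegral_of_dominated_convergence (fun _ => 1) (fun I => ?_)
      (fun I => ae_of_all _ fun ω => ?_) (by simp) ?_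
    · refine (hg.comp hz).mul (Finset.measurable_fun_prod _ fun i _ =>
        Finset.measurable_fun_prod _ fun j _ => ?_)
      exact (ha i j).comp (((hJ i).prodMk (hx i)).prodMk (hm.measurable_score i j))
    · exact mul_le_one' (hg1 _) (Finset.prod_le_one' fun i _ =>
        Finset.prod_le_one' fun j _ => ha1 _ _ _ _)
    · filter_upwards [hA] with ω hω
      exact ENNReal.Tendsto.const_mul hω (Or.inr (hgt _))
  have h2 : Tendsto (fun I => ∫⁻ ω, g (fun i => (J i ω, x i ω)) *
      ∏ i ∈ Finset.range I, ∏ j, ∫⁻ t, a i j (J i ω, x i ω) t ∂(G j (J i ω)) ∂P) atTop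
      (𝓝 (∫⁻ ω, g (fun i => (J i ω, x i ω)) * A' ω ∂P)) := by
    refine tendsto_lintegral_of_dominated_convergence (fun _ => 1) (fun I => ?_)
      (fun I => ae_of_all _ fun ω => ?_) (by simp) ?_
    · refine (hg.comp hz).mul (Finset.measurable_fun_prod _ fun i _ =>
        Finset.measurable_fun_prod _ fun j _ => ?_)
      have h3 : Measurable fun y : ℝ × 𝕏 => ∫⁻ t, a i j y t ∂((G j).comap Prod.fst measurable_fst y) :=
        (ha i j).lintegral_kernel_prod_right'
      exact h3.comp ((hJ i).prodMk (hx i))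
    · refine mul_le_one' (hg1 _) (Finset.prod_le_one' fun i _ =>
        Finset.prod_le_one' fun j _ => ?_)
      exact (lintegral_mono fun t => ha1 _ _ _ _).trans (by simp)
    · filter_upwards [hA'] with ω hω
      exact ENNReal.Tendsto.const_mul hω (Or.inr (hgt _))
  simp_rw [hm.lintegral_prod G hJ hx hg ha] at h1
  exact tendsto_nhds_unique h1 h2

lemma IsPoissonRandomMeasure.ae_eq_zero {E : Type*} [MeasurableSpace E] {N : Ω → Measure E}
    {Λ : Measure E} (hN : IsPoissonRandomMeasure P N Λ) {B : Set E} (hB : MeasurableSet B)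
    (h : Λ B = 0) : ∀ᵐ ω ∂P, N ω B = 0 := by
  have h1 := hN.law B hB (by simp [h])
  have hNB : Measurable fun ω => N ω B := (Measure.measurable_coe hB).comp hN.measurable
  rw [h, ENNReal.toNNReal_zero] at h1
  have h2 : P.map (fun ω => N ω B) {0}ᶜ =
      (poissonMeasure 0).map (fun k : ℕ => (k : ℝ≥0∞)) {0}ᶜ := by rw [h1]
  rw [Measure.map_apply hNB (measurableSet_singleton _).compl,
    Measure.map_apply .of_discrete (measurableSet_singleton _).compl] at h2
  have h3 : (fun k : ℕ => (k : ℝ≥0∞)) ⁻¹' {0}ᶜ = {0}ᶜ := by ext k; simp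
  rw [h3, (prob_compl_eq_zero_iff (measurableSet_singleton _)).2
    (by rw [poissonMeasure_singleton]; simp)] at h2
  exact h2

lemma IsCRMSeries.ae_pos {ν : Measure ℝ} {α : Measure 𝕏} [SFinite α] (h : IsCRMSeries P ν α J x)
    (hν : ν (Iic 0) = 0) : ∀ᵐ ω ∂P, ∀ i, 0 < J i ω := by
  have hB : MeasurableSet (Iic (0 : ℝ) ×ˢ (univ : Set 𝕏)) := measurableSet_Iic.prod .univ
  filter_upwards [h.poisson.ae_eq_zero hB (by rw [Measure.prod_prod, hν, zero_mul])] with ω hω i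
  rw [Measure.sum_apply _ hB, ENNReal.tsum_eq_zero] at hω
  have := hω i
  rw [Measure.dirac_apply' _ hB, indicator_apply_eq_zero] at this
  by_contra hi
  simpa using this ⟨not_lt.1 hi, mem_univ _⟩

/-- A measurable family of laws, turned into a Markov kernel off the positive half-line. -/
def posKernel (G : ℝ → Measure ℝ) (hG : Measurable G) : Kernel ℝ ℝ where
  toFun s := if 0 < s then G s else Measure.dirac 0
  measurable' := Measurable.ite measurableSet_Ioi hG measurable_const

lemma posKernel_apply {G : ℝ → Measure ℝ} (hG : Measurable G) {s : ℝ} (hs : 0 < s) :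
    posKernel G hG s = G s := if_pos hs

lemma isMarkovKernel_posKernel {G : ℝ → Measure ℝ} (hG : Measurable G)
    (hG1 : ∀ s, 0 < s → IsProbabilityMeasure (G s)) : IsMarkovKernel (posKernel G hG) := by
  refine ⟨fun s => ?_⟩
  change IsProbabilityMeasure (if 0 < s then G s else Measure.dirac 0)
  split_ifs with hs
  · exact hG1 s hs
  · infer_instance

/-- Heights are almost surely positive, so the values of `G` off the positive half-line are
irrelevant. This matters because the tilted score laws are known to be probability measures only at
positive heights. -/
lemma IsScoreArray.posKernel {G : Fin d → ℝ → Measure ℝ} (hG : ∀ j, Measurable (G j))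
    (hm : IsScoreArray P G J x m) (hpos : ∀ᵐ ω ∂P, ∀ i, 0 < J i ω) :
    IsScoreArray P (fun j s => posKernel (G j) (hG j) s) J x m := by
  refine ⟨hm.measurable_score, fun C hC I B hB => ?_⟩
  rw [hm.condLaw C hC I B hB]
  refine lintegral_congr_ae (ae_restrict_of_ae ?_)
  filter_upwards [hpos] with ω hω
  simp only [posKernel_apply _ (hω _)]

lemma pairing_sum {H : Fin d → 𝕏 → ℝ≥0∞} (hH : ∀ j, Measurable (H j)) (w : ℕ → Fin d → ℝ≥0∞)
    (y : ℕ → 𝕏) : pairing H (fun j => Measure.sum fun i => w i j • Measure.dirac (y i)) =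
      ∑' i, ∑ j, H j (y i) * w i j := by
  simp only [pairing, lintegral_sum_measure, lintegral_smul_measure, smul_eq_mul]
  rw [Summable.tsum_finsetSum fun _ _ => ENNReal.summable]
  refine Finset.sum_congr rfl fun j _ => tsum_congr fun i => ?_
  rw [lintegral_dirac' _ (hH j), mul_comm]

/-- The Laplace functional of a compound random vector of measures. -/
theorem IsCompoundVector.laplace [IsProbabilityMeasure P] {G : Fin d → ℝ → Measure ℝ}
    {ν : Measure ℝ} {α : Measure 𝕏} [SFinite α] [SFinite ν] {μ : Fin d → Ω → Measure 𝕏}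
    (hμ : IsCompoundVector P G ν α μ)
    (hG : ∀ j, Measurable (G j)) (hG1 : ∀ j s, 0 < s → IsProbabilityMeasure (G j s))
    (hν : ν (Iic 0) = 0) {H : Fin d → 𝕏 → ℝ≥0∞} (hH : ∀ j, Measurable (H j)) :
    ∫⁻ ω, expNeg (pairing H fun j => μ j ω) ∂P =
      expNeg (∫⁻ p, (1 - ∏ j, ∫⁻ t, expNeg (H j p.2 * ENNReal.ofReal (t * p.1)) ∂(G j p.1))
        ∂(ν.prod α)) := by
  obtain ⟨J, x, m, hJx, hm, hsum⟩ := hμ.series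
  have hpos := hJx.ae_pos hν
  have hm' := hm.posKernel hG hpos
  have : ∀ j, IsMarkovKernel (CoRM.posKernel (G j) (hG j)) := fun j =>
    isMarkovKernel_posKernel (hG j) (hG1 j)
  let K : Fin d → Kernel ℝ ℝ := fun j => CoRM.posKernel (G j) (hG j)
  let a : ℕ → Fin d → ℝ × 𝕏 → ℝ → ℝ≥0∞ := fun _ j z t => expNeg (H j z.2 * ENNReal.ofReal (t * z.1))
  have ha : ∀ i j, Measurable (Function.uncurry (a i j)) := fun i j => by
    have := hH j
    simp only [a, Function.uncurry_def]
    fun_prop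
  let b : ℝ × 𝕏 → ℝ≥0∞ := fun z => ∏ j, ∫⁻ t, a 0 j z t ∂(K j z.1)
  have hb1 : ∀ z, b z ≤ 1 := fun z => Finset.prod_le_one' fun j _ =>
    (lintegral_mono fun t => expNeg_le_one _).trans (by simp)
  have hb : Measurable b := Finset.measurable_fun_prod _ fun j _ => by
    have h3 : Measurable fun y : ℝ × 𝕏 => ∫⁻ t, a 0 j y t ∂((K j).comap Prod.fst measurable_fst y) :=
      (ha 0 j).lintegral_kernel_prod_right'
    exact h3
  -- Once the scores are integrated out, each atom contributes a factor `b (J i, x i) ≤ 1`. Writing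
  -- the product as the exponential of minus the integral of `negLog b` against the Poisson measure
  -- makes its Laplace functional applicable.
  have key := hm'.lintegral_tendsto_prod K hJx.measurable_height hJx.measurable_location
    (g := fun _ => 1) measurable_const (fun _ => le_rfl) ha (fun i j z t => expNeg_le_one _)
    (A := fun ω => expNeg (pairing H fun j => μ j ω))
    (A' := fun ω => expNeg (∫⁻ e, negLog (b e) ∂(Measure.sum fun i => Measure.dirac (J i ω, x i ω))))
    (by
      filter_upwards [hsum] with ω hω
      have h1 : (fun j => μ j ω) = fun j => Measure.sum fun i =>
        ENNReal.ofReal (m i j ω * J i ω) • Measure.dirac (x i ω) := funext hω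
      rw [h1, pairing_sum hH]
      have := tendsto_prod_expNeg fun i => ∑ j, H j (x i ω) * ENNReal.ofReal (m i j ω * J i ω)
      simp only [expNeg_sum] at this
      exact this)
    (by
      refine ae_of_all _ fun ω => ?_
      have h1 : ∀ y, ∫⁻ e, negLog (b e) ∂(Measure.dirac y) = negLog (b y) := fun y =>
        lintegral_dirac' _ (measurable_negLog.comp hb)
      rw [lintegral_sum_measure]
      simp_rw [h1]
      have := tendsto_prod_expNeg fun i => negLog (b (J i ω, x i ω))
      simp_rw [expNeg_negLog (hb1 _)] at this
      exact this)
  simp only [one_mul] at key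
  refine (key.trans (hJx.poisson.laplace (measurable_negLog.comp hb))).trans ?_
  congr 1
  have hae : ∀ᵐ p ∂(ν.prod α), 0 < p.1 := by
    rw [ae_iff]
    have : {p : ℝ × 𝕏 | ¬ 0 < p.1} = Iic 0 ×ˢ univ := by ext p; simp
    rw [this, Measure.prod_prod, hν, zero_mul]
  refine lintegral_congr_ae ?_
  filter_upwards [hae] with p hp
  rw [expNeg_negLog (hb1 p)]
  simp only [b, K, posKernel_apply _ hp, a]

end Scores

end

end CoRM

/-! ### Score laws under exponential tilting -/

namespace CoRM

open Filter Topology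

noncomputable section

lemma pi_withDensity {ι E : Type*} [Fintype ι] [MeasurableSpace E] (μ : ι → Measure E)
    [∀ i, SigmaFinite (μ i)] {g : ι → E → ℝ≥0∞} (hg : ∀ i, Measurable (g i))
    [∀ i, SigmaFinite ((μ i).withDensity (g i))] :
    Measure.pi (fun i => (μ i).withDensity (g i)) =
      (Measure.pi μ).withDensity fun x => ∏ i, g i (x i) := by
  refine Measure.pi_eq fun B hB => ?_
  rw [withDensity_apply _ (MeasurableSet.univ_pi hB), Measure.restrict_pi_pi, lintegral_pi_prod _ hg]
  exact Finset.prod_congr rfl fun i _ => (withDensity_apply _ (hB i)).symm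

/-- The inequality `y^k / k! ≤ e^y` at `y = v a` gives the constant `k! / v^k`. The real `v` is a
positive minorant of `u`, needed because `u` may be infinite. -/
lemma exists_pow_mul_expNeg_le (k : ℕ) {u : ℝ≥0∞} (hu : u ≠ 0) :
    ∃ C : ℝ≥0∞, C ≠ ∞ ∧ ∀ a : ℝ≥0, (a : ℝ≥0∞) ^ k * expNeg (u * a) ≤ C := by
  obtain ⟨v, hv0, hvu⟩ : ∃ v : ℝ≥0, 0 < v ∧ (v : ℝ≥0∞) ≤ u := by
    obtain ⟨v, hv, hv'⟩ := ENNReal.lt_iff_exists_nnreal_btwn.1 (pos_iff_ne_zero.2 hu)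
    exact ⟨v, by exact_mod_cast hv, hv'.le⟩
  refine ⟨ENNReal.ofReal (k.factorial / (v : ℝ) ^ k), ENNReal.ofReal_ne_top, fun a => ?_⟩
  have h1 : expNeg (u * a) ≤ ENNReal.ofReal (Real.exp (-(v * a : ℝ))) := by
    rw [← expNeg_ofReal (by positivity), ENNReal.ofReal_mul v.coe_nonneg]
    simp only [ENNReal.ofReal_coe_nnreal]
    exact expNeg_antitone (by gcongr)
  calc (a : ℝ≥0∞) ^ k * expNeg (u * a)
      ≤ ENNReal.ofReal ((a : ℝ) ^ k) * ENNReal.ofReal (Real.exp (-(v * a : ℝ))) := by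
        rw [ENNReal.ofReal_pow a.coe_nonneg, ENNReal.ofReal_coe_nnreal]
        gcongr
    _ = ENNReal.ofReal ((a : ℝ) ^ k * Real.exp (-(v * a : ℝ))) := by
        rw [ENNReal.ofReal_mul (by positivity)]
    _ ≤ _ := by
        refine ENNReal.ofReal_le_ofReal ?_
        have h2 := Real.pow_div_factorial_le_exp (v * a : ℝ) (by positivity) k
        have h3 : (0 : ℝ) < v := by exact_mod_cast hv0
        have h4 : (0 : ℝ) < k.factorial := by positivity
        rw [div_le_iff₀ h4, mul_pow] at h2
        rw [le_div_iff₀ (by positivity), Real.exp_neg, mul_assoc, mul_comm, mul_assoc,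
          inv_mul_le_iff₀ (Real.exp_pos _)]
        exact h2

section ScoreMoments

variable {f : ℝ → ℝ≥0}

lemma isProbabilityMeasure_scoreLaw (hf_one : ∫⁻ m in Ioi (0 : ℝ), (f m : ℝ≥0∞) = 1) :
    IsProbabilityMeasure (scoreLaw f) :=
  ⟨by rw [scoreLaw, withDensity_apply _ .univ, Measure.restrict_univ, hf_one]⟩

lemma scoreLaw_ae_pos (hf : Measurable f) : ∀ᵐ t ∂(scoreLaw f), 0 < t := by
  rw [scoreLaw, ae_withDensity_iff (by fun_prop)]
  filter_upwards [ae_restrict_mem measurableSet_Ioi] with t ht _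
  exact ht

/-- The Laplace transform of the `k`-th moment measure of the scores, scaled by `s`. -/
def scoreMoment (f : ℝ → ℝ≥0) (θ : ℝ≥0∞) (k : ℕ) (s : ℝ) : ℝ≥0∞ :=
  ∫⁻ t, ENNReal.ofReal (t * s) ^ k * expNeg (θ * ENNReal.ofReal (t * s)) ∂(scoreLaw f)

instance : SFinite (scoreLaw f) := by unfold scoreLaw; infer_instance

lemma measurable_scoreMoment {T : Type*} [MeasurableSpace T] {θ : T → ℝ≥0∞} {s : T → ℝ}
    (hθ : Measurable θ) (hs : Measurable s) (k : ℕ) :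
    Measurable fun y => scoreMoment f (θ y) k (s y) := by
  unfold scoreMoment
  refine Measurable.lintegral_prod_right' (f := fun q : T × ℝ =>
    ENNReal.ofReal (q.2 * s q.1) ^ k * expNeg (θ q.1 * ENNReal.ofReal (q.2 * s q.1))) ?_
  fun_prop

lemma scoreMoment_ne_top (hf_one : ∫⁻ m in Ioi (0 : ℝ), (f m : ℝ≥0∞) = 1) {θ : ℝ≥0∞} (hθ : θ ≠ 0)
    (k : ℕ) (s : ℝ) : scoreMoment f θ k s ≠ ∞ := by
  have := isProbabilityMeasure_scoreLaw hf_one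
  obtain ⟨C, hC, h⟩ := exists_pow_mul_expNeg_le k hθ
  refine ne_top_of_le_ne_top hC ((lintegral_mono fun t => h _).trans ?_)
  simp

lemma scoreMoment_ne_zero (hf : Measurable f) (hf_one : ∫⁻ m in Ioi (0 : ℝ), (f m : ℝ≥0∞) = 1)
    {θ : ℝ≥0∞} (hθ : θ ≠ ∞) (k : ℕ) {s : ℝ} (hs : 0 < s) : scoreMoment f θ k s ≠ 0 := by
  have := isProbabilityMeasure_scoreLaw hf_one
  intro h
  rw [scoreMoment, lintegral_eq_zero_iff (by fun_prop)] at h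
  obtain ⟨t, ht0, ht⟩ := ((scoreLaw_ae_pos hf).and h).exists
  have h1 : ENNReal.ofReal (t * s) ≠ 0 := by
    rw [Ne, ENNReal.ofReal_eq_zero, not_le]
    exact mul_pos ht0 hs
  rcases mul_eq_zero.1 ht with h2 | h2
  · exact pow_ne_zero k h1 h2
  · exact ENNReal.mul_ne_top hθ ENNReal.ofReal_ne_top (expNeg_eq_zero_iff.1 h2)

lemma ofReal_density_eq {u s t : ℝ} (hu : 0 < u) (hs : 0 < s) (ht : 0 < t) (k : ℕ) :
    ENNReal.ofReal (Real.exp (-(s * u * t)) * t ^ k) * ENNReal.ofReal (s ^ k) =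
      ENNReal.ofReal (t * s) ^ k * expNeg (ENNReal.ofReal u * ENNReal.ofReal (t * s)) := by
  rw [← ENNReal.ofReal_mul hu.le, expNeg_ofReal (by positivity), ← ENNReal.ofReal_mul (by positivity),
    ← ENNReal.ofReal_pow (by positivity), ← ENNReal.ofReal_mul (by positivity)]
  congr 1
  rw [mul_pow]
  ring_nf

/-- The factor `s^k` turns the moment of the score `m` into the moment of the jump `m s`. All later
formulas are in terms of jumps. -/
lemma scoreIntegral_mul (hf : Measurable f) {u s : ℝ} (hu : 0 < u) (hs : 0 < s) (k : ℕ) :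
    scoreIntegral f u k s * ENNReal.ofReal (s ^ k) = scoreMoment f (ENNReal.ofReal u) k s := by
  rw [scoreIntegral, scoreMoment, scoreLaw, lintegral_withDensity_eq_lintegral_mul _ (by fun_prop)
    (by fun_prop), ← lintegral_mul_const _ (by fun_prop)]
  refine setLIntegral_congr_fun measurableSet_Ioi fun t ht => ?_
  simp only [Pi.mul_apply]
  rw [← ofReal_density_eq hu hs ht, show u * t * s = s * u * t by ring]
  ring

/-- Integrals with respect to `jumpLaw`. -/
lemma lintegral_jumpLaw (hf : Measurable f) {u s : ℝ} (hu : 0 < u) (hs : 0 < s) (k : ℕ)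
    {g : ℝ → ℝ≥0∞} (hg : Measurable g) :
    ∫⁻ t, g t ∂(jumpLaw f u k s) = (scoreMoment f (ENNReal.ofReal u) k s)⁻¹ *
      ∫⁻ t, g t * (ENNReal.ofReal (t * s) ^ k *
        expNeg (ENNReal.ofReal u * ENNReal.ofReal (t * s))) ∂(scoreLaw f) := by
  have hs0 : ENNReal.ofReal (s ^ k) ≠ 0 := by
    rw [Ne, ENNReal.ofReal_eq_zero, not_le]; positivity
  have h1 : ∀ g : ℝ → ℝ≥0∞, Measurable g → ∫⁻ t, g t * (ENNReal.ofReal (t * s) ^ k *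
        expNeg (ENNReal.ofReal u * ENNReal.ofReal (t * s))) ∂(scoreLaw f) =
      (∫⁻ t, g t ∂((volume.restrict (Ioi 0)).withDensity
        fun t => ENNReal.ofReal (Real.exp (-(s * u * t)) * t ^ k) * (f t : ℝ≥0∞))) *
        ENNReal.ofReal (s ^ k) := fun g hg => by
    rw [scoreLaw, lintegral_withDensity_eq_lintegral_mul _ (by fun_prop) (by fun_prop),
      lintegral_withDensity_eq_lintegral_mul _ (by fun_prop) (by fun_prop),
      ← lintegral_mul_const _ (by fun_prop)]
    refine setLIntegral_congr_fun measurableSet_Ioi fun t ht => ?_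
    simp only [Pi.mul_apply]
    rw [← ofReal_density_eq hu hs ht]
    ring
  have h2 := h1 1 measurable_one
  simp only [Pi.one_apply, one_mul, lintegral_one] at h2
  rw [scoreMoment, h2, h1 g hg, jumpLaw, normalized, lintegral_smul_measure, smul_eq_mul,
    ENNReal.mul_inv (Or.inr ENNReal.ofReal_ne_top) (Or.inr hs0), mul_assoc]
  congr 1
  rw [mul_comm _ (ENNReal.ofReal (s ^ k)), ← mul_assoc,
    ENNReal.inv_mul_cancel hs0 ENNReal.ofReal_ne_top, one_mul]

/-- An atom that has not been observed is the case `k = 0`, so the lemmas on `jumpLaw` serve both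
parts of the posterior. -/
lemma tiltedScoreLaw_eq (u s : ℝ) : tiltedScoreLaw f u s = jumpLaw f u 0 s := by
  unfold tiltedScoreLaw jumpLaw
  congr 2
  ext t
  rw [pow_zero, mul_one, show u * t * s = s * u * t by ring]

lemma isProbabilityMeasure_jumpLaw (hf : Measurable f)
    (hf_one : ∫⁻ m in Ioi (0 : ℝ), (f m : ℝ≥0∞) = 1) {u s : ℝ} (hu : 0 < u) (hs : 0 < s) (k : ℕ) :
    IsProbabilityMeasure (jumpLaw f u k s) := by
  constructor
  have h := lintegral_jumpLaw hf hu hs k measurable_one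
  simp only [Pi.one_apply, one_mul, lintegral_one] at h
  rw [h]
  exact ENNReal.inv_mul_cancel (scoreMoment_ne_zero hf hf_one ENNReal.ofReal_ne_top k hs)
    (scoreMoment_ne_top hf_one (by simpa using hu) k s)

lemma measurable_jumpLaw (hf : Measurable f) (u : ℝ) (k : ℕ) : Measurable (jumpLaw f u k) := by
  refine Measure.measurable_of_measurable_coe _ fun B hB => ?_
  have h : ∀ B : Set ℝ, MeasurableSet B → Measurable fun s => (volume.restrict (Ioi 0)).withDensity
      (fun t => ENNReal.ofReal (Real.exp (-(s * u * t)) * t ^ k) * (f t : ℝ≥0∞)) B := fun B hB => by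
    simp_rw [withDensity_apply _ hB]
    refine Measurable.lintegral_prod_right' (f := fun q : ℝ × ℝ =>
      ENNReal.ofReal (Real.exp (-(q.1 * u * q.2)) * q.2 ^ k) * (f q.2 : ℝ≥0∞)) ?_
    fun_prop
  exact (h univ .univ).inv.mul (h B hB)

/-- A Laplace transform of a tilted law is a further tilting: `θ` adds to `u`, and the normalizing
constant is left in the denominator. -/
lemma lintegral_expNeg_jumpLaw (hf : Measurable f) {u s : ℝ} (hu : 0 < u) (hs : 0 < s) (k : ℕ)
    (θ : ℝ≥0∞) : ∫⁻ t, expNeg (θ * ENNReal.ofReal (t * s)) ∂(jumpLaw f u k s) =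
      (scoreMoment f (ENNReal.ofReal u) k s)⁻¹ * scoreMoment f (θ + ENNReal.ofReal u) k s := by
  rw [lintegral_jumpLaw hf hu hs k (by fun_prop), scoreMoment, scoreMoment]
  congr 1
  refine lintegral_congr fun t => ?_
  rw [add_mul, expNeg_add]
  ring

end ScoreMoments

end

end CoRM

/-! ### Laplace exponent and moments of a jump intensity -/

namespace CoRM

open Filter Topology

noncomputable section

/-- The Laplace exponent of a completely random vector with jump intensity `ρ` and centering
measure `α`. -/
def exponent {𝕏 : Type*} [MeasurableSpace 𝕏] {d : ℕ} (ρ : Measure (Fin d → ℝ≥0)) (α : Measure 𝕏)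
    (H : Fin d → 𝕏 → ℝ≥0∞) : ℝ≥0∞ :=
  ∫⁻ x, ∫⁻ w, (1 - expNeg (∑ j, H j x * w j)) ∂ρ ∂α

/-- The Laplace transform at `θ` of the moment measure of `ρ` with multi-index `k`. -/
def jumpMoment {d : ℕ} (ρ : Measure (Fin d → ℝ≥0)) (k : Fin d → ℕ) (θ : Fin d → ℝ≥0∞) : ℝ≥0∞ :=
  ∫⁻ w, (∏ j, (w j : ℝ≥0∞) ^ k j) * expNeg (∑ j, θ j * w j) ∂ρ

/-- The multivariate Lévy measure of the jumps of the compound vector with scores of density `f` and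
directing Lévy measure `ν`. -/
def jumpMeasure (d : ℕ) (f : ℝ → ℝ≥0) (ν : Measure ℝ) : Measure (Fin d → ℝ≥0) :=
  (ν.prod (Measure.pi fun _ : Fin d => scoreLaw f)).map fun q j => (q.2 j * q.1).toNNReal

section General

variable {𝕏 : Type*} [MeasurableSpace 𝕏] {d : ℕ} {ρ : Measure (Fin d → ℝ≥0)} {α : Measure 𝕏}

lemma measurable_jumpMoment [SFinite ρ] {T : Type*} [MeasurableSpace T] (k : Fin d → ℕ)
    {θ : T → Fin d → ℝ≥0∞} (hθ : Measurable θ) : Measurable fun y => jumpMoment ρ k (θ y) := by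
  unfold jumpMoment
  refine Measurable.lintegral_prod_right' (f := fun q : T × (Fin d → ℝ≥0) =>
    (∏ j, (q.2 j : ℝ≥0∞) ^ k j) * expNeg (∑ j, θ q.1 j * q.2 j)) ?_
  fun_prop

lemma one_sub_expNeg_add (a b : ℝ≥0∞) :
    1 - expNeg (a + b) = (1 - expNeg a) + expNeg a * (1 - expNeg b) := by
  rw [expNeg_add, ENNReal.mul_sub fun _ _ => expNeg_ne_top _, mul_one]
  refine (ENNReal.eq_sub_of_add_eq (ENNReal.mul_ne_top (expNeg_ne_top _) (expNeg_ne_top _)) ?_).symm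
  rw [add_assoc, tsub_add_cancel_of_le (mul_le_of_le_one_right' (expNeg_le_one _)),
    tsub_add_cancel_of_le (expNeg_le_one _)]

/-- The increment of the exponent is again an exponent, for the intensity tilted by `e^{-H·w}`. This
is the reason why a tilted compound vector is still compound. -/
lemma exponent_add [SFinite ρ] {H : Fin d → 𝕏 → ℝ≥0∞} (hH : ∀ j, Measurable (H j))
    (H' : Fin d → 𝕏 → ℝ≥0∞) : exponent ρ α (H + H') = exponent ρ α H +
      ∫⁻ x, ∫⁻ w, expNeg (∑ j, H j x * w j) * (1 - expNeg (∑ j, H' j x * w j)) ∂ρ ∂α := by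
  simp only [exponent, Pi.add_apply, add_mul, Finset.sum_add_distrib, one_sub_expNeg_add]
  rw [← lintegral_add_left]
  · refine lintegral_congr fun x => ?_
    rw [lintegral_add_left (by fun_prop)]
  · refine Measurable.lintegral_prod_right' (f := fun q : 𝕏 × (Fin d → ℝ≥0) =>
      1 - expNeg (∑ j, H j q.1 * q.2 j)) ?_
    fun_prop

lemma one_sub_expNeg_le (a : ℝ≥0∞) : 1 - expNeg a ≤ min 1 a := by
  refine le_min tsub_le_self ?_
  rcases eq_or_ne a ∞ with rfl | ha
  · simp
  · rw [tsub_le_iff_right, expNeg_eq_ofReal ha]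
    conv_rhs => enter [1]; rw [← ENNReal.ofReal_toReal ha]
    rw [← ENNReal.ofReal_add ENNReal.toReal_nonneg (Real.exp_pos _).le, ← ENNReal.ofReal_one]
    refine ENNReal.ofReal_le_ofReal ?_
    linarith [Real.add_one_le_exp (-a.toReal)]

lemma min_one_mul_le {a b C : ℝ≥0∞} (h1 : 1 ≤ C) (ha : a ≤ C) : min 1 (a * b) ≤ C * min 1 b := by
  rcases le_total 1 b with hb | hb
  · rw [min_eq_left hb, mul_one]
    exact (min_le_left _ _).trans h1
  · rw [min_eq_right hb]
    exact (min_le_right _ _).trans (by gcongr)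

lemma min_one_sum_le {ι : Type*} (s : Finset ι) (a : ι → ℝ≥0∞) :
    min 1 (∑ i ∈ s, a i) ≤ ∑ i ∈ s, min 1 (a i) := by
  classical
  induction s using Finset.induction_on with
  | empty => simp
  | insert i s hi ih =>
    rw [Finset.sum_insert hi, Finset.sum_insert hi]
    refine le_trans ?_ (add_le_add_right ih _)
    rcases le_total 1 (a i) with h | h
    · rw [min_eq_left h]; exact (min_le_left _ _).trans le_self_add
    · rcases le_total 1 (∑ i ∈ s, a i) with h' | h'
      · rw [min_eq_left h']; exact (min_le_left _ _).trans le_add_self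
      · rw [min_eq_right h, min_eq_right h']; exact min_le_right _ _

lemma lintegral_one_sub_expNeg_ne_top (hρ : ∀ j, ∫⁻ w, min 1 (w j : ℝ≥0∞) ∂ρ ≠ ∞)
    {θ : Fin d → ℝ≥0∞} (hθ : ∀ j, θ j ≠ ∞) : ∫⁻ w, (1 - expNeg (∑ j, θ j * w j)) ∂ρ ≠ ∞ := by
  have h : ∀ w : Fin d → ℝ≥0, 1 - expNeg (∑ j, θ j * w j) ≤
      ∑ j, max 1 (θ j) * min 1 (w j : ℝ≥0∞) := fun w =>
    (one_sub_expNeg_le _).trans ((min_one_sum_le _ _).trans (Finset.sum_le_sum fun j _ =>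
      min_one_mul_le (le_max_left _ _) (le_max_right _ _)))
  refine ne_top_of_le_ne_top ?_ (lintegral_mono h)
  rw [lintegral_finsetSum _ fun j _ => by fun_prop]
  refine (ENNReal.sum_lt_top.2 fun j _ => ?_).ne
  rw [lintegral_const_mul _ (by fun_prop)]
  exact ENNReal.mul_lt_top (max_lt ENNReal.one_lt_top (hθ j).lt_top) (hρ j).lt_top

lemma exponent_const (θ : Fin d → ℝ≥0∞) : exponent ρ α (fun j _ => θ j) =
    (∫⁻ w, (1 - expNeg (∑ j, θ j * w j)) ∂ρ) * α univ := by
  rw [exponent, lintegral_const]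

lemma exponent_const_ne_top [IsFiniteMeasure α] (hρ : ∀ j, ∫⁻ w, min 1 (w j : ℝ≥0∞) ∂ρ ≠ ∞)
    {θ : Fin d → ℝ≥0∞} (hθ : ∀ j, θ j ≠ ∞) : exponent ρ α (fun j _ => θ j) ≠ ∞ := by
  rw [exponent_const]
  exact ENNReal.mul_ne_top (lintegral_one_sub_expNeg_ne_top hρ hθ) (measure_ne_top _ _)

/-- One factor `w j₀` with `k j₀ ≥ 1` is kept to dominate the integrand by a multiple of `min 1 (w
j₀)`; the exponentials bound the rest. Without such a factor the integral could diverge, as `ρ` may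
be infinite. -/
lemma jumpMoment_ne_top (hρ : ∀ j, ∫⁻ w, min 1 (w j : ℝ≥0∞) ∂ρ ≠ ∞) {k : Fin d → ℕ} (hk : k ≠ 0)
    {θ : Fin d → ℝ≥0∞} (hθ : ∀ j, θ j ≠ 0) : jumpMoment ρ k θ ≠ ∞ := by
  classical
  obtain ⟨j₀, hj₀⟩ := Function.ne_iff.1 hk
  choose C hC hle using fun j => exists_pow_mul_expNeg_le (k j) (hθ j)
  obtain ⟨C', hC', hle'⟩ := exists_pow_mul_expNeg_le (k j₀ - 1) (hθ j₀)
  have h0 : ∀ w : ℝ≥0, (w : ℝ≥0∞) ^ k j₀ * expNeg (θ j₀ * w) ≤ (C j₀ + C') * min 1 (w : ℝ≥0∞) := by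
    intro w
    rcases le_total 1 (w : ℝ≥0∞) with hw | hw
    · rw [min_eq_left hw, mul_one]
      exact (hle j₀ w).trans le_self_add
    · rw [min_eq_right hw]
      obtain ⟨n, hn⟩ := Nat.exists_eq_succ_of_ne_zero hj₀
      have h2 := hle' w
      rw [hn, Nat.succ_sub_one] at h2
      rw [hn, pow_succ, mul_right_comm]
      gcongr
      exact h2.trans le_add_self
  have hb : ∀ w : Fin d → ℝ≥0, (∏ j, (w j : ℝ≥0∞) ^ k j) * expNeg (∑ j, θ j * w j) ≤
      (∏ j ∈ Finset.univ.erase j₀, C j) * (C j₀ + C') * min 1 (w j₀ : ℝ≥0∞) := fun w => by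
    rw [expNeg_sum, ← Finset.prod_mul_distrib, ← Finset.prod_erase_mul _ _ (Finset.mem_univ j₀),
      mul_assoc]
    exact mul_le_mul' (Finset.prod_le_prod' fun j _ => hle j _) (h0 _)
  refine ne_top_of_le_ne_top ?_ (lintegral_mono hb)
  rw [lintegral_const_mul _ (by fun_prop)]
  exact ENNReal.mul_ne_top (ENNReal.mul_ne_top (ENNReal.prod_ne_top fun j _ => hC j)
    (ENNReal.add_ne_top.2 ⟨hC _, hC'⟩)) (hρ j₀)

lemma jumpMoment_ne_zero (hρ0 : ∀ᵐ w ∂ρ, ∀ j, 0 < w j) (hρ : ρ ≠ 0) (k : Fin d → ℕ)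
    {θ : Fin d → ℝ≥0∞} (hθ : ∀ j, θ j ≠ ∞) : jumpMoment ρ k θ ≠ 0 := by
  intro h
  rw [jumpMoment, lintegral_eq_zero_iff (by fun_prop)] at h
  have : (ae ρ).NeBot := ae_neBot.2 hρ
  obtain ⟨w, hw0, hw⟩ := (hρ0.and h).exists
  rcases mul_eq_zero.1 hw with h2 | h2
  · rw [Finset.prod_eq_zero_iff] at h2
    obtain ⟨j, -, hj⟩ := h2
    exact pow_ne_zero _ (by exact_mod_cast (hw0 j).ne') hj
  · rw [expNeg_eq_zero_iff, ENNReal.sum_eq_top] at h2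
    obtain ⟨j, -, hj⟩ := h2
    exact ENNReal.mul_ne_top (hθ j) ENNReal.coe_ne_top hj

end General

/-! ### The jump measure of a compound vector and the tilted Laplace functional -/

section JumpMeasure

variable {𝕏 : Type*} [MeasurableSpace 𝕏] {d : ℕ} {α : Measure 𝕏} {f : ℝ → ℝ≥0} {ν : Measure ℝ}

/-- The measure `min(s, 1) ν(ds)` is finite with a density positive `ν`-almost everywhere, so
dividing by the density recovers `ν`. -/
lemma sFinite_of_levy (hν : ν (Iic 0) = 0) (h : ∫⁻ s, ENNReal.ofReal (min s 1) ∂ν < ∞) :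
    SFinite ν := by
  have h1 : ∀ᵐ s ∂ν, ENNReal.ofReal (min s 1) ≠ 0 := by
    have : ∀ᵐ s ∂ν, s ∉ Iic (0 : ℝ) := measure_eq_zero_iff_ae_notMem.1 hν
    filter_upwards [this] with s hs
    rw [Ne, ENNReal.ofReal_eq_zero, not_le]
    exact lt_min (by simpa using hs) one_pos
  have h2 := withDensity_inv_same (μ := ν) (f := fun s => ENNReal.ofReal (min s 1)) (by fun_prop) h1
    (ae_of_all _ fun _ => ENNReal.ofReal_ne_top)
  have := isFiniteMeasure_withDensity h.ne
  rw [← h2]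
  infer_instance

lemma sFinite_jumpMeasure [SFinite ν] (hf_one : ∫⁻ m in Ioi (0 : ℝ), (f m : ℝ≥0∞) = 1) :
    SFinite (jumpMeasure d f ν) := by
  have := isProbabilityMeasure_scoreLaw hf_one
  unfold jumpMeasure
  infer_instance

lemma measurable_jump : Measurable fun (q : ℝ × (Fin d → ℝ)) j => (q.2 j * q.1).toNNReal :=
  measurable_pi_lambda _ fun j => by fun_prop

lemma ae_pos_of_levy (hν : ν (Iic 0) = 0) : ∀ᵐ s ∂ν, 0 < s := by
  filter_upwards [measure_eq_zero_iff_ae_notMem.1 hν] with s hs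
  simpa using hs

lemma lintegral_jumpMeasure (hf_one : ∫⁻ m in Ioi (0 : ℝ), (f m : ℝ≥0∞) = 1)
    {F : (Fin d → ℝ≥0) → ℝ≥0∞} (hF : Measurable F) : ∫⁻ w, F w ∂(jumpMeasure d f ν) =
      ∫⁻ s, ∫⁻ t, F (fun j => (t j * s).toNNReal) ∂(Measure.pi fun _ : Fin d => scoreLaw f) ∂ν := by
  have := isProbabilityMeasure_scoreLaw hf_one
  rw [jumpMeasure, lintegral_map hF measurable_jump]
  exact lintegral_prod _ (hF.comp measurable_jump).aemeasurable

lemma jumpMeasure_ae_pos (hf : Measurable f) (hf_one : ∫⁻ m in Ioi (0 : ℝ), (f m : ℝ≥0∞) = 1)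
    (hν : ν (Iic 0) = 0) : ∀ᵐ w ∂(jumpMeasure d f ν), ∀ j, 0 < w j := by
  have := isProbabilityMeasure_scoreLaw hf_one
  rw [ae_all_iff]
  intro j
  rw [jumpMeasure, ae_map_iff measurable_jump.aemeasurable
    (measurableSet_lt measurable_const (by fun_prop))]
  have h1 : ∀ᵐ q ∂(ν.prod (Measure.pi fun _ : Fin d => scoreLaw f)), 0 < q.1 :=
    Measure.quasiMeasurePreserving_fst.ae (ae_pos_of_levy hν)
  have h2 : ∀ᵐ q ∂(ν.prod (Measure.pi fun _ : Fin d => scoreLaw f)), 0 < q.2 j :=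
    Measure.quasiMeasurePreserving_snd.ae
      ((Measure.quasiMeasurePreserving_eval (fun _ : Fin d => scoreLaw f) j).ae
        (scoreLaw_ae_pos hf))
  filter_upwards [h1, h2] with q hq1 hq2
  rw [Real.toNNReal_pos]
  exact mul_pos hq2 hq1

lemma jumpMeasure_univ (hf_one : ∫⁻ m in Ioi (0 : ℝ), (f m : ℝ≥0∞) = 1) :
    jumpMeasure d f ν univ = ν univ := by
  have := isProbabilityMeasure_scoreLaw hf_one
  rw [← lintegral_one, lintegral_jumpMeasure hf_one measurable_const]
  simp

/-- For a fixed height the scores are independent, so moments of the jump vector factorize over the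
groups. -/
lemma jumpMoment_jumpMeasure (hf_one : ∫⁻ m in Ioi (0 : ℝ), (f m : ℝ≥0∞) = 1)
    (k : Fin d → ℕ) (θ : Fin d → ℝ≥0∞) :
    jumpMoment (jumpMeasure d f ν) k θ = ∫⁻ s, ∏ j, scoreMoment f (θ j) (k j) s ∂ν := by
  have := isProbabilityMeasure_scoreLaw hf_one
  rw [jumpMoment, lintegral_jumpMeasure hf_one (by fun_prop)]
  refine lintegral_congr fun s => ?_
  simp only [scoreMoment]
  rw [← lintegral_pi_prod (f := fun j t => ENNReal.ofReal (t * s) ^ k j *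
    expNeg (θ j * ENNReal.ofReal (t * s))) _ fun j => by fun_prop]
  refine lintegral_congr fun t => ?_
  rw [expNeg_sum, ← Finset.prod_mul_distrib]
  rfl

/-- The difference stays under the integral in `s`, since the integrals of its two terms against `ν`
may both be infinite. For fixed `s` the score integrals are at most 1 and can be subtracted. -/
lemma lintegral_expNeg_mul_one_sub (hf_one : ∫⁻ m in Ioi (0 : ℝ), (f m : ℝ≥0∞) = 1)
    (θ θ' : Fin d → ℝ≥0∞) :
    ∫⁻ w, expNeg (∑ j, θ j * w j) * (1 - expNeg (∑ j, θ' j * w j)) ∂(jumpMeasure d f ν) =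
      ∫⁻ s, (∏ j, scoreMoment f (θ j) 0 s - ∏ j, scoreMoment f (θ' j + θ j) 0 s) ∂ν := by
  have := isProbabilityMeasure_scoreLaw hf_one
  rw [lintegral_jumpMeasure hf_one (by fun_prop)]
  have h : ∀ (θ : Fin d → ℝ≥0∞) (s : ℝ), ∏ j, scoreMoment f (θ j) 0 s =
      ∫⁻ t, expNeg (∑ j, θ j * ENNReal.ofReal (t j * s))
        ∂(Measure.pi fun _ : Fin d => scoreLaw f) := fun θ s => by
    simp only [scoreMoment, pow_zero, one_mul, expNeg_sum]
    rw [← lintegral_pi_prod (f := fun j t => expNeg (θ j * ENNReal.ofReal (t * s))) _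
      fun j => by fun_prop]
  refine lintegral_congr fun s => ?_
  rw [h, h, ← lintegral_sub (by fun_prop)]
  · refine lintegral_congr fun t => ?_
    rw [ENNReal.mul_sub fun _ _ => expNeg_ne_top _, mul_one, ← expNeg_add, ← Finset.sum_add_distrib]
    congr 2
    refine congrArg _ (funext fun j => ?_)
    rw [add_mul, add_comm]
    rfl
  · refine ne_top_of_le_ne_top ENNReal.one_ne_top ((lintegral_mono fun t => expNeg_le_one _).trans ?_)
    simp
  · refine ae_of_all _ fun t => expNeg_antitone (Finset.sum_le_sum fun j _ => ?_)
    gcongr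
    exact le_add_self

lemma exponent_jumpMeasure (hf_one : ∫⁻ m in Ioi (0 : ℝ), (f m : ℝ≥0∞) = 1)
    (H : Fin d → 𝕏 → ℝ≥0∞) : exponent (jumpMeasure d f ν) α H =
      ∫⁻ x, ∫⁻ s, (1 - ∏ j, scoreMoment f (H j x) 0 s) ∂ν ∂α := by
  have := isProbabilityMeasure_scoreLaw hf_one
  have h0 : ∀ s, scoreMoment f 0 0 s = 1 := fun s => by simp [scoreMoment, expNeg_zero]
  have h1 := fun x => lintegral_expNeg_mul_one_sub (ν := ν) hf_one (fun _ : Fin d => 0)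
    fun j => H j x
  simp only [zero_mul, Finset.sum_const_zero, expNeg_zero, one_mul, h0, Finset.prod_const_one,
    add_zero] at h1
  simp_rw [exponent, h1]

variable [SFinite ν]

/-- The Laplace functional of a compound vector with tilted scores and updated Lévy measure. -/
theorem laplace_tilted [SFinite α] {Ω : Type*} [MeasurableSpace Ω] {P : Measure Ω}
    [IsProbabilityMeasure P] {μ : Fin d → Ω → Measure 𝕏} (hf : Measurable f)
    (hf_one : ∫⁻ m in Ioi (0 : ℝ), (f m : ℝ≥0∞) = 1) (hν : ν (Iic 0) = 0) {u : Fin d → ℝ}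
    (hu : ∀ j, 0 < u j)
    (hμ : IsCompoundVector P (fun j s => tiltedScoreLaw f (u j) s) (updatedLevy f ν u) α μ)
    {H : Fin d → 𝕏 → ℝ≥0∞} (hH : ∀ j, Measurable (H j)) :
    expNeg (exponent (jumpMeasure d f ν) α fun j _ => ENNReal.ofReal (u j)) *
      ∫⁻ ω, expNeg (pairing H fun j => μ j ω) ∂P =
    expNeg (exponent (jumpMeasure d f ν) α fun j x => H j x + ENNReal.ofReal (u j)) := by
  have hpos := ae_pos_of_levy hν
  have hint : ∀ s, 0 < s → ∏ j, scoreIntegral f (u j) 0 s =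
      ∏ j, scoreMoment f (ENNReal.ofReal (u j)) 0 s := fun s hs =>
    Finset.prod_congr rfl fun j _ => by
      simpa using scoreIntegral_mul hf (hu j) hs 0
  have hup : updatedLevy f ν u =
      ν.withDensity fun s => ∏ j, scoreMoment f (ENNReal.ofReal (u j)) 0 s := by
    refine withDensity_congr_ae ?_
    filter_upwards [hpos] with s hs using hint s hs
  have hdens : Measurable fun s => ∏ j, scoreMoment f (ENNReal.ofReal (u j)) 0 s :=
    Finset.measurable_fun_prod _ fun j _ => measurable_scoreMoment measurable_const measurable_id 0
  have : SFinite (updatedLevy f ν u) := by rw [hup]; infer_instance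
  simp only [tiltedScoreLaw_eq] at hμ
  rw [hμ.laplace (fun j => measurable_jumpLaw hf (u j) 0)
    (fun j s hs => isProbabilityMeasure_jumpLaw hf hf_one (hu j) hs 0)
    (withDensity_absolutelyContinuous _ _ hν) hH, ← expNeg_add]
  have := sFinite_jumpMeasure (d := d) (ν := ν) hf_one
  -- The exponent at `H + u` exceeds the exponent at `u` by an increment. It equals the exponent of
  -- the tilted vector because the denominators from the tilted scores cancel the density of the
  -- updated Lévy measure.
  have hsplit := exponent_add (ρ := jumpMeasure d f ν) (α := α)
    (H := fun j _ => ENNReal.ofReal (u j)) (fun j => measurable_const) H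
  have hcomm : (fun j x => H j x + ENNReal.ofReal (u j)) =
      (fun (j : Fin d) (_ : 𝕏) => ENNReal.ofReal (u j)) + H := by
    ext j x; simp [add_comm]
  rw [hcomm, hsplit]
  congr 2
  simp_rw [lintegral_expNeg_mul_one_sub hf_one]
  have h1 : ∫⁻ p, (1 - ∏ j, ∫⁻ t, expNeg (H j p.2 * ENNReal.ofReal (t * p.1))
      ∂(jumpLaw f (u j) 0 p.1)) ∂((updatedLevy f ν u).prod α) =
      ∫⁻ p, (1 - ∏ j, ((scoreMoment f (ENNReal.ofReal (u j)) 0 p.1)⁻¹ *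
        scoreMoment f (H j p.2 + ENNReal.ofReal (u j)) 0 p.1)) ∂((updatedLevy f ν u).prod α) := by
    have hae : ∀ᵐ p ∂((updatedLevy f ν u).prod α), 0 < p.1 :=
      Measure.quasiMeasurePreserving_fst.ae (withDensity_absolutelyContinuous _ _ hpos)
    refine lintegral_congr_ae ?_
    filter_upwards [hae] with p hp
    congr 1
    exact Finset.prod_congr rfl fun j _ => lintegral_expNeg_jumpLaw hf (hu j) hp 0 _
  have hmeas : Measurable fun p : ℝ × 𝕏 => 1 - ∏ j, ((scoreMoment f (ENNReal.ofReal (u j)) 0 p.1)⁻¹ *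
        scoreMoment f (H j p.2 + ENNReal.ofReal (u j)) 0 p.1) := by
    refine measurable_const.sub (Finset.measurable_fun_prod _ fun j _ => ?_)
    refine (measurable_scoreMoment measurable_const measurable_fst 0).inv.mul
      (measurable_scoreMoment ?_ measurable_fst 0)
    exact ((hH j).comp measurable_snd).add measurable_const
  rw [h1, lintegral_prod_symm _ hmeas.aemeasurable]
  refine lintegral_congr fun x => ?_
  rw [hup]
  refine (lintegral_withDensity_eq_lintegral_mul _ hdens
    (hmeas.comp (measurable_prodMk_right (y := x)))).trans ?_
  refine lintegral_congr_ae ?_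
  filter_upwards [hpos] with s hs
  have hne0 : ∏ j, scoreMoment f (ENNReal.ofReal (u j)) 0 s ≠ 0 :=
    Finset.prod_ne_zero_iff.2 fun j _ => scoreMoment_ne_zero hf hf_one ENNReal.ofReal_ne_top 0 hs
  have hnet : ∏ j, scoreMoment f (ENNReal.ofReal (u j)) 0 s ≠ ∞ :=
    ENNReal.prod_ne_top fun j _ => scoreMoment_ne_top hf_one (by simpa using hu j) 0 s
  simp only [Pi.mul_apply, Function.comp_apply]
  rw [ENNReal.mul_sub fun _ _ => hnet, mul_one, ← Finset.prod_mul_distrib]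
  congr 1
  refine Finset.prod_congr rfl fun j _ => ?_
  rw [← mul_assoc, ENNReal.mul_inv_cancel
    (scoreMoment_ne_zero hf hf_one ENNReal.ofReal_ne_top 0 hs)
    (scoreMoment_ne_top hf_one (by simpa using hu j) 0 s), one_mul]

/-- The Laplace functional of a compound vector with i.i.d. scores. -/
theorem laplace_iid [SFinite α] {Ω : Type*} [MeasurableSpace Ω] {P : Measure Ω}
    [IsProbabilityMeasure P] {μ : Fin d → Ω → Measure 𝕏}
    (hf_one : ∫⁻ m in Ioi (0 : ℝ), (f m : ℝ≥0∞) = 1) (hν : ν (Iic 0) = 0)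
    (hμ : IsCompoundVector P (fun _ _ => scoreLaw f) ν α μ)
    {H : Fin d → 𝕏 → ℝ≥0∞} (hH : ∀ j, Measurable (H j)) :
    ∫⁻ ω, expNeg (pairing H fun j => μ j ω) ∂P = expNeg (exponent (jumpMeasure d f ν) α H) := by
  have := isProbabilityMeasure_scoreLaw hf_one
  rw [hμ.laplace (fun j => measurable_const) (fun j s hs => this) hν hH]
  congr 1
  rw [exponent_jumpMeasure hf_one, lintegral_prod_symm]
  · simp only [scoreMoment, pow_zero, one_mul]
  · refine Measurable.aemeasurable (measurable_const.sub (Finset.measurable_fun_prod _ fun j _ => ?_))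
    have := measurable_scoreMoment (f := f) ((hH j).comp measurable_snd) (measurable_fst (α := ℝ)) 0
    simpa only [scoreMoment, pow_zero, one_mul, Function.comp_apply] using this

end JumpMeasure

end

end CoRM

/-! ### Consequences of the regularity assumptions -/

namespace CoRM

open Filter Topology

noncomputable section

section Regularity

variable {d : ℕ} {f : ℝ → ℝ≥0} {ν : Measure ℝ}

lemma pi_scoreLaw (hf : Measurable f) : Measure.pi (fun _ : Fin d => scoreLaw f) =
    (volume.restrict (univ.pi fun _ : Fin d => Ioi (0 : ℝ))).withDensity
      fun t => ∏ j, (f (t j) : ℝ≥0∞) := by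
  have : SigmaFinite ((volume.restrict (Ioi (0 : ℝ))).withDensity fun m => (f m : ℝ≥0∞)) :=
    SigmaFinite.withDensity f
  unfold scoreLaw
  rw [pi_withDensity (fun _ : Fin d => volume.restrict (Ioi (0 : ℝ))) (g := fun _ m => (f m : ℝ≥0∞))
    fun _ => by fun_prop, ← Measure.restrict_pi_pi, volume_pi]

/-- The substitution `s = z t`, whose Jacobian `z^d` absorbs the prefactor, rewrites an integral
over jump sizes as one over scores. -/
lemma lintegral_score_scale (hf : Measurable f) {z : ℝ} (hz : 0 < z)
    {F : (Fin d → ℝ) → ℝ≥0∞} (hF : Measurable F) :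
    ∫⁻ s in (univ.pi fun _ : Fin d => Ioi (0 : ℝ)),
      ENNReal.ofReal (z ^ d)⁻¹ * F s * ∏ j, (f (s j / z) : ℝ≥0∞) ∂volume =
      ∫⁻ t, F (z • t) ∂(Measure.pi fun _ : Fin d => scoreLaw f) := by
  have hpi : MeasurableSet (univ.pi fun _ : Fin d => Ioi (0 : ℝ)) :=
    MeasurableSet.univ_pi fun _ => measurableSet_Ioi
  have h1 := Measure.map_addHaar_smul (volume : Measure (Fin d → ℝ)) hz.ne'
  rw [Module.finrank_fin_fun, abs_of_pos (by positivity)] at h1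
  have h2 : ∀ g : (Fin d → ℝ) → ℝ≥0∞, Measurable g →
      ∫⁻ s, ENNReal.ofReal (z ^ d)⁻¹ * g s = ∫⁻ t, g (z • t) := fun g hg => by
    rw [lintegral_const_mul _ hg, ← smul_eq_mul, ← lintegral_smul_measure, ← h1,
      lintegral_map hg (by fun_prop)]
  rw [pi_scoreLaw hf, lintegral_withDensity_eq_lintegral_mul _ (by fun_prop) (by fun_prop),
    ← lintegral_indicator hpi, ← lintegral_indicator hpi]
  have h3 := h2 ((univ.pi fun _ : Fin d => Ioi (0 : ℝ)).indicator
    fun s => F s * ∏ j, (f (s j / z) : ℝ≥0∞)) (Measurable.indicator (by fun_prop) hpi)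
  refine Eq.trans ?_ (h3.trans ?_)
  · refine lintegral_congr fun s => ?_
    by_cases hs : s ∈ univ.pi fun _ : Fin d => Ioi (0 : ℝ)
    · simp only [indicator_of_mem hs, mul_assoc]
    · simp only [indicator_of_notMem hs, mul_zero]
  · refine lintegral_congr fun t => ?_
    have hiff : z • t ∈ (univ.pi fun _ : Fin d => Ioi (0 : ℝ)) ↔
        t ∈ univ.pi fun _ : Fin d => Ioi (0 : ℝ) := by
      simp [hz]
    by_cases ht : t ∈ univ.pi fun _ : Fin d => Ioi (0 : ℝ)
    · rw [indicator_of_mem (hiff.2 ht), indicator_of_mem ht]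
      simp only [Pi.mul_apply, Pi.smul_apply, smul_eq_mul, mul_div_cancel_left₀ _ hz.ne']
      rw [mul_comm]
    · rw [indicator_of_notMem (mt hiff.1 ht), indicator_of_notMem ht]

/-- After rescaling, each coordinate `t j * z` of a jump is at most the norm of the jump. The
regularity assumption enters the proof only in this form. -/
lemma lintegral_min_one_jumpMeasure_ne_top (hf : Measurable f)
    (hf_one : ∫⁻ m in Ioi (0 : ℝ), (f m : ℝ≥0∞) = 1) (hν : ν (Iic 0) = 0)
    (hA1 : ∫⁻ z, (∫⁻ s in (univ.pi fun _ : Fin d => Ioi (0 : ℝ)),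
      ENNReal.ofReal ((z ^ d)⁻¹ * min 1 ‖WithLp.toLp 2 s‖) *
        ∏ j, (f (s j / z) : ℝ≥0∞) ∂volume) ∂ν < ∞) (j : Fin d) :
    ∫⁻ w, min 1 (w j : ℝ≥0∞) ∂(jumpMeasure d f ν) ≠ ∞ := by
  refine ne_top_of_le_ne_top hA1.ne ?_
  rw [lintegral_jumpMeasure hf_one (by fun_prop)]
  refine lintegral_mono_ae ?_
  filter_upwards [ae_pos_of_levy hν] with z hz
  have h1 := lintegral_score_scale (d := d) hf hz
    (F := fun s => ENNReal.ofReal (min 1 ‖WithLp.toLp 2 s‖)) (by fun_prop)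
  have h2 : ∀ s : Fin d → ℝ, ENNReal.ofReal ((z ^ d)⁻¹ * min 1 ‖WithLp.toLp 2 s‖) =
      ENNReal.ofReal (z ^ d)⁻¹ * ENNReal.ofReal (min 1 ‖WithLp.toLp 2 s‖) := fun s =>
    ENNReal.ofReal_mul (by positivity)
  simp_rw [h2, h1]
  refine lintegral_mono fun t => ?_
  have h3 : t j * z ≤ ‖WithLp.toLp 2 (z • t)‖ := by
    have := PiLp.norm_apply_le (WithLp.toLp 2 (z • t)) j
    refine le_trans ?_ this
    rw [Real.norm_eq_abs]
    refine le_trans (le_of_eq ?_) (le_abs_self _)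
    simp [mul_comm]
  change min 1 (ENNReal.ofReal (t j * z)) ≤ _
  rw [← ENNReal.ofReal_one, ← ENNReal.ofReal_min]
  exact ENNReal.ofReal_le_ofReal (min_le_min_left _ h3)

/-- Substituting `s = z t`, the inner integral is the total mass 1 of the score density, so the
assumption just says that `ν` is infinite. -/
lemma levy_univ_eq_top (hf : Measurable f)
    (hf_one : ∫⁻ m in Ioi (0 : ℝ), (f m : ℝ≥0∞) = 1) (hν : ν (Iic 0) = 0)
    (hA3 : ∫⁻ z, (∫⁻ s in Ioi (0 : ℝ), ENNReal.ofReal z⁻¹ * (f (s / z) : ℝ≥0∞) ∂volume) ∂ν = ∞) :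
    ν univ = ∞ := by
  have h : ∀ z : ℝ, 0 < z →
      ∫⁻ s in Ioi (0 : ℝ), ENNReal.ofReal z⁻¹ * (f (s / z) : ℝ≥0∞) ∂volume = 1 := fun z hz => by
    have h1 := Real.map_volume_mul_left hz.ne'
    rw [abs_of_pos (by positivity)] at h1
    rw [lintegral_const_mul _ (by fun_prop), ← smul_eq_mul, ← lintegral_smul_measure,
      ← Measure.restrict_smul, ← h1, Measure.restrict_map (by fun_prop) measurableSet_Ioi,
      lintegral_map (by fun_prop) (by fun_prop)]
    have h2 : (fun x => z * x) ⁻¹' Ioi 0 = Ioi 0 := by ext x; simp [hz]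
    rw [h2, ← hf_one]
    simp only [mul_div_cancel_left₀ _ hz.ne']
  rw [← hA3, ← lintegral_one]
  refine lintegral_congr_ae ?_
  filter_upwards [ae_pos_of_levy hν] with z hz
  rw [h z hz]

end Regularity

end

end CoRM

/-! ### Realization of a compound vector on a space of sequences -/

namespace CoRM

open Filter Topology

noncomputable section

/-- Used to insert an event about the first `I₀` rows of scores into an infinite product over all
atoms. -/
lemma tendsto_prod_range_mul {c b : ℕ → ℝ≥0∞} {I₀ : ℕ} (hc : ∀ i, I₀ ≤ i → c i = 1)
    (hc1 : ∀ i, c i ≠ ∞) {L : ℝ≥0∞}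
    (hb : Tendsto (fun I => ∏ i ∈ Finset.range I, b i) atTop (𝓝 L)) :
    Tendsto (fun I => ∏ i ∈ Finset.range I, c i * b i) atTop
      (𝓝 ((∏ i ∈ Finset.range I₀, c i) * L)) := by
  refine (ENNReal.Tendsto.const_mul hb
    (Or.inr (ENNReal.prod_ne_top fun i _ => hc1 i))).congr' ?_
  filter_upwards [eventually_ge_atTop I₀] with I hI
  rw [Finset.prod_mul_distrib]
  congr 1
  refine Finset.prod_subset (Finset.range_mono hI) fun i _ hi => hc i ?_
  simpa using hi

lemma measurable_sum_dirac {E : Type*} [MeasurableSpace E] {T : Type*} [MeasurableSpace T]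
    {w : ℕ → T → ℝ≥0∞} {e : ℕ → T → E} (hw : ∀ i, Measurable (w i)) (he : ∀ i, Measurable (e i)) :
    Measurable fun t => Measure.sum fun i => w i t • Measure.dirac (e i t) := by
  refine Measure.measurable_of_measurable_coe _ fun B hB => ?_
  simp_rw [Measure.sum_apply _ hB, Measure.smul_apply, smul_eq_mul, Measure.dirac_apply' _ hB]
  exact Measurable.tsum fun i => (hw i).mul ((measurable_one.indicator hB).comp (he i))

lemma measurableSet_forall_lt {T : Type*} [MeasurableSpace T] {d : ℕ} {m : ℕ → Fin d → T → ℝ}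
    (hm : ∀ i j, Measurable (m i j)) (I : ℕ) {B : ℕ → Fin d → Set ℝ}
    (hB : ∀ i j, MeasurableSet (B i j)) : MeasurableSet {t | ∀ i < I, ∀ j, m i j t ∈ B i j} := by
  have h : {t | ∀ i < I, ∀ j, m i j t ∈ B i j} = ⋂ i, ⋂ (_ : i < I), ⋂ j, m i j ⁻¹' B i j := by
    ext t
    simp
  rw [h]
  exact MeasurableSet.iInter fun i => MeasurableSet.iInter fun _ => MeasurableSet.iInter fun j =>
    hm i j (hB i j)

section Transfer

variable {Ω : Type*} [MeasurableSpace Ω] {P : Measure Ω} {𝕏 : Type u} [MeasurableSpace 𝕏] {d : ℕ}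

/-- A compound random vector may be realized on a space of sequences. -/
theorem IsCompoundVector.exists_small [IsProbabilityMeasure P] {G : Fin d → ℝ → Measure ℝ}
    (hG : ∀ j, Measurable (G j)) {ν : Measure ℝ} {α : Measure 𝕏} {μ : Fin d → Ω → Measure 𝕏}
    (hμ : IsCompoundVector P G ν α μ) :
    ∃ (Ω' : Type u) (_ : MeasurableSpace Ω') (P' : Measure Ω') (_ : IsProbabilityMeasure P')
      (μ' : Fin d → Ω' → Measure 𝕏), IsCompoundVector P' G ν α μ' := by
  obtain ⟨J, x, m, hJx, hm, -⟩ := hμ.series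
  -- The sequences of points and scores live in the universe of `𝕏`, which is the universe required
  -- of `Ω'`.
  let Φ : Ω → (ℕ → ℝ × 𝕏) × (ℕ → Fin d → ℝ) := fun ω =>
    (fun i => (J i ω, x i ω), fun i j => m i j ω)
  have hΦ1 : Measurable fun ω i => (J i ω, x i ω) :=
    measurable_pi_lambda _ fun i => (hJx.measurable_height i).prodMk (hJx.measurable_location i)
  have hΦ : Measurable Φ := hΦ1.prodMk
    (measurable_pi_lambda _ fun i => measurable_pi_lambda _ fun j => hm.measurable_score i j)
  have hP' : IsProbabilityMeasure (P.map Φ) := Measure.isProbabilityMeasure_map hΦ.aemeasurable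
  have hJ' : ∀ i, Measurable fun q : (ℕ → ℝ × 𝕏) × (ℕ → Fin d → ℝ) => (q.1 i).1 := fun i => by
    fun_prop
  have hx' : ∀ i, Measurable fun q : (ℕ → ℝ × 𝕏) × (ℕ → Fin d → ℝ) => (q.1 i).2 := fun i => by
    fun_prop
  have hm' : ∀ i j, Measurable fun q : (ℕ → ℝ × 𝕏) × (ℕ → Fin d → ℝ) => q.2 i j := fun i j => by
    fun_prop
  refine ⟨_, inferInstance, P.map Φ, hP', fun j q => Measure.sum fun i =>
    ENNReal.ofReal (q.2 i j * (q.1 i).1) • Measure.dirac (q.1 i).2, fun j => ?_,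
    fun i q => (q.1 i).1, fun i q => (q.1 i).2, fun i j q => q.2 i j, ⟨hJ', hx', ?_⟩, ⟨hm', ?_⟩,
    ae_of_all _ fun q j => rfl⟩
  · exact measurable_sum_dirac (fun i => by have := hm' i j; have := hJ' i; fun_prop) hx'
  · have hN : Measurable fun q : (ℕ → ℝ × 𝕏) × (ℕ → Fin d → ℝ) =>
        Measure.sum fun i => Measure.dirac ((q.1 i).1, (q.1 i).2) := by
      have := measurable_sum_dirac (w := fun _ _ => 1) (fun i => measurable_const)
        fun i => (hJ' i).prodMk (hx' i)
      simpa using this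
    -- The Poisson property passes to the image law because it is equivalent to a formula for
    -- Laplace functionals.
    refine isPoissonRandomMeasure_of_laplace hN fun h hh => ?_
    exact (lintegral_map (measurable_expNeg.comp ((Measure.measurable_lintegral hh).comp hN))
      hΦ).trans (hJx.poisson.laplace hh)
  · intro C hC I B hB
    have h1 : MeasurableSet {q : (ℕ → ℝ × 𝕏) × (ℕ → Fin d → ℝ) |
        (fun i => ((q.1 i).1, (q.1 i).2)) ∈ C} := by
      exact measurable_fst hC
    rw [Measure.map_apply hΦ, setLIntegral_map h1 _ hΦ]
    · exact hm.condLaw C hC I B hB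
    · exact Finset.measurable_fun_prod _ fun i _ => Finset.measurable_fun_prod _ fun j _ =>
        (Measure.measurable_coe (hB i j)).comp ((hG j).comp (hJ' i))
    · exact h1.inter (measurableSet_forall_lt hm' I hB)

end Transfer

/-! ### Exponential tilting of the probability measure -/

section Tilting

variable {Ω : Type*} [MeasurableSpace Ω] {P : Measure Ω} {𝕏 : Type*} [MeasurableSpace 𝕏] {d : ℕ}
  {f : ℝ → ℝ≥0} {ν : Measure ℝ} {α : Measure 𝕏}

/-- Exponential tilting of a compound vector with i.i.d. scores gives the compound vector with
tilted scores and updated Lévy measure. -/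
theorem IsCompoundVector.tilt [IsProbabilityMeasure P] [SFinite α] [SFinite ν]
    (hf : Measurable f) (hf_one : ∫⁻ m in Ioi (0 : ℝ), (f m : ℝ≥0∞) = 1) (hν : ν (Iic 0) = 0)
    {μ : Fin d → Ω → Measure 𝕏} (hμ : IsCompoundVector P (fun _ _ => scoreLaw f) ν α μ)
    {u : Fin d → ℝ} (hu : ∀ j, 0 < u j)
    (hfin : exponent (jumpMeasure d f ν) α (fun j _ => ENNReal.ofReal (u j)) ≠ ∞) :
    ∃ P' : Measure Ω, IsProbabilityMeasure P' ∧
      IsCompoundVector P' (fun j s => tiltedScoreLaw f (u j) s) (updatedLevy f ν u) α μ := by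
  have hscore := isProbabilityMeasure_scoreLaw hf_one
  set ψ := exponent (jumpMeasure d f ν) α (fun j _ => ENNReal.ofReal (u j)) with hψ
  let D : Ω → ℝ≥0∞ := fun ω => expNeg (pairing (fun j _ => ENNReal.ofReal (u j)) fun j => μ j ω)
  have hD : Measurable D := measurable_expNeg.comp ((measurable_pairing fun j => measurable_const).comp
    (measurable_pi_lambda _ hμ.measurable))
  have hψ0 : expNeg ψ ≠ 0 := fun h => hfin (expNeg_eq_zero_iff.1 h)
  have hDint : ∫⁻ ω, D ω ∂P = expNeg ψ := laplace_iid hf_one hν hμ fun j => measurable_const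
  -- The random vector is unchanged; only the probability is reweighted by the normalized density
  -- `e^{-⟨u, μ⟩}`.
  let P' : Measure Ω := P.withDensity fun ω => (expNeg ψ)⁻¹ * D ω
  have hP'int : ∀ g : Ω → ℝ≥0∞, Measurable g →
      ∫⁻ ω, g ω ∂P' = (expNeg ψ)⁻¹ * ∫⁻ ω, g ω * D ω ∂P := fun g hg => by
    rw [lintegral_withDensity_eq_lintegral_mul _ (hD.const_mul _) hg,
      ← lintegral_const_mul _ (by fun_prop)]
    refine lintegral_congr fun ω => ?_
    simp only [Pi.mul_apply]
    ring
  have hP' : IsProbabilityMeasure P' := ⟨by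
    have := hP'int 1 measurable_one
    simp only [Pi.one_apply, one_mul, lintegral_one] at this
    rw [this, hDint, ENNReal.inv_mul_cancel hψ0 (expNeg_ne_top _)]⟩
  have hac : P' ≪ P := withDensity_absolutelyContinuous _ _
  obtain ⟨J, x, m, hJx, hm, hsum⟩ := hμ.series
  have hpos := hJx.ae_pos hν
  have hz : Measurable fun ω i => (J i ω, x i ω) :=
    measurable_pi_lambda _ fun i => (hJx.measurable_height i).prodMk (hJx.measurable_location i)
  let φ : ℝ → ℝ≥0∞ := fun s => ∏ j, scoreMoment f (ENNReal.ofReal (u j)) 0 s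
  have hφm : Measurable φ :=
    Finset.measurable_fun_prod _ fun j _ => measurable_scoreMoment measurable_const measurable_id 0
  have hφ1 : ∀ s, φ s ≤ 1 := fun s => Finset.prod_le_one' fun j _ => by
    refine (lintegral_mono fun t => ?_).trans (lintegral_one (μ := scoreLaw f) |>.trans_le (by simp))
    simpa using expNeg_le_one _
  let a : ℕ → Fin d → ℝ × 𝕏 → ℝ → ℝ≥0∞ := fun _ j z t =>
    expNeg (ENNReal.ofReal (u j) * ENNReal.ofReal (t * z.1))
  have ham : ∀ i j, Measurable (Function.uncurry (a i j)) := fun i j => by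
    simp only [a, Function.uncurry_def]
    fun_prop
  have hAD : ∀ᵐ ω ∂P, Tendsto (fun I => ∏ i ∈ Finset.range I, ∏ j,
      a i j (J i ω, x i ω) (m i j ω)) atTop (𝓝 (D ω)) := by
    filter_upwards [hsum] with ω hω
    have h1 : (fun j => μ j ω) = fun j => Measure.sum fun i =>
      ENNReal.ofReal (m i j ω * J i ω) • Measure.dirac (x i ω) := funext hω
    simp only [D]
    rw [h1, pairing_sum fun j => measurable_const]
    have := tendsto_prod_expNeg fun i => ∑ j, ENNReal.ofReal (u j) * ENNReal.ofReal (m i j ω * J i ω)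
    simp only [expNeg_sum] at this
    exact this
  have hAφ : ∀ ω, Tendsto (fun I => ∏ i ∈ Finset.range I, ∏ j,
      ∫⁻ t, a i j (J i ω, x i ω) t ∂(scoreLaw f)) atTop
      (𝓝 (expNeg (∑' i, negLog (φ (J i ω))))) := fun ω => by
    have := tendsto_prod_expNeg fun i => negLog (φ (J i ω))
    simp_rw [expNeg_negLog (hφ1 _)] at this
    simpa only [φ, scoreMoment, pow_zero, one_mul] using this
  let K : Fin d → Kernel ℝ ℝ := fun _ => Kernel.const ℝ (scoreLaw f)
  have hmK : IsScoreArray P (fun j s => K j s) J x m := hm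
  have htl : ∀ j s, 0 < s → IsProbabilityMeasure (tiltedScoreLaw f (u j) s) := fun j s hs => by
    rw [tiltedScoreLaw_eq]
    exact isProbabilityMeasure_jumpLaw hf hf_one (hu j) hs 0
  have htm : ∀ j, Measurable (tiltedScoreLaw f (u j)) := fun j => by
    have : tiltedScoreLaw f (u j) = jumpLaw f (u j) 0 := funext (tiltedScoreLaw_eq _)
    rw [this]
    exact measurable_jumpLaw hf _ 0
  refine ⟨P', hP', hμ.measurable, J, x, m, ⟨hJx.measurable_height, hJx.measurable_location, ?_⟩,
    ⟨hm.measurable_score, ?_⟩, hac.ae_le hsum⟩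
  · have hNm := hJx.poisson.measurable
    refine isPoissonRandomMeasure_of_laplace hNm fun h hh => ?_
    have hsumint : ∀ (h : ℝ × 𝕏 → ℝ≥0∞), Measurable h → ∀ ω,
        ∫⁻ e, h e ∂(Measure.sum fun i => Measure.dirac (J i ω, x i ω)) =
          ∑' i, h (J i ω, x i ω) := fun h hh ω => by
      rw [lintegral_sum_measure]
      exact tsum_congr fun i => lintegral_dirac' _ hh
    refine (hP'int _ (measurable_expNeg.comp
      ((Measure.measurable_lintegral hh).comp hNm))).trans ?_
    simp only [Function.comp_apply]
    simp_rw [hsumint h hh]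
    -- Integrating out the scores replaces the density `D` by the product of the `φ (J i)`. Under
    -- `P'`, the Laplace functional of the points at `h` is thus the one under `P` at `h + negLog
    -- φ`, divided by `e^{-ψ}`.
    have h1 := hmK.lintegral_tendsto_prod K hJx.measurable_height hJx.measurable_location
      (g := fun z => expNeg (∑' i, h (z i)))
      (measurable_expNeg.comp (Measurable.tsum fun i => hh.comp (measurable_pi_apply i)))
      (fun z => expNeg_le_one _) ham (fun i j z t => expNeg_le_one _) hAD (ae_of_all _ hAφ)
    have hφn : Measurable fun e : ℝ × 𝕏 => h e + negLog (φ e.1) :=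
      hh.add (measurable_negLog.comp (hφm.comp measurable_fst))
    have h2 := hJx.poisson.laplace hφn
    simp_rw [hsumint _ hφn, ENNReal.tsum_add, expNeg_add, expNeg_negLog (hφ1 _)] at h2
    rw [h1, h2]
    have hφ1m : Measurable fun e : ℝ × 𝕏 => φ e.1 := hφm.comp measurable_fst
    have hm1 : Measurable fun e : ℝ × 𝕏 => 1 - φ e.1 := measurable_const.sub hφ1m
    have hm2 : Measurable fun e : ℝ × 𝕏 => 1 - expNeg (h e) := by fun_prop
    have hψ2 : ψ = ∫⁻ e, (1 - φ e.1) ∂(ν.prod α) := by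
      rw [hψ, exponent_jumpMeasure hf_one]
      exact (lintegral_prod_symm _ hm1.aemeasurable).symm
    have hup : updatedLevy f ν u = ν.withDensity φ := by
      refine withDensity_congr_ae ?_
      filter_upwards [ae_pos_of_levy hν] with s hs
      exact Finset.prod_congr rfl fun j _ => by simpa using scoreIntegral_mul hf (hu j) hs 0
    -- From `1 - e^{-h} φ = (1 - φ) + φ (1 - e^{-h})`: the first term integrates to `ψ`, which the
    -- normalization cancels, and the second is the exponent for the updated Lévy measure `φ ν`.
    have hsplit : ∫⁻ e, (1 - expNeg (h e) * φ e.1) ∂(ν.prod α) =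
        ψ + ∫⁻ e, (1 - expNeg (h e)) ∂((updatedLevy f ν u).prod α) := by
      rw [hup, prod_withDensity_left hφm, lintegral_withDensity_eq_lintegral_mul _
        hφ1m hm2, hψ2, ← lintegral_add_left hm1]
      refine lintegral_congr fun e => ?_
      have := one_sub_expNeg_add (negLog (φ e.1)) (h e)
      rw [expNeg_add, expNeg_negLog (hφ1 _)] at this
      rw [mul_comm, this]
      rfl
    rw [hsplit, expNeg_add, ← mul_assoc, ENNReal.inv_mul_cancel hψ0 (expNeg_ne_top _), one_mul]
  · intro C hC I₀ B hB
    classical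
    have hCm : MeasurableSet {ω | (fun i => (J i ω, x i ω)) ∈ C} := hz hC
    let tl : Fin d → Kernel ℝ ℝ := fun j => posKernel _ (htm j)
    have : ∀ j, IsMarkovKernel (tl j) := fun j => isMarkovKernel_posKernel (htm j) (htl j)
    -- The two sides of the conditional law are compared under `P` by integrating out the scores
    -- from each. This `g` carries the expected answer; the factors `c` below carry the event about
    -- the first `I₀` rows of scores.
    let g : (ℕ → ℝ × 𝕏) → ℝ≥0∞ := C.indicator fun z =>
      ∏ i ∈ Finset.range I₀, ∏ j, tl j (z i).1 (B i j)
    have hgm : Measurable fun z : ℕ → ℝ × 𝕏 => ∏ i ∈ Finset.range I₀, ∏ j, tl j (z i).1 (B i j) :=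
      Finset.measurable_fun_prod _ fun i _ => Finset.measurable_fun_prod _ fun j _ =>
        ((tl j).measurable_coe (hB i j)).comp (by fun_prop)
    have hprod1 : ∀ z : ℕ → ℝ × 𝕏, ∏ i ∈ Finset.range I₀, ∏ j, tl j (z i).1 (B i j) ≤ 1 := fun z =>
      Finset.prod_le_one' fun i _ => Finset.prod_le_one' fun j _ => prob_le_one
    have hR := hmK.lintegral_tendsto_prod K hJx.measurable_height hJx.measurable_location
      (g := g) (hgm.indicator hC)
      (fun z => (indicator_le_self' (fun _ _ => zero_le) _).trans (hprod1 z)) ham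
      (fun i j z t => expNeg_le_one _) hAD (ae_of_all _ hAφ)
    let c : ℕ → Fin d → ℝ → ℝ≥0∞ := fun i j t => if i < I₀ then (B i j).indicator 1 t else 1
    have hcm : ∀ i j, Measurable (c i j) := fun i j => by
      by_cases hi : i < I₀
      · simp only [c, if_pos hi]; exact measurable_one.indicator (hB i j)
      · simp only [c, if_neg hi]; exact measurable_const
    have hc1 : ∀ i j t, c i j t ≤ 1 := fun i j t => by
      simp only [c]
      split_ifs
      · exact indicator_le_self' (fun _ _ => zero_le) _
      · exact le_rfl
    have hL := hmK.lintegral_tendsto_prod K hJx.measurable_height hJx.measurable_location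
      (g := C.indicator 1) (measurable_one.indicator hC)
      (fun z => indicator_le_self' (fun _ _ => zero_le) _)
      (a := fun i j z t => c i j t * a i j z t)
      (fun i j => ((hcm i j).comp measurable_snd).mul (ham i j))
      (fun i j z t => mul_le_one' (hc1 i j t) (expNeg_le_one _))
      (A := fun ω => (∏ i ∈ Finset.range I₀, ∏ j, c i j (m i j ω)) * D ω)
      (A' := fun ω => (∏ i ∈ Finset.range I₀, ∏ j, tl j (J i ω) (B i j)) *
        expNeg (∑' i, negLog (φ (J i ω))))
      (by
        filter_upwards [hAD] with ω hω
        simp only [Finset.prod_mul_distrib (s := Finset.univ)]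
        refine tendsto_prod_range_mul (fun i hi => Finset.prod_eq_one fun j _ => ?_) (fun i => ?_) hω
        · simp [c, hi]
        · exact ENNReal.prod_ne_top fun j _ => ne_top_of_le_ne_top ENNReal.one_ne_top (hc1 _ _ _))
      (by
        filter_upwards [hpos] with ω hω
        -- Bayes' formula for one score: the exponential weight restricted to `B i j` is the tilted
        -- probability of `B i j` times the total weight.
        have hterm : ∀ i j, ∫⁻ t, c i j t * a i j (J i ω, x i ω) t ∂(K j (J i ω)) =
            (if i < I₀ then tl j (J i ω) (B i j) else 1) *
              ∫⁻ t, a i j (J i ω, x i ω) t ∂(scoreLaw f) := fun i j => by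
          by_cases hi : i < I₀
          · have h1 := lintegral_jumpLaw hf (hu j) (hω i) 0 (measurable_one.indicator (hB i j))
            simp only [c, hi, if_true, tl, posKernel_apply _ (hω i), tiltedScoreLaw_eq]
            rw [lintegral_indicator_one (hB i j)] at h1
            simp only [pow_zero, one_mul] at h1
            rw [h1]
            have h2 := scoreMoment_ne_zero hf hf_one (θ := ENNReal.ofReal (u j))
              ENNReal.ofReal_ne_top 0 (hω i)
            have h3 := scoreMoment_ne_top hf_one (θ := ENNReal.ofReal (u j))
              (by simpa using hu j) 0 (J i ω)
            have h4 : ∫⁻ t, a i j (J i ω, x i ω) t ∂(scoreLaw f) =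
                scoreMoment f (ENNReal.ofReal (u j)) 0 (J i ω) := by
              simp [a, scoreMoment]
            rw [h4, mul_right_comm, ENNReal.inv_mul_cancel h2 h3, one_mul]
            rfl
          · simp only [c, hi, if_false, one_mul]
            rfl
        simp only [hterm, Finset.prod_mul_distrib (s := Finset.univ)]
        have h5 := tendsto_prod_range_mul (I₀ := I₀)
          (c := fun i => ∏ j, if i < I₀ then tl j (J i ω) (B i j) else 1)
          (fun i hi => Finset.prod_eq_one fun j _ => by simp [hi])
          (fun i => ENNReal.prod_ne_top fun j _ => by
            split_ifs
            · exact measure_ne_top _ _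
            · exact ENNReal.one_ne_top) (hAφ ω)
        have h6 : ∏ i ∈ Finset.range I₀, ∏ j, (if i < I₀ then tl j (J i ω) (B i j) else 1) =
            ∏ i ∈ Finset.range I₀, ∏ j, tl j (J i ω) (B i j) :=
          Finset.prod_congr rfl fun i hi => Finset.prod_congr rfl fun j _ =>
            if_pos (Finset.mem_range.1 hi)
        rw [h6] at h5
        exact h5)
    have hSm : MeasurableSet {ω | (fun i => (J i ω, x i ω)) ∈ C ∧ ∀ i < I₀, ∀ j, m i j ω ∈ B i j} :=
      hCm.inter (measurableSet_forall_lt hm.measurable_score I₀ hB)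
    have hind : ∀ ω, {ω | (fun i => (J i ω, x i ω)) ∈ C ∧ ∀ i < I₀, ∀ j, m i j ω ∈ B i j}.indicator
        (1 : Ω → ℝ≥0∞) ω * D ω = C.indicator 1 (fun i => (J i ω, x i ω)) *
          ((∏ i ∈ Finset.range I₀, ∏ j, c i j (m i j ω)) * D ω) := fun ω => by
      rw [← mul_assoc]
      congr 1
      by_cases hC' : (fun i => (J i ω, x i ω)) ∈ C
      · rw [indicator_of_mem hC', Pi.one_apply, one_mul]
        by_cases hall : ∀ i < I₀, ∀ j, m i j ω ∈ B i j
        · rw [indicator_of_mem (by exact ⟨hC', hall⟩), Pi.one_apply]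
          refine (Finset.prod_eq_one fun i hi => Finset.prod_eq_one fun j _ => ?_).symm
          simp [c, Finset.mem_range.1 hi, hall i (Finset.mem_range.1 hi) j]
        · rw [indicator_of_notMem fun h => hall h.2]
          push Not at hall
          obtain ⟨i, hi, j, hij⟩ := hall
          refine (Finset.prod_eq_zero (Finset.mem_range.2 hi)
            (Finset.prod_eq_zero (Finset.mem_univ j) ?_)).symm
          simp [c, hi, hij]
      · rw [indicator_of_notMem fun h => hC' h.1, indicator_of_notMem hC', zero_mul]
    have e1 : P' {ω | (fun i => (J i ω, x i ω)) ∈ C ∧ ∀ i < I₀, ∀ j, m i j ω ∈ B i j} =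
        (expNeg ψ)⁻¹ * ∫⁻ ω, C.indicator 1 (fun i => (J i ω, x i ω)) *
          ((∏ i ∈ Finset.range I₀, ∏ j, c i j (m i j ω)) * D ω) ∂P := by
      rw [← lintegral_indicator_one hSm, hP'int _ (measurable_one.indicator hSm)]
      simp_rw [hind]
    have e2 : ∫⁻ ω in {ω | (fun i => (J i ω, x i ω)) ∈ C},
        ∏ i ∈ Finset.range I₀, ∏ j, tiltedScoreLaw f (u j) (J i ω) (B i j) ∂P' =
        (expNeg ψ)⁻¹ * ∫⁻ ω, g (fun i => (J i ω, x i ω)) * D ω ∂P := by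
      refine Eq.trans ?_ (hP'int _ ((hgm.indicator hC).comp hz))
      rw [← lintegral_indicator hCm]
      refine lintegral_congr_ae ?_
      filter_upwards [hac.ae_le hpos] with ω hω
      by_cases hC' : (fun i => (J i ω, x i ω)) ∈ C
      · rw [indicator_of_mem (by exact hC')]
        refine Eq.trans ?_ (indicator_of_mem hC' _).symm
        simp only [tl, posKernel_apply _ (hω _)]
      · rw [indicator_of_notMem (by exact hC')]
        exact (indicator_of_notMem hC' _).symm
    rw [e1, e2, hL, hR]
    congr 1
    refine lintegral_congr fun ω => ?_
    by_cases hC' : (fun i => (J i ω, x i ω)) ∈ C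
    · simp only [g]
      rw [indicator_of_mem hC', indicator_of_mem hC', Pi.one_apply, one_mul]
    · simp only [g]
      rw [indicator_of_notMem hC', indicator_of_notMem hC', zero_mul, zero_mul]

end Tilting

end

end CoRM

/-! ### Jumps at the observed values -/

namespace CoRM

open Filter Topology

noncomputable section

section Jumps

variable {d : ℕ} {f : ℝ → ℝ≥0} {ν : Measure ℝ} {u : Fin d → ℝ} {k : Fin d → ℕ}

lemma exists_jumpKernel (hf : Measurable f) (hf_one : ∫⁻ m in Ioi (0 : ℝ), (f m : ℝ≥0∞) = 1)
    (hu : ∀ j, 0 < u j) (k : Fin d → ℕ) :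
    ∃ κ : Kernel ℝ (Fin d → ℝ), IsMarkovKernel κ ∧
      ∀ s, 0 < s → κ s = Measure.pi fun j => jumpLaw f (u j) (k j) s := by
  have hmk : ∀ j s, IsProbabilityMeasure
      (posKernel (jumpLaw f (u j) (k j)) (measurable_jumpLaw hf _ _) s) := fun j s => by
    have := isMarkovKernel_posKernel (measurable_jumpLaw hf (u j) (k j))
      fun s hs => isProbabilityMeasure_jumpLaw hf hf_one (hu j) hs (k j)
    exact this.isProbabilityMeasure s
  refine ⟨⟨fun s => Measure.pi fun j =>
    posKernel (jumpLaw f (u j) (k j)) (measurable_jumpLaw hf _ _) s,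
    measurable_measure_pi fun j => Kernel.measurable _⟩, ⟨fun s => ?_⟩, fun s hs => ?_⟩
  · change IsProbabilityMeasure (Measure.pi _)
    infer_instance
  · change Measure.pi _ = _
    congr 1
    funext j
    exact posKernel_apply _ hs

/-- The normalizing constant of `sigmaLaw` is the moment of the jump measure, the same quantity that
appears in the density of the samples. -/
lemma sigmaLaw_eq (hf : Measurable f) (hf_one : ∫⁻ m in Ioi (0 : ℝ), (f m : ℝ≥0∞) = 1)
    (hν : ν (Iic 0) = 0) (hu : ∀ j, 0 < u j) (k : Fin d → ℕ) :
    sigmaLaw f ν u k = (jumpMoment (jumpMeasure d f ν) k fun j => ENNReal.ofReal (u j))⁻¹ •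
      ν.withDensity fun s => ∏ j, scoreMoment f (ENNReal.ofReal (u j)) (k j) s := by
  have h1 : (ν.withDensity fun s => ∏ j, (scoreIntegral f (u j) (k j) s *
      ENNReal.ofReal (s ^ k j))) =
      ν.withDensity fun s => ∏ j, scoreMoment f (ENNReal.ofReal (u j)) (k j) s := by
    refine withDensity_congr_ae ?_
    filter_upwards [ae_pos_of_levy hν] with s hs
    exact Finset.prod_congr rfl fun j _ => scoreIntegral_mul hf (hu j) hs _
  rw [sigmaLaw, normalized, h1, withDensity_apply _ MeasurableSet.univ, Measure.restrict_univ,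
    jumpMoment_jumpMeasure hf_one]

lemma lintegral_sigmaLaw (hf : Measurable f) (hf_one : ∫⁻ m in Ioi (0 : ℝ), (f m : ℝ≥0∞) = 1)
    (hν : ν (Iic 0) = 0) (hu : ∀ j, 0 < u j) (k : Fin d → ℕ) {g : ℝ → ℝ≥0∞} (hg : Measurable g) :
    ∫⁻ s, g s ∂(sigmaLaw f ν u k) =
      (jumpMoment (jumpMeasure d f ν) k fun j => ENNReal.ofReal (u j))⁻¹ *
        ∫⁻ s, (∏ j, scoreMoment f (ENNReal.ofReal (u j)) (k j) s) * g s ∂ν := by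
  have h1 : Measurable fun s => ∏ j, scoreMoment f (ENNReal.ofReal (u j)) (k j) s :=
    Finset.measurable_fun_prod _ fun j _ => measurable_scoreMoment measurable_const measurable_id _
  rw [sigmaLaw_eq hf hf_one hν hu, lintegral_smul_measure, smul_eq_mul,
    lintegral_withDensity_eq_lintegral_mul _ h1 hg]
  rfl

lemma sigmaLaw_ae_pos (hν : ν (Iic 0) = 0) : ∀ᵐ s ∂(sigmaLaw f ν u k), 0 < s := by
  have : sigmaLaw f ν u k ≪ ν :=
    Measure.AbsolutelyContinuous.smul_left (withDensity_absolutelyContinuous _ _) _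
  exact this.ae_le (ae_pos_of_levy hν)

lemma isProbabilityMeasure_sigmaLaw (hf : Measurable f)
    (hf_one : ∫⁻ m in Ioi (0 : ℝ), (f m : ℝ≥0∞) = 1) (hν : ν (Iic 0) = 0) (hu : ∀ j, 0 < u j)
    (h0 : jumpMoment (jumpMeasure d f ν) k (fun j => ENNReal.ofReal (u j)) ≠ 0)
    (h1 : jumpMoment (jumpMeasure d f ν) k (fun j => ENNReal.ofReal (u j)) ≠ ∞) :
    IsProbabilityMeasure (sigmaLaw f ν u k) := ⟨by
  have := lintegral_sigmaLaw hf hf_one hν hu k (measurable_const (a := (1 : ℝ≥0∞)))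
  rw [lintegral_one] at this
  rw [this]
  simp only [mul_one]
  rw [← jumpMoment_jumpMeasure hf_one, ENNReal.inv_mul_cancel h0 h1]⟩

lemma compProd_sigmaLaw_apply [IsProbabilityMeasure (sigmaLaw f ν u k)] (hν : ν (Iic 0) = 0)
    {κ : Kernel ℝ (Fin d → ℝ)} [IsMarkovKernel κ]
    (hf : Measurable f) (hf_one : ∫⁻ m in Ioi (0 : ℝ), (f m : ℝ≥0∞) = 1) (hu : ∀ j, 0 < u j)
    (hκ : ∀ s, 0 < s → κ s = Measure.pi fun j => jumpLaw f (u j) (k j) s)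
    {A : Set ℝ} {B : Fin d → Set ℝ} (hA : MeasurableSet A) (hB : ∀ j, MeasurableSet (B j)) :
    (sigmaLaw f ν u k ⊗ₘ κ) (A ×ˢ univ.pi B) =
      ∫⁻ s in A, ∏ j, jumpLaw f (u j) (k j) s (B j) ∂(sigmaLaw f ν u k) := by
  rw [Measure.compProd_apply_prod hA (MeasurableSet.univ_pi hB)]
  refine lintegral_congr_ae (ae_restrict_of_ae ?_)
  filter_upwards [sigmaLaw_ae_pos hν] with s hs
  have := fun j => isProbabilityMeasure_jumpLaw hf hf_one (hu j) hs (k j)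
  rw [hκ s hs, Measure.pi_pi]

/-- The Laplace transform of the jumps at a fixed atom. -/
lemma laplace_jumps (hf : Measurable f) (hf_one : ∫⁻ m in Ioi (0 : ℝ), (f m : ℝ≥0∞) = 1)
    (hν : ν (Iic 0) = 0) (hu : ∀ j, 0 < u j)
    (h0 : jumpMoment (jumpMeasure d f ν) k (fun j => ENNReal.ofReal (u j)) ≠ 0)
    (h1 : jumpMoment (jumpMeasure d f ν) k (fun j => ENNReal.ofReal (u j)) ≠ ∞)
    {Ω : Type*} [MeasurableSpace Ω] {P : Measure Ω} [IsProbabilityMeasure P]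
    {σ : Ω → ℝ} {T : Fin d → Ω → ℝ} (hσ : Measurable σ) (hT : ∀ j, Measurable (T j))
    (hlaw : ∀ (A : Set ℝ) (B : Fin d → Set ℝ), MeasurableSet A → (∀ j, MeasurableSet (B j)) →
      P {ω | σ ω ∈ A ∧ ∀ j, T j ω ∈ B j} =
        ∫⁻ s in A, ∏ j, jumpLaw f (u j) (k j) s (B j) ∂(sigmaLaw f ν u k)) (θ : Fin d → ℝ≥0∞) :
    ∫⁻ ω, expNeg (∑ j, θ j * ENNReal.ofReal (T j ω * σ ω)) ∂P =
      (jumpMoment (jumpMeasure d f ν) k fun j => ENNReal.ofReal (u j))⁻¹ *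
        jumpMoment (jumpMeasure d f ν) k fun j => θ j + ENNReal.ofReal (u j) := by
  obtain ⟨κ, hκ1, hκ⟩ := exists_jumpKernel hf hf_one hu k
  have hsp := isProbabilityMeasure_sigmaLaw hf hf_one hν hu h0 h1
  have hm : Measurable fun ω => (σ ω, fun j => T j ω) := hσ.prodMk (measurable_pi_lambda _ hT)
  -- The law is prescribed on boxes, which determine it.
  have hmap : P.map (fun ω => (σ ω, fun j => T j ω)) = sigmaLaw f ν u k ⊗ₘ κ := by
    have := Measure.isProbabilityMeasure_map (μ := P) hm.aemeasurable
    refine ext_prod_pi fun A B hA hB => ?_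
    rw [Measure.map_apply hm (hA.prod (MeasurableSet.univ_pi hB)),
      compProd_sigmaLaw_apply hν hf hf_one hu hκ hA hB, ← hlaw A B hA hB]
    congr 1
    ext ω
    simp
  have hF : Measurable fun q : ℝ × (Fin d → ℝ) =>
      expNeg (∑ j, θ j * ENNReal.ofReal (q.2 j * q.1)) := by fun_prop
  refine (lintegral_map hF hm).symm.trans ?_
  have hg : Measurable fun s => ∏ j, ((scoreMoment f (ENNReal.ofReal (u j)) (k j) s)⁻¹ *
      scoreMoment f (θ j + ENNReal.ofReal (u j)) (k j) s) :=
    Finset.measurable_fun_prod _ fun j _ =>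
      (measurable_scoreMoment measurable_const measurable_id _).inv.mul
        (measurable_scoreMoment measurable_const measurable_id _)
  rw [hmap, Measure.lintegral_compProd hF]
  have h2 : ∫⁻ s, ∫⁻ t, expNeg (∑ j, θ j * ENNReal.ofReal (t j * s)) ∂(κ s) ∂(sigmaLaw f ν u k) =
      ∫⁻ s, ∏ j, ((scoreMoment f (ENNReal.ofReal (u j)) (k j) s)⁻¹ *
        scoreMoment f (θ j + ENNReal.ofReal (u j)) (k j) s) ∂(sigmaLaw f ν u k) := by
    refine lintegral_congr_ae ?_
    filter_upwards [sigmaLaw_ae_pos hν] with s hs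
    have := fun j => isProbabilityMeasure_jumpLaw hf hf_one (hu j) hs (k j)
    simp_rw [hκ s hs, expNeg_sum]
    rw [lintegral_pi_prod _ (f := fun j t => expNeg (θ j * ENNReal.ofReal (t * s)))
      fun j => by fun_prop]
    exact Finset.prod_congr rfl fun j _ => lintegral_expNeg_jumpLaw hf (hu j) hs _ _
  -- The density of `sigmaLaw` is the product of the denominators produced by the `jumpLaw`
  -- transforms, so they cancel.
  rw [h2, lintegral_sigmaLaw hf hf_one hν hu k hg, jumpMoment_jumpMeasure hf_one k
    fun j => θ j + ENNReal.ofReal (u j)]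
  congr 1
  refine lintegral_congr_ae ?_
  filter_upwards [ae_pos_of_levy hν] with s hs
  rw [← Finset.prod_mul_distrib]
  refine Finset.prod_congr rfl fun j _ => ?_
  rw [← mul_assoc, ENNReal.mul_inv_cancel (scoreMoment_ne_zero hf hf_one ENNReal.ofReal_ne_top _ hs)
    (scoreMoment_ne_top hf_one (by simpa using hu j) _ _), one_mul]

end Jumps

/-! ### Laplace functional and existence of the posterior representation -/

section Posterior

variable {𝕏 : Type*} [MeasurableSpace 𝕏] {d : ℕ} {n : Fin d → ℕ}

/-- The unnormalized Laplace functional of the posterior law for the samples `x`. -/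
def posteriorLaplace (ρ : Measure (Fin d → ℝ≥0)) (α : Measure 𝕏)
    (x : (j : Fin d) → Fin (n j) → 𝕏) (H : Fin d → 𝕏 → ℝ≥0∞) : ℝ≥0∞ :=
  expNeg (exponent ρ α H) *
    ∏ a ∈ distinctValues x, jumpMoment ρ (frequency x a) fun j => H j a

omit [MeasurableSpace 𝕏] in
lemma frequency_ne_zero {x : (j : Fin d) → Fin (n j) → 𝕏} (a : distinctValues x) :
    frequency x a ≠ 0 := by
  classical
  obtain ⟨a, ha⟩ := a
  simp only [distinctValues, Finset.mem_image, Finset.mem_univ, true_and] at ha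
  obtain ⟨p, hp⟩ := ha
  intro h
  have := congrFun h p.1
  simp only [frequency, Pi.zero_apply, Finset.card_eq_zero] at this
  exact Finset.eq_empty_iff_forall_notMem.1 this p.2 (by simpa using hp)

variable {f : ℝ → ℝ≥0} {ν : Measure ℝ} {α : Measure 𝕏} {u : Fin d → ℝ}
  {x : (j : Fin d) → Fin (n j) → 𝕏}

section

variable {Ω : Type*} [MeasurableSpace Ω] {P : Measure Ω}
  {μ' : Fin d → Ω → Measure 𝕏} {σ : distinctValues x → Ω → ℝ} {T : distinctValues x → Fin d → Ω → ℝ}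

lemma measurable_posteriorVector (h : IsPosteriorRepresentation P f ν α x u μ' σ T) :
    Measurable (posteriorVector x μ' σ T) := by
  refine measurable_pi_lambda _ fun j => ?_
  refine Measure.measurable_of_measurable_coe _ fun B hB => ?_
  have h1 : Measurable fun ω => μ' j ω B := (Measure.measurable_coe hB).comp (h.compound.measurable j)
  have h2 : ∀ a : distinctValues x, Measurable fun ω => ENNReal.ofReal (T a j ω * σ a ω) *
      Measure.dirac (a : 𝕏) B := fun a =>
    ((h.measurable_jump a j).mul (h.measurable_sigma a)).ennreal_ofReal.mul_const _
  simp only [posteriorVector, Measure.add_apply, Measure.finsetSum_apply, Measure.smul_apply,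
    smul_eq_mul]
  exact h1.add (Finset.measurable_fun_sum _ fun a _ => h2 a)

omit [MeasurableSpace Ω] in
lemma pairing_posteriorVector {H : Fin d → 𝕏 → ℝ≥0∞} (hH : ∀ j, Measurable (H j)) (ω : Ω) :
    pairing H (posteriorVector x μ' σ T ω) = pairing H (fun j => μ' j ω) +
      ∑ a : distinctValues x, ∑ j, H j a * ENNReal.ofReal (T a j ω * σ a ω) := by
  simp only [pairing, posteriorVector, lintegral_add_measure, Finset.sum_add_distrib]
  rw [Finset.sum_comm (s := (Finset.univ : Finset (distinctValues x)))]
  congr 1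
  refine Finset.sum_congr rfl fun j _ => ?_
  rw [lintegral_finsetSum_measure]
  refine Finset.sum_congr rfl fun a _ => ?_
  rw [lintegral_smul_measure, lintegral_dirac' _ (hH j), smul_eq_mul, mul_comm]

/-- By independence the transform is a product: the tilted vector contributes the increment of the
exponent from `u` to `H + u`, and each observed value a ratio of jump moments. Multiplying by the
value at `u` instead of dividing keeps the formula free of quotients. -/
theorem IsPosteriorRepresentation.laplace [IsProbabilityMeasure P] [SFinite ν] [SFinite α]
    (hf : Measurable f) (hf_one : ∫⁻ m in Ioi (0 : ℝ), (f m : ℝ≥0∞) = 1) (hν : ν (Iic 0) = 0)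
    (hu : ∀ j, 0 < u j)
    (h0 : ∀ k, jumpMoment (jumpMeasure d f ν) k (fun j => ENNReal.ofReal (u j)) ≠ 0)
    (h1 : ∀ k, k ≠ 0 → jumpMoment (jumpMeasure d f ν) k (fun j => ENNReal.ofReal (u j)) ≠ ∞)
    (h : IsPosteriorRepresentation P f ν α x u μ' σ T) {H : Fin d → 𝕏 → ℝ≥0∞}
    (hH : ∀ j, Measurable (H j)) :
    posteriorLaplace (jumpMeasure d f ν) α x (fun j _ => ENNReal.ofReal (u j)) *
        ∫⁻ μ, expNeg (pairing H μ) ∂(P.map (posteriorVector x μ' σ T)) =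
      posteriorLaplace (jumpMeasure d f ν) α x (fun j y => H j y + ENNReal.ofReal (u j)) := by
  have hpm : Measurable fun μ : Fin d → Measure 𝕏 => expNeg (pairing H μ) :=
    measurable_expNeg.comp (measurable_pairing hH)
  rw [lintegral_map hpm (measurable_posteriorVector h)]
  simp_rw [pairing_posteriorVector hH, expNeg_add, expNeg_sum (Finset.univ (α := distinctValues x))]
  have hg : ∀ a : distinctValues x, Measurable fun q : ℝ × (Fin d → ℝ) =>
      expNeg (∑ j, H j (a : 𝕏) * ENNReal.ofReal (q.2 j * q.1)) := fun a => by fun_prop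
  have hind := h.parts_indep.comp (φ := fun μ => expNeg (pairing H μ))
    (ψ := fun q : distinctValues x → ℝ × (Fin d → ℝ) =>
      ∏ a : distinctValues x, expNeg (∑ j, H j a * ENNReal.ofReal ((q a).2 j * (q a).1)))
    (measurable_expNeg.comp (measurable_pairing hH))
    (Finset.measurable_fun_prod _ fun a _ => (hg a).comp (measurable_pi_apply a))
  have hjm : ∀ a, Measurable fun ω => (σ a ω, fun j => T a j ω) := fun a =>
    (h.measurable_sigma a).prodMk (measurable_pi_lambda _ (h.measurable_jump a))
  have e1 := lintegral_mul_eq_lintegral_mul_lintegral_of_indepFun''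
    ((measurable_expNeg.comp (measurable_pairing hH)).comp
      (measurable_pi_lambda _ h.compound.measurable)).aemeasurable
    ((Finset.measurable_fun_prod _ fun a _ => (hg a).comp (measurable_pi_apply a)).comp
      (measurable_pi_lambda _ hjm)).aemeasurable hind
  simp only [Function.comp_apply] at e1
  have hind2 := h.jumps_indep.comp _ hg
  have e2 := lintegral_prod_eq_prod_lintegral_of_indepFun Finset.univ _ hind2
    fun a => (hg a).comp (hjm a)
  simp only [Function.comp_apply] at e2
  have e3 := fun a => laplace_jumps hf hf_one hν hu (h0 _) (h1 _ (frequency_ne_zero a))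
    (h.measurable_sigma a) (h.measurable_jump a) (h.jumps_law a) fun j => H j (a : 𝕏)
  rw [e1, e2]
  simp_rw [e3]
  rw [Finset.prod_mul_distrib, posteriorLaplace, posteriorLaplace, ← laplace_tilted hf hf_one hν hu
    h.compound hH, ← Finset.prod_coe_sort (distinctValues x), ← Finset.prod_coe_sort
    (distinctValues x)]
  have e4 : (∏ a : distinctValues x,
      jumpMoment (jumpMeasure d f ν) (frequency x a) fun j => ENNReal.ofReal (u j)) *
      ∏ a : distinctValues x, (jumpMoment (jumpMeasure d f ν) (frequency x a)
        fun j => ENNReal.ofReal (u j))⁻¹ = 1 := by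
    rw [← Finset.prod_mul_distrib]
    exact Finset.prod_eq_one fun a _ => ENNReal.mul_inv_cancel (h0 _) (h1 _ (frequency_ne_zero a))
  calc _ = expNeg (exponent (jumpMeasure d f ν) α fun j _ => ENNReal.ofReal (u j)) *
        (∫⁻ ω, expNeg (pairing H fun j => μ' j ω) ∂P) *
        (((∏ a : distinctValues x,
      jumpMoment (jumpMeasure d f ν) (frequency x a) fun j => ENNReal.ofReal (u j)) *
      ∏ a : distinctValues x, (jumpMoment (jumpMeasure d f ν) (frequency x a)
        fun j => ENNReal.ofReal (u j))⁻¹) * ∏ a : distinctValues x,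
          jumpMoment (jumpMeasure d f ν) (frequency x a) fun j => H j (a : 𝕏) + ENNReal.ofReal (u j)) := by
        ring
    _ = _ := by rw [e4, one_mul]

end

lemma iIndepFun_comp_measurePreserving {ι Ω Ω' : Type*} [Fintype ι] [MeasurableSpace Ω]
    [MeasurableSpace Ω'] {P : Measure Ω} {P' : Measure Ω'} [IsProbabilityMeasure P]
    [IsProbabilityMeasure P'] {E : ι → Type*} [∀ i, MeasurableSpace (E i)] {Y : (i : ι) → Ω → E i}
    (hY : ∀ i, Measurable (Y i)) (h : iIndepFun Y P) {φ : Ω' → Ω} (hφ : MeasurePreserving φ P' P) :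
    iIndepFun (fun i ω => Y i (φ ω)) P' := by
  rw [iIndepFun_iff_map_fun_eq_pi_map fun i => (hY i).aemeasurable] at h
  refine (iIndepFun_iff_map_fun_eq_pi_map
    fun i => ((hY i).comp hφ.measurable).aemeasurable).2 ?_
  have h1 : P'.map (fun ω i => Y i (φ ω)) = P.map fun ω i => Y i ω := by
    rw [← hφ.map_eq, Measure.map_map (measurable_pi_lambda _ hY) hφ.measurable]
    rfl
  have h2 : ∀ i, P'.map (Y i ∘ φ) = P.map (Y i) := fun i => by
    rw [← hφ.map_eq, Measure.map_map (hY i) hφ.measurable]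
  simp_rw [h2]
  exact h1.trans h

lemma IsCompoundVector.comp_measurePreserving {Ω Ω' : Type*} [MeasurableSpace Ω]
    [MeasurableSpace Ω'] {P : Measure Ω} {P' : Measure Ω'} [IsProbabilityMeasure P]
    [IsProbabilityMeasure P'] {G : Fin d → ℝ → Measure ℝ} (hG : ∀ j, Measurable (G j))
    {μ : Fin d → Ω → Measure 𝕏} (h : IsCompoundVector P G ν α μ) {φ : Ω' → Ω}
    (hφ : MeasurePreserving φ P' P) : IsCompoundVector P' G ν α fun j ω => μ j (φ ω) := by
  obtain ⟨J, y, m, hJ, hm, hsum⟩ := h.series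
  have hz : Measurable fun ω i => (J i ω, y i ω) :=
    measurable_pi_lambda _ fun i => (hJ.measurable_height i).prodMk (hJ.measurable_location i)
  refine ⟨fun j => (h.measurable j).comp hφ.measurable, fun i ω => J i (φ ω), fun i ω => y i (φ ω),
    fun i j ω => m i j (φ ω), ⟨fun i => (hJ.measurable_height i).comp hφ.measurable,
      fun i => (hJ.measurable_location i).comp hφ.measurable, ?_⟩,
    ⟨fun i j => (hm.measurable_score i j).comp hφ.measurable, fun C hC I B hB => ?_⟩,
    hφ.quasiMeasurePreserving.ae hsum⟩
  · refine isPoissonRandomMeasure_of_laplace (hJ.poisson.measurable.comp hφ.measurable)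
      fun h hh => ?_
    refine Eq.trans ?_ (hJ.poisson.laplace hh)
    exact hφ.lintegral_comp (measurable_expNeg.comp
      ((Measure.measurable_lintegral hh).comp hJ.poisson.measurable))
  · have h1 := hφ.measure_preimage ((hz hC).inter
      (measurableSet_forall_lt hm.measurable_score I hB)).nullMeasurableSet
    have h2 := hφ.setLIntegral_comp_preimage (hz hC) (f := fun ω =>
      ∏ i ∈ Finset.range I, ∏ j, G j (J i ω) (B i j))
      (Finset.measurable_fun_prod _ fun i _ => Finset.measurable_fun_prod _ fun j _ =>
        (Measure.measurable_coe (hB i j)).comp ((hG j).comp (hJ.measurable_height i)))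
    exact h1.trans ((hm.condLaw C hC I B hB).trans h2.symm)

end Posterior

/-- Existence of a posterior representation. -/
theorem exists_posteriorRepresentation {𝕏 : Type u} [MeasurableSpace 𝕏] {d : ℕ} {n : Fin d → ℕ}
    {Ω : Type*} [MeasurableSpace Ω] {P : Measure Ω} [IsProbabilityMeasure P]
    {f : ℝ → ℝ≥0} {ν : Measure ℝ} {α : Measure 𝕏} [SFinite ν] [SFinite α]
    (hf : Measurable f) (hf_one : ∫⁻ m in Ioi (0 : ℝ), (f m : ℝ≥0∞) = 1) (hν : ν (Iic 0) = 0)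
    {μ : Fin d → Ω → Measure 𝕏} (hμ : IsCompoundVector P (fun _ _ => scoreLaw f) ν α μ)
    {u : Fin d → ℝ} (hu : ∀ j, 0 < u j)
    (hfin : exponent (jumpMeasure d f ν) α (fun j _ => ENNReal.ofReal (u j)) ≠ ∞)
    (h0 : ∀ k, jumpMoment (jumpMeasure d f ν) k (fun j => ENNReal.ofReal (u j)) ≠ 0)
    (h1 : ∀ k, k ≠ 0 → jumpMoment (jumpMeasure d f ν) k (fun j => ENNReal.ofReal (u j)) ≠ ∞)
    (x : (j : Fin d) → Fin (n j) → 𝕏) :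
    ∃ (Ω' : Type u) (_ : MeasurableSpace Ω') (P' : Measure Ω') (_ : IsProbabilityMeasure P')
      (μ' : Fin d → Ω' → Measure 𝕏) (σ : distinctValues x → Ω' → ℝ)
      (T : distinctValues x → Fin d → Ω' → ℝ),
      IsPosteriorRepresentation P' f ν α x u μ' σ T := by
  have hG : ∀ j, Measurable (tiltedScoreLaw f (u j)) := fun j => by
    have : tiltedScoreLaw f (u j) = jumpLaw f (u j) 0 := funext (tiltedScoreLaw_eq _)
    rw [this]
    exact measurable_jumpLaw hf _ 0
  obtain ⟨P₀, hP₀, hcomp⟩ := hμ.tilt hf hf_one hν hu hfin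
  obtain ⟨Ω₁, _, P₁, hP₁, μ₁, hμ₁⟩ := hcomp.exists_small hG
  choose κ hκ1 hκ using fun k => exists_jumpKernel hf hf_one hu k
  have hs : ∀ a : distinctValues x, IsProbabilityMeasure (sigmaLaw f ν u (frequency x a)) :=
    fun a => isProbabilityMeasure_sigmaLaw hf hf_one hν hu (h0 _) (h1 _ (frequency_ne_zero a))
  -- The representation lives on a product space, which provides all the required independence.
  let Λ : distinctValues x → Measure (ℝ × (Fin d → ℝ)) := fun a =>
    sigmaLaw f ν u (frequency x a) ⊗ₘ κ (frequency x a)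
  refine ⟨Ω₁ × (distinctValues x → ℝ × (Fin d → ℝ)), inferInstance, P₁.prod (Measure.pi Λ),
    inferInstance, fun j ω => μ₁ j ω.1, fun a ω => (ω.2 a).1, fun a j ω => (ω.2 a).2 j,
    hμ₁.comp_measurePreserving hG measurePreserving_fst, fun a => by fun_prop,
    fun a j => by fun_prop, fun a A B hA hB => ?_, ?_, ?_⟩
  · rw [← compProd_sigmaLaw_apply hν hf hf_one hu (hκ (frequency x a)) hA hB]
    have hmp : MeasurePreserving (fun ω : Ω₁ × (distinctValues x → ℝ × (Fin d → ℝ)) => ω.2 a)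
        (P₁.prod (Measure.pi Λ)) (Λ a) := (measurePreserving_eval Λ a).comp measurePreserving_snd
    rw [← hmp.measure_preimage (hA.prod (MeasurableSet.univ_pi hB)).nullMeasurableSet]
    congr 1
    ext ω
    simp
  · have h2 : iIndepFun (fun a (q : distinctValues x → ℝ × (Fin d → ℝ)) => q a) (Measure.pi Λ) :=
      iIndepFun_pi (X := fun _ q => q) fun a => aemeasurable_id
    exact iIndepFun_comp_measurePreserving (fun a => measurable_pi_apply a) h2 measurePreserving_snd
  · exact indepFun_prod (X := fun ω j => μ₁ j ω)
      (Y := fun (q : distinctValues x → ℝ × (Fin d → ℝ)) a => q a)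
      (measurable_pi_lambda _ hμ₁.measurable) measurable_id

end

end CoRM

/-! ### One-sided derivatives along dyadic increments -/

namespace CoRM

open Filter Topology

noncomputable section

section Slope

lemma mul_expNeg_le_one_sub (δ : ℝ≥0∞) : δ * expNeg δ ≤ 1 - expNeg δ := by
  rcases eq_or_ne δ ∞ with rfl | h
  · simp [expNeg_top]
  · lift δ to ℝ≥0 using h
    have h1 := Real.add_one_le_exp (δ : ℝ)
    rw [expNeg_eq_ofReal ENNReal.coe_ne_top, ← ENNReal.ofReal_one,
      ← ENNReal.ofReal_sub _ (Real.exp_pos _).le, ← ENNReal.ofReal_coe_nnreal,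
      ← ENNReal.ofReal_mul δ.coe_nonneg, ENNReal.toReal_ofReal δ.coe_nonneg]
    refine ENNReal.ofReal_le_ofReal ?_
    have h2 : Real.exp (δ : ℝ) * Real.exp (-(δ : ℝ)) = 1 := by
      rw [← Real.exp_add, add_neg_cancel, Real.exp_zero]
    nlinarith [Real.exp_pos (-(δ : ℝ))]

lemma tendsto_inv_two_pow_mul {z : ℝ≥0∞} (hz : z ≠ ∞) :
    Tendsto (fun n : ℕ => ((2 : ℝ≥0∞) ^ n)⁻¹ * z) atTop (𝓝 0) := by
  have h : Tendsto (fun n : ℕ => ((2 : ℝ≥0∞) ^ n)⁻¹) atTop (𝓝 0) := by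
    simp_rw [ENNReal.inv_pow]
    exact ENNReal.tendsto_pow_atTop_nhds_zero_of_lt_one (by simp)
  simpa using ENNReal.Tendsto.mul_const h (Or.inr hz)

lemma two_pow_ne_zero (n : ℕ) : (2 : ℝ≥0∞) ^ n ≠ 0 := by simp

lemma two_pow_ne_top (n : ℕ) : (2 : ℝ≥0∞) ^ n ≠ ∞ := by simp

/-- The chain rule for `1 - e^{-δ}` at 0: it lies between `δ e^{-δ}` and `δ`, and finiteness of `L`
forces `δ n → 0`. -/
lemma tendsto_two_pow_mul_one_sub {δ : ℕ → ℝ≥0∞} {L : ℝ≥0∞} (hL : L ≠ ∞)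
    (h : Tendsto (fun n => 2 ^ n * δ n) atTop (𝓝 L)) :
    Tendsto (fun n => 2 ^ n * (1 - expNeg (δ n))) atTop (𝓝 L) := by
  have h0 : Tendsto δ atTop (𝓝 0) := by
    have h1 : Tendsto (fun n : ℕ => ((2 : ℝ≥0∞) ^ n)⁻¹) atTop (𝓝 0) := by
      simpa using tendsto_inv_two_pow_mul ENNReal.one_ne_top
    have h2 := ENNReal.Tendsto.mul h1 (Or.inr hL) h (Or.inr ENNReal.zero_ne_top)
    rw [zero_mul] at h2
    refine h2.congr fun n => ?_
    rw [← mul_assoc, ENNReal.inv_mul_cancel (two_pow_ne_zero n) (two_pow_ne_top n), one_mul]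
  have h3 : Tendsto (fun n => 2 ^ n * δ n * expNeg (δ n)) atTop (𝓝 L) := by
    have := ENNReal.Tendsto.mul h (Or.inr ENNReal.one_ne_top)
      (b := 1) (by simpa [expNeg_zero] using (continuous_expNeg.tendsto 0).comp h0) (Or.inr hL)
    simpa using this
  refine tendsto_of_tendsto_of_tendsto_of_le_of_le h3 h (fun n => ?_) fun n => ?_
  · simp only [mul_assoc]
    exact mul_le_mul_right (mul_expNeg_le_one_sub _) _
  · exact mul_le_mul_right ((one_sub_expNeg_le _).trans (min_le_right _ _)) _

/-- Halving the increment raises the quotient, since `1 - e^{-2y} ≤ 2 (1 - e^{-y})`. Dyadic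
increments make this enough for monotone convergence, so no dominating function is needed. -/
lemma monotone_two_pow_mul_one_sub (z : ℝ≥0∞) :
    Monotone fun n : ℕ => 2 ^ n * (1 - expNeg ((2 ^ n)⁻¹ * z)) := by
  refine monotone_nat_of_le_succ fun n => ?_
  set y := ((2 : ℝ≥0∞) ^ (n + 1))⁻¹ * z with hy
  have h1 : ((2 : ℝ≥0∞) ^ n)⁻¹ * z = y + y := by
    rw [hy, ← add_mul, ← two_mul, pow_succ, ENNReal.mul_inv (by simp) (by simp), mul_comm (2 : ℝ≥0∞),
      mul_assoc _ _ (2 : ℝ≥0∞), ENNReal.inv_mul_cancel (by simp) (by simp), mul_one]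
  rw [h1, one_sub_expNeg_add, pow_succ, mul_assoc, two_mul]
  refine mul_le_mul_right (add_le_add le_rfl ?_) _
  exact mul_le_of_le_one_left' (expNeg_le_one _)

lemma tendsto_two_pow_mul_one_sub_self (z : ℝ≥0∞) :
    Tendsto (fun n : ℕ => 2 ^ n * (1 - expNeg ((2 ^ n)⁻¹ * z))) atTop (𝓝 z) := by
  rcases eq_or_ne z ∞ with rfl | hz
  · have : ∀ n : ℕ, ((2 : ℝ≥0∞) ^ n)⁻¹ * ∞ = ∞ := fun n =>
      ENNReal.mul_top (ENNReal.inv_ne_zero.2 (two_pow_ne_top n))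
    simp_rw [this, expNeg_top, tsub_zero, mul_one]
    exact ENNReal.tendsto_pow_atTop_nhds_top_iff.2 (by norm_num)
  · refine tendsto_two_pow_mul_one_sub hz (tendsto_const_nhds.congr fun n => ?_)
    rw [← mul_assoc, ENNReal.mul_inv_cancel (two_pow_ne_zero n) (two_pow_ne_top n), one_mul]

/-- `A` is the value at `0` and `a n` the value at `2⁻ⁿ` of a decreasing function whose difference
quotients at `0` increase to `A'`. -/
structure HasSlope (A : ℝ≥0∞) (a : ℕ → ℝ≥0∞) (A' : ℝ≥0∞) : Prop where
  ne_top : A ≠ ∞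
  slope_ne_top : A' ≠ ∞
  le : ∀ n, a n ≤ A
  mono : Monotone a
  slope_mono : Monotone fun n => 2 ^ n * (A - a n)
  tendsto_slope : Tendsto (fun n => 2 ^ n * (A - a n)) atTop (𝓝 A')

namespace HasSlope

variable {A B : ℝ≥0∞} {a b : ℕ → ℝ≥0∞} {A' B' : ℝ≥0∞}

lemma tendsto (h : HasSlope A a A') : Tendsto a atTop (𝓝 A) := by
  have h1 : Tendsto (fun n : ℕ => A - ((2 : ℝ≥0∞) ^ n)⁻¹ * A') atTop (𝓝 A) := by
    simpa using ENNReal.Tendsto.sub tendsto_const_nhds (tendsto_inv_two_pow_mul h.slope_ne_top)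
      (Or.inl h.ne_top)
  refine tendsto_of_tendsto_of_tendsto_of_le_of_le h1 tendsto_const_nhds (fun n => ?_) h.le
  have h2 : 2 ^ n * (A - a n) ≤ A' := h.slope_mono.ge_of_tendsto h.tendsto_slope n
  have h3 : A - a n ≤ ((2 : ℝ≥0∞) ^ n)⁻¹ * A' := by
    rw [mul_comm, ← div_eq_mul_inv, ENNReal.le_div_iff_mul_le (Or.inl (two_pow_ne_zero n))
      (Or.inl (two_pow_ne_top n)), mul_comm]
    exact h2
  exact tsub_le_iff_left.2 (tsub_le_iff_right.1 h3)

lemma mul_sub_mul (hA : HasSlope A a A') (hB : HasSlope B b B') (n : ℕ) :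
    A * B - a n * b n = (A - a n) * B + a n * (B - b n) := by
  have ha := ne_top_of_le_ne_top hA.ne_top (hA.le n)
  have hb := ne_top_of_le_ne_top hB.ne_top (hB.le n)
  refine ENNReal.sub_eq_of_eq_add (ENNReal.mul_ne_top ha hb) ?_
  rw [add_assoc, ← mul_add, tsub_add_cancel_of_le (hB.le n), ← add_mul,
    tsub_add_cancel_of_le (hA.le n)]

/-- The product rule, from `A B - a b = (A - a) B + a (B - b)`. Both summands of the quotient are
increasing because `a` and the two slopes are, so monotonicity survives products. -/
lemma mul (hA : HasSlope A a A') (hB : HasSlope B b B') :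
    HasSlope (A * B) (fun n => a n * b n) (A' * B + A * B') := by
  have h : (fun n => 2 ^ n * (A * B - a n * b n)) = fun n =>
      2 ^ n * (A - a n) * B + a n * (2 ^ n * (B - b n)) := funext fun n => by
    rw [hA.mul_sub_mul hB]
    ring
  refine ⟨ENNReal.mul_ne_top hA.ne_top hB.ne_top, ENNReal.add_ne_top.2
    ⟨ENNReal.mul_ne_top hA.slope_ne_top hB.ne_top, ENNReal.mul_ne_top hA.ne_top hB.slope_ne_top⟩,
    fun n => mul_le_mul' (hA.le n) (hB.le n), fun m n hmn => mul_le_mul' (hA.mono hmn) (hB.mono hmn),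
    ?_, ?_⟩
  · rw [h]
    exact fun m n hmn => add_le_add (mul_le_mul' (hA.slope_mono hmn) le_rfl)
      (mul_le_mul' (hA.mono hmn) (hB.slope_mono hmn))
  · rw [h]
    exact (ENNReal.Tendsto.mul_const hA.tendsto_slope (Or.inr hB.ne_top)).add
      (ENNReal.Tendsto.mul hA.tendsto (Or.inr hB.slope_ne_top) hB.tendsto_slope
        (Or.inr hA.ne_top))

lemma prod {ι : Type*} [DecidableEq ι] (s : Finset ι) {A : ι → ℝ≥0∞} {a : ι → ℕ → ℝ≥0∞}
    {A' : ι → ℝ≥0∞} (h : ∀ i ∈ s, HasSlope (A i) (a i) (A' i)) :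
    HasSlope (∏ i ∈ s, A i) (fun n => ∏ i ∈ s, a i n)
      (∑ i ∈ s, A' i * ∏ k ∈ s.erase i, A k) := by
  induction s using Finset.induction_on with
  | empty =>
    simp only [Finset.prod_empty, Finset.sum_empty]
    exact ⟨ENNReal.one_ne_top, ENNReal.zero_ne_top, fun _ => le_rfl, fun _ _ _ => le_rfl,
      by simp [monotone_const], by simp⟩
  | insert i s hi ih =>
    have h1 := (h i (Finset.mem_insert_self i s)).mul
      (ih fun k hk => h k (Finset.mem_insert_of_mem hk))
    simp only [Finset.prod_insert hi, Finset.sum_insert hi, Finset.erase_insert hi]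
    convert h1 using 2
    rw [Finset.mul_sum]
    refine Finset.sum_congr rfl fun k hk => ?_
    have hki : i ≠ k := fun h => hi (h ▸ hk)
    rw [Finset.erase_insert_of_ne hki, Finset.prod_insert fun h => hi (Finset.mem_of_mem_erase h)]
    ring

end HasSlope

section Integral

variable {E : Type*} [MeasurableSpace E] {m : Measure E} {F Z : E → ℝ≥0∞}

lemma two_pow_mul_lintegral_sub (hF : Measurable F) (hZ : Measurable Z) (h : ∫⁻ e, F e ∂m ≠ ∞)
    (n : ℕ) : 2 ^ n * (∫⁻ e, F e ∂m - ∫⁻ e, F e * expNeg ((2 ^ n)⁻¹ * Z e) ∂m) =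
      ∫⁻ e, F e * (2 ^ n * (1 - expNeg ((2 ^ n)⁻¹ * Z e))) ∂m := by
  have hle : ∀ e, F e * expNeg ((2 ^ n)⁻¹ * Z e) ≤ F e := fun e =>
    mul_le_of_le_one_right' (expNeg_le_one _)
  rw [← lintegral_sub (by fun_prop) (ne_top_of_le_ne_top h (lintegral_mono hle)) (ae_of_all _ hle),
    ← lintegral_const_mul _ (by fun_prop)]
  refine lintegral_congr_ae ?_
  filter_upwards [ae_lt_top hF h] with e he
  rw [mul_left_comm, ENNReal.mul_sub fun _ _ => he.ne, mul_one]

lemma monotone_slope_lintegral (hF : Measurable F) (hZ : Measurable Z) (h : ∫⁻ e, F e ∂m ≠ ∞) :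
    Monotone fun n : ℕ =>
      2 ^ n * (∫⁻ e, F e ∂m - ∫⁻ e, F e * expNeg ((2 ^ n)⁻¹ * Z e) ∂m) := by
  simp_rw [two_pow_mul_lintegral_sub hF hZ h]
  exact fun a b hab => lintegral_mono fun e =>
    mul_le_mul_right (monotone_two_pow_mul_one_sub (Z e) hab) _

/-- The quotients increase pointwise to `Z`, so monotone convergence applies even when the limit is
infinite. -/
lemma tendsto_lintegral_two_pow_mul (hF : Measurable F) (hZ : Measurable Z) :
    Tendsto (fun n : ℕ => ∫⁻ e, F e * (2 ^ n * (1 - expNeg ((2 ^ n)⁻¹ * Z e))) ∂m) atTop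
      (𝓝 (∫⁻ e, F e * Z e ∂m)) := by
  refine lintegral_tendsto_of_tendsto_of_monotone (fun n => by fun_prop)
    (ae_of_all _ fun e a b hab => mul_le_mul_right (monotone_two_pow_mul_one_sub (Z e) hab) _)
    (ae_of_all _ fun e => ?_)
  -- At `Z e = 0` the value `F e` may be infinite and multiplication by it is not continuous; there
  -- all terms vanish.
  rcases eq_or_ne (Z e) 0 with h0 | h0
  · simp [h0, expNeg_zero]
  · exact ENNReal.Tendsto.const_mul (tendsto_two_pow_mul_one_sub_self _) (Or.inl h0)

lemma tendsto_slope_lintegral (hF : Measurable F) (hZ : Measurable Z) (h : ∫⁻ e, F e ∂m ≠ ∞) :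
    Tendsto (fun n : ℕ =>
      2 ^ n * (∫⁻ e, F e ∂m - ∫⁻ e, F e * expNeg ((2 ^ n)⁻¹ * Z e) ∂m)) atTop
      (𝓝 (∫⁻ e, F e * Z e ∂m)) := by
  simp_rw [two_pow_mul_lintegral_sub hF hZ h]
  exact tendsto_lintegral_two_pow_mul hF hZ

lemma monotone_lintegral_mul_expNeg : Monotone fun n : ℕ =>
    ∫⁻ e, F e * expNeg ((2 ^ n)⁻¹ * Z e) ∂m := fun _ _ hab => lintegral_mono fun _ =>
  mul_le_mul_right (expNeg_antitone (mul_le_mul_left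
    (ENNReal.inv_le_inv.2 (pow_le_pow_right' one_le_two hab)) _)) _

lemma hasSlope_lintegral (hF : Measurable F) (hZ : Measurable Z) (h : ∫⁻ e, F e ∂m ≠ ∞)
    (h' : ∫⁻ e, F e * Z e ∂m ≠ ∞) : HasSlope (∫⁻ e, F e ∂m)
      (fun n => ∫⁻ e, F e * expNeg ((2 ^ n)⁻¹ * Z e) ∂m) (∫⁻ e, F e * Z e ∂m) :=
  ⟨h, h', fun _ => lintegral_mono fun _ => mul_le_of_le_one_right' (expNeg_le_one _),
    monotone_lintegral_mul_expNeg, monotone_slope_lintegral hF hZ h, tendsto_slope_lintegral hF hZ h⟩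

end Integral

end Slope

end

end CoRM

/-! ### Labelled points and their distinct values -/

namespace CoRM

open Filter Topology

noncomputable section

section Labels

variable {𝕏 ι : Type*} [Fintype ι] {d : ℕ}

open Classical in
/-- The number of points with label `j` located at `a`. -/
def occurrences (g : ι → Fin d) (x : ι → 𝕏) (a : 𝕏) (j : Fin d) : ℕ :=
  (Finset.univ.filter fun p => g p = j ∧ x p = a).card

open Classical in
lemma occurrences_cons {q : ℕ} (g : Fin (q + 1) → Fin d) (y : 𝕏) (x : Fin q → 𝕏) (a : 𝕏) :
    occurrences g (Fin.cons y x) a =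
      occurrences (fun p => g p.succ) x a + if y = a then Pi.single (g 0) 1 else 0 := by
  funext j
  simp only [occurrences, Pi.add_apply, Finset.card_filter, Fin.sum_univ_succ, Fin.cons_zero,
    Fin.cons_succ]
  rw [add_comm]
  congr 1
  by_cases h : y = a <;> by_cases h' : g 0 = j <;> simp [h, h']

open Classical in
lemma image_cons {q : ℕ} (y : 𝕏) (x : Fin q → 𝕏) :
    Finset.univ.image (Fin.cons y x : Fin (q + 1) → 𝕏) = insert y (Finset.univ.image x) := by
  ext a
  simp [Fin.exists_fin_succ, eq_comm]

open Classical in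
lemma occurrences_eq_zero {g : ι → Fin d} {x : ι → 𝕏} {a : 𝕏} (ha : a ∉ Finset.univ.image x) :
    occurrences g x a = 0 := by
  funext j
  simp only [Finset.mem_image, Finset.mem_univ, true_and, not_exists] at ha
  simp [occurrences, ha]

open Classical in
lemma occurrences_ne_zero {g : ι → Fin d} {x : ι → 𝕏} {a : 𝕏} (ha : a ∈ Finset.univ.image x) :
    occurrences g x a ≠ 0 := by
  simp only [Finset.mem_image, Finset.mem_univ, true_and] at ha
  obtain ⟨p, rfl⟩ := ha
  intro h
  have := congrFun h (g p)
  simp only [occurrences, Pi.zero_apply, Finset.card_eq_zero] at this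
  exact Finset.eq_empty_iff_forall_notMem.1 this p (by simp)

/-- The points that are not repetitions of a point with a smaller index. -/
def IsFirst {q : ℕ} (x : Fin q → 𝕏) (p : Fin q) : Prop := ∀ p' < p, x p' ≠ x p

open Classical in
lemma exists_isFirst {q : ℕ} (x : Fin q → 𝕏) {a : 𝕏} (ha : a ∈ Finset.univ.image x) :
    ∃ p, IsFirst x p ∧ x p = a := by
  simp only [Finset.mem_image, Finset.mem_univ, true_and] at ha
  have hne : (Finset.univ.filter fun p => x p = a).Nonempty := by
    obtain ⟨p, hp⟩ := ha
    exact ⟨p, by simpa using hp⟩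
  have h1 := Finset.min'_mem _ hne
  simp only [Finset.mem_filter, Finset.mem_univ, true_and] at h1
  refine ⟨_, fun p' hp' h => ?_, h1⟩
  exact not_lt.2 (Finset.min'_le _ p' (by simpa using h.trans h1)) hp'

open Classical in
lemma image_filter_isFirst {q : ℕ} (x : Fin q → 𝕏) :
    (Finset.univ.filter fun p => IsFirst x p).image x = Finset.univ.image x := by
  refine Finset.Subset.antisymm (Finset.image_subset_image (Finset.filter_subset _ _)) fun a ha => ?_
  obtain ⟨p, hp, rfl⟩ := exists_isFirst x ha
  exact Finset.mem_image_of_mem _ (by simpa using hp)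

open Classical in
lemma injOn_isFirst {q : ℕ} (x : Fin q → 𝕏) :
    Set.InjOn x (Finset.univ.filter fun p => IsFirst x p : Finset (Fin q)) := by
  intro p hp p' hp' h
  simp only [Finset.coe_filter, Finset.mem_univ, true_and, mem_ofPred_eq] at hp hp'
  rcases lt_trichotomy p p' with h1 | h1 | h1
  · exact absurd h (hp' p h1)
  · exact h1
  · exact absurd h.symm (hp p' h1)

open Classical in
-- Each distinct value is counted at its first occurrence. The index set then no longer depends on
-- `x`, which makes measurability in `x` and integration term by term accessible.
lemma sum_image_eq {q : ℕ} (x : Fin q → 𝕏) (h : 𝕏 → ℝ≥0∞) :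
    ∑ a ∈ Finset.univ.image x, h a = ∑ p, if IsFirst x p then h (x p) else 0 := by
  rw [← image_filter_isFirst, Finset.sum_image (injOn_isFirst x), Finset.sum_filter]

open Classical in
lemma prod_image_eq {q : ℕ} (x : Fin q → 𝕏) (h : 𝕏 → ℝ≥0∞) :
    ∏ a ∈ Finset.univ.image x, h a = ∏ p, if IsFirst x p then h (x p) else 1 := by
  rw [← image_filter_isFirst, Finset.prod_image (injOn_isFirst x), Finset.prod_filter]

lemma measurableSet_isFirst [MeasurableSpace 𝕏] [MeasurableEq 𝕏] {q : ℕ} (p : Fin q) :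
    MeasurableSet {x : Fin q → 𝕏 | IsFirst x p} := by
  have : {x : Fin q → 𝕏 | IsFirst x p} = ⋂ p', ⋂ (_ : p' < p), {x : Fin q → 𝕏 | x p' = x p}ᶜ := by
    ext x
    simp [IsFirst]
  rw [this]
  exact MeasurableSet.iInter fun p' => MeasurableSet.iInter fun _ =>
    (measurableSet_eq_fun (measurable_pi_apply p') (measurable_pi_apply p)).compl

end Labels

/-! ### The densities of the labelled points -/

section Moments

variable {𝕏 : Type*} [MeasurableSpace 𝕏] {d : ℕ} {ρ : Measure (Fin d → ℝ≥0)} {α : Measure 𝕏}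

open Classical in
/-- The density of the observed points with labels `g` under exponential tilting by `H`. -/
def labelLaplace {ι : Type*} [Fintype ι] (ρ : Measure (Fin d → ℝ≥0)) (α : Measure 𝕏)
    (g : ι → Fin d) (x : ι → 𝕏) (H : Fin d → 𝕏 → ℝ≥0∞) : ℝ≥0∞ :=
  expNeg (exponent ρ α H) *
    ∏ a ∈ Finset.univ.image x, jumpMoment ρ (occurrences g x a) fun j => H j a

lemma measurable_exponent [SFinite ρ] [SFinite α] {T : Type*} [MeasurableSpace T]
    {H : T → Fin d → 𝕏 → ℝ≥0∞} (hH : ∀ j, Measurable fun z : T × 𝕏 => H z.1 j z.2) :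
    Measurable fun t => exponent ρ α (H t) := by
  unfold exponent
  refine Measurable.lintegral_prod_right' (f := fun z : T × 𝕏 =>
    ∫⁻ w, (1 - expNeg (∑ j, H z.1 j z.2 * w j)) ∂ρ) ?_
  refine Measurable.lintegral_prod_right' (f := fun z : (T × 𝕏) × (Fin d → ℝ≥0) =>
    1 - expNeg (∑ j, H z.1.1 j z.1.2 * z.2 j)) ?_
  have : ∀ j, Measurable fun z : (T × 𝕏) × (Fin d → ℝ≥0) => H z.1.1 j z.1.2 := fun j =>
    (hH j).comp measurable_fst
  fun_prop

lemma measurable_jumpMoment_of_measurable [SFinite ρ] {T : Type*} [MeasurableSpace T]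
    {k : T → Fin d → ℕ} (hk : Measurable k) {θ : T → Fin d → ℝ≥0∞} (hθ : Measurable θ) :
    Measurable fun t => jumpMoment ρ (k t) (θ t) := by
  have h : Measurable fun z : (Fin d → ℕ) × (Fin d → ℝ≥0∞) => jumpMoment ρ z.1 z.2 :=
    measurable_from_prod_countable_right fun k => measurable_jumpMoment k measurable_id
  exact h.comp (hk.prodMk hθ)

/-- The product over distinct values becomes a product over first occurrences, and the multi-indices
take countably many values. -/
lemma measurable_labelLaplace [SFinite ρ] [SFinite α] [MeasurableEq 𝕏] {T : Type*}
    [MeasurableSpace T] {q : ℕ} (g : Fin q → Fin d) {x : T → Fin q → 𝕏} (hx : Measurable x)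
    {H : T → Fin d → 𝕏 → ℝ≥0∞} (hH : ∀ j, Measurable fun z : T × 𝕏 => H z.1 j z.2) :
    Measurable fun t => labelLaplace ρ α g (x t) (H t) := by
  classical
  have h1 : ∀ t, labelLaplace ρ α g (x t) (H t) = expNeg (exponent ρ α (H t)) *
      ∏ p, if IsFirst (x t) p then
        jumpMoment ρ (occurrences g (x t) (x t p)) (fun j => H t j (x t p)) else 1 := fun t => by
    rw [← prod_image_eq (x t) fun a => jumpMoment ρ (occurrences g (x t) a) (fun j => H t j a)]
    rfl
  simp_rw [h1]
  refine (measurable_expNeg.comp (measurable_exponent hH)).mul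
    (Finset.measurable_fun_prod _ fun p _ => ?_)
  have hfirst : MeasurableSet {t | IsFirst (x t) p} := hx (measurableSet_isFirst p)
  refine Measurable.ite hfirst ?_ measurable_const
  have hxp : Measurable fun t => x t p := (measurable_pi_apply p).comp hx
  have hocc : Measurable fun t => occurrences g (x t) (x t p) := by
    refine measurable_pi_lambda _ fun j => ?_
    simp only [occurrences, Finset.card_filter]
    refine Finset.measurable_fun_sum _ fun p' _ => ?_
    have hxp' : Measurable fun t => x t p' := (measurable_pi_apply p').comp hx
    have hS : MeasurableSet {t | g p' = j ∧ x t p' = x t p} :=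
      (MeasurableSet.const _).inter (measurableSet_eq_fun hxp' hxp)
    exact Measurable.ite hS measurable_const measurable_const
  have hθ : Measurable fun t => fun j => H t j (x t p) := measurable_pi_lambda _ fun j =>
    (hH j).comp (measurable_id.prodMk hxp)
  exact measurable_jumpMoment_of_measurable hocc hθ

open Classical in
-- A new value opens its own moment factor, with a single occurrence; a repeated value, as in
-- `labelLaplace_cons_of_mem`, raises the multi-index of an existing factor.
lemma labelLaplace_cons_of_notMem {q : ℕ} (g : Fin (q + 1) → Fin d) {y : 𝕏} {x : Fin q → 𝕏}
    (hy : y ∉ Finset.univ.image x) (H : Fin d → 𝕏 → ℝ≥0∞) :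
    labelLaplace ρ α g (Fin.cons y x) H = jumpMoment ρ (Pi.single (g 0) 1) (fun j => H j y) *
      labelLaplace ρ α (fun p => g p.succ) x H := by
  unfold labelLaplace
  rw [image_cons, Finset.prod_insert hy, occurrences_cons, occurrences_eq_zero hy, if_pos rfl,
    zero_add, mul_left_comm]
  congr 2
  refine Finset.prod_congr rfl fun a ha => ?_
  have : y ≠ a := fun h => hy (h ▸ ha)
  rw [occurrences_cons, if_neg this, add_zero]

open Classical in
lemma labelLaplace_cons_of_mem {q : ℕ} (g : Fin (q + 1) → Fin d) {y : 𝕏} {x : Fin q → 𝕏}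
    (hy : y ∈ Finset.univ.image x) (H : Fin d → 𝕏 → ℝ≥0∞) :
    labelLaplace ρ α g (Fin.cons y x) H = expNeg (exponent ρ α H) *
      (jumpMoment ρ (occurrences (fun p => g p.succ) x y + Pi.single (g 0) 1) (fun j => H j y) *
      ∏ a ∈ (Finset.univ.image x).erase y,
        jumpMoment ρ (occurrences (fun p => g p.succ) x a) fun j => H j a) := by
  unfold labelLaplace
  rw [image_cons, Finset.insert_eq_self.2 hy, ← Finset.mul_prod_erase _ _ hy, occurrences_cons,
    if_pos rfl]
  congr 2
  refine Finset.prod_congr rfl fun a ha => ?_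
  rw [occurrences_cons, if_neg (Finset.ne_of_mem_erase ha).symm, add_zero]

/-- Half of `H` is spent on bounding one factor, by `a e^{-(c/2) a} ≤ C'` for the total mass `a`;
the other half is left to the induction with `c / 2`. If the total mass is infinite the exponential
vanishes. -/
lemma exists_expNeg_pairing_mul_prod_le {q : ℕ} (g : Fin q → Fin d) (B : Fin q → Set 𝕏)
    {c : ℝ≥0∞} (hc : c ≠ 0) : ∃ C : ℝ≥0∞, C ≠ ∞ ∧ ∀ H : Fin d → 𝕏 → ℝ≥0∞,
      (∀ j, Measurable (H j)) → (∀ j y, c ≤ H j y) → ∀ μ : Fin d → Measure 𝕏,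
        expNeg (pairing H μ) * ∏ p, μ (g p) (B p) ≤ C := by
  induction q generalizing c with
  | zero => exact ⟨1, ENNReal.one_ne_top, fun H _ _ μ => by simpa using expNeg_le_one _⟩
  | succ q ih =>
    have hc2 : c / 2 ≠ 0 := by simpa using hc
    obtain ⟨C, hC, h⟩ := ih (fun p => g p.succ) (fun p => B p.succ) hc2
    obtain ⟨C', hC', h'⟩ := exists_pow_mul_expNeg_le 1 hc2
    refine ⟨C * C', ENNReal.mul_ne_top hC hC', fun H hH hcH μ => ?_⟩
    have hH2 : ∀ j, Measurable fun y => H j y / 2 := fun j => (hH j).div_const _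
    have hle : ∀ j y, c / 2 ≤ H j y / 2 := fun j y => ENNReal.div_le_div_right (hcH j y) _
    have e1 : pairing H μ = pairing (fun j y => H j y / 2) μ + pairing (fun j y => H j y / 2) μ := by
      rw [← pairing_add hH2]
      congr 1
      funext j y
      exact (ENNReal.add_halves _).symm
    have e2 : μ (g 0) (B 0) * expNeg (pairing (fun j y => H j y / 2) μ) ≤ C' := by
      have h3 : c / 2 * μ (g 0) univ ≤ pairing (fun j y => H j y / 2) μ := by
        rw [← lintegral_const]
        exact (lintegral_mono (hle (g 0))).trans (Finset.single_le_sum (f := fun j =>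
          ∫⁻ y, H j y / 2 ∂(μ j)) (fun _ _ => zero_le) (Finset.mem_univ (g 0)))
      rcases eq_or_ne (μ (g 0) univ) ∞ with h4 | h4
      · rw [h4, ENNReal.mul_top hc2, top_le_iff] at h3
        simp [h3, expNeg_top]
      · lift μ (g 0) univ to ℝ≥0 using h4 with a ha
        calc _ ≤ (a : ℝ≥0∞) * expNeg (c / 2 * a) :=
              mul_le_mul' (ha ▸ measure_mono (subset_univ _)) (expNeg_antitone h3)
          _ ≤ C' := by simpa using h' a
    rw [Fin.prod_univ_succ, e1, expNeg_add]
    calc _ = (expNeg (pairing (fun j y => H j y / 2) μ) * ∏ p : Fin q, μ (g p.succ) (B p.succ)) *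
          (μ (g 0) (B 0) * expNeg (pairing (fun j y => H j y / 2) μ)) := by ring
      _ ≤ C * C' := mul_le_mul' (h _ hH2 hle μ) e2

end Moments

end

end CoRM

/-! ### Moment measures by differentiation of the Laplace functional -/

namespace CoRM

open Filter Topology

noncomputable section

section Moments

variable {𝕏 : Type*} [MeasurableSpace 𝕏] {d : ℕ} {ρ : Measure (Fin d → ℝ≥0)} {α : Measure 𝕏}

/-- The indicator of `B` in the coordinate `j`. -/
def coordIndicator (j : Fin d) (B : Set 𝕏) (i : Fin d) (y : 𝕏) : ℝ≥0∞ :=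
  if i = j then B.indicator 1 y else 0

lemma measurable_coordIndicator (j : Fin d) {B : Set 𝕏} (hB : MeasurableSet B) (i : Fin d) :
    Measurable (coordIndicator j B i) := by
  unfold coordIndicator
  split_ifs
  · exact measurable_one.indicator hB
  · exact measurable_const

lemma pairing_coordIndicator (j : Fin d) {B : Set 𝕏} (hB : MeasurableSet B)
    (μ : Fin d → Measure 𝕏) : pairing (coordIndicator j B) μ = μ j B := by
  rw [pairing, Finset.sum_eq_single j]
  · simp only [coordIndicator, if_true]
    exact lintegral_indicator_one hB
  · intro i _ hi
    simp [coordIndicator, hi]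
  · simp

omit [MeasurableSpace 𝕏] in
lemma sum_coordIndicator_mul (j : Fin d) (B : Set 𝕏) (y : 𝕏) (w : Fin d → ℝ≥0) :
    ∑ i, coordIndicator j B i y * w i = B.indicator 1 y * (w j : ℝ≥0∞) := by
  simp [coordIndicator]

/-- The function `H` increased by `2⁻ⁿ` on `B` in the coordinate `j`. -/
def bump (H : Fin d → 𝕏 → ℝ≥0∞) (j : Fin d) (B : Set 𝕏) (n : ℕ) (i : Fin d) (y : 𝕏) : ℝ≥0∞ :=
  H i y + (2 ^ n)⁻¹ * coordIndicator j B i y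

lemma measurable_bump {H : Fin d → 𝕏 → ℝ≥0∞} (hH : ∀ j, Measurable (H j)) (j : Fin d) {B : Set 𝕏}
    (hB : MeasurableSet B) (n : ℕ) (i : Fin d) : Measurable (bump H j B n i) :=
  (hH i).add ((measurable_coordIndicator j hB i).const_mul _)

lemma pairing_bump {H : Fin d → 𝕏 → ℝ≥0∞} (hH : ∀ j, Measurable (H j)) (j : Fin d) {B : Set 𝕏}
    (hB : MeasurableSet B) (n : ℕ) (μ : Fin d → Measure 𝕏) :
    pairing (bump H j B n) μ = pairing H μ + (2 ^ n)⁻¹ * μ j B := by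
  rw [← pairing_coordIndicator j hB μ]
  refine (pairing_add hH (H' := fun i y => (2 ^ n)⁻¹ * coordIndicator j B i y) μ).trans ?_
  congr 1
  simp only [pairing, Finset.mul_sum]
  exact Finset.sum_congr rfl fun i _ => lintegral_const_mul _ (measurable_coordIndicator j hB i)

lemma jumpMoment_antitone (k : Fin d → ℕ) {θ θ' : Fin d → ℝ≥0∞} (h : θ ≤ θ') :
    jumpMoment ρ k θ' ≤ jumpMoment ρ k θ :=
  lintegral_mono fun _ => mul_le_mul_right (expNeg_antitone
    (Finset.sum_le_sum fun j _ => mul_le_mul_left (h j) _)) _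

lemma jumpMoment_add_single (k : Fin d → ℕ) (j : Fin d) (θ : Fin d → ℝ≥0∞) :
    jumpMoment ρ (k + Pi.single j 1) θ =
      ∫⁻ w, ((∏ i, (w i : ℝ≥0∞) ^ k i) * expNeg (∑ i, θ i * w i)) * (w j : ℝ≥0∞) ∂ρ := by
  refine lintegral_congr fun w => ?_
  have : ∏ i, (w i : ℝ≥0∞) ^ (Pi.single j 1 : Fin d → ℕ) i = w j := by
    rw [Finset.prod_eq_single j]
    · simp
    · intro i _ hi
      simp [hi]
    · simp
  simp only [Pi.add_apply, pow_add, Finset.prod_mul_distrib, this]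
  ring

omit [MeasurableSpace 𝕏] in
-- Differentiating `e^{-θ·w}` in `θ j` brings down a factor `w j`. The bump changes `θ j` only if `a
-- ∈ B`, whence the indicator.
lemma hasSlope_jumpMoment (hρ : ∀ j, ∫⁻ w, min 1 (w j : ℝ≥0∞) ∂ρ ≠ ∞) {k : Fin d → ℕ}
    (hk : k ≠ 0) (H : Fin d → 𝕏 → ℝ≥0∞) {a : 𝕏} (ha : ∀ j, H j a ≠ 0) (j : Fin d) (B : Set 𝕏) :
    HasSlope (jumpMoment ρ k fun i => H i a) (fun n => jumpMoment ρ k fun i => bump H j B n i a)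
      (B.indicator 1 a * jumpMoment ρ (k + Pi.single j 1) fun i => H i a) := by
  have hk' : k + Pi.single j 1 ≠ 0 := fun h => by
    have := congrFun h j
    simp at this
  have h1 : jumpMoment ρ k (fun i => H i a) ≠ ∞ := jumpMoment_ne_top hρ hk ha
  have h2 : ∫⁻ w, ((∏ i, (w i : ℝ≥0∞) ^ k i) * expNeg (∑ i, H i a * w i)) *
      (B.indicator 1 a * (w j : ℝ≥0∞)) ∂ρ =
      B.indicator 1 a * jumpMoment ρ (k + Pi.single j 1) fun i => H i a := by
    rw [jumpMoment_add_single, ← lintegral_const_mul _ (by fun_prop)]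
    refine lintegral_congr fun w => ?_
    ring
  have h3 : B.indicator 1 a * jumpMoment ρ (k + Pi.single j 1) (fun i => H i a) ≠ ∞ := by
    refine ENNReal.mul_ne_top ?_ (jumpMoment_ne_top hρ hk' ha)
    by_cases h : a ∈ B <;> simp [h]
  rw [← h2] at h3
  have h4 := hasSlope_lintegral (m := ρ) (F := fun w =>
    (∏ i, (w i : ℝ≥0∞) ^ k i) * expNeg (∑ i, H i a * w i))
    (Z := fun w => B.indicator 1 a * (w j : ℝ≥0∞)) (by fun_prop) (by fun_prop) h1 h3
  rw [h2] at h4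
  have h5 : (fun n => jumpMoment ρ k fun i => bump H j B n i a) = fun n : ℕ =>
      ∫⁻ w, ((∏ i, (w i : ℝ≥0∞) ^ k i) * expNeg (∑ i, H i a * w i)) *
        expNeg ((2 ^ n)⁻¹ * (B.indicator 1 a * (w j : ℝ≥0∞))) ∂ρ := ?_
  · rw [h5]
    exact h4
  funext n
  refine lintegral_congr fun w => ?_
  rw [mul_assoc, ← expNeg_add]
  congr 2
  simp only [bump, add_mul, Finset.sum_add_distrib, mul_assoc, ← Finset.mul_sum,
    sum_coordIndicator_mul]

variable {Ω : Type*} [MeasurableSpace Ω] {P : Measure Ω} {μ : Fin d → Ω → Measure 𝕏}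

/-- The derivative of the exponent in the direction of the indicator of `B`, by monotone convergence
on `𝕏` times the space of jumps. -/
lemma tendsto_two_pow_mul_exponent_increment [SFinite ρ] [SFinite α] {H : Fin d → 𝕏 → ℝ≥0∞}
    (hH : ∀ j, Measurable (H j)) (j : Fin d) {B : Set 𝕏} (hB : MeasurableSet B) :
    Tendsto (fun n => 2 ^ n * ∫⁻ y, ∫⁻ w, expNeg (∑ i, H i y * w i) *
      (1 - expNeg (∑ i, (2 ^ n)⁻¹ * coordIndicator j B i y * w i)) ∂ρ ∂α) atTop
      (𝓝 (∫⁻ y, B.indicator 1 y * jumpMoment ρ (Pi.single j 1) (fun i => H i y) ∂α)) := by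
  have hBm : Measurable fun z : 𝕏 × (Fin d → ℝ≥0) => B.indicator (1 : 𝕏 → ℝ≥0∞) z.1 :=
    (measurable_one.indicator hB).comp measurable_fst
  have hHm : ∀ i, Measurable fun z : 𝕏 × (Fin d → ℝ≥0) => H i z.1 := fun i =>
    (hH i).comp measurable_fst
  have hFm : Measurable fun z : 𝕏 × (Fin d → ℝ≥0) => expNeg (∑ i, H i z.1 * z.2 i) := by fun_prop
  have hZm : Measurable fun z : 𝕏 × (Fin d → ℝ≥0) =>
      B.indicator (1 : 𝕏 → ℝ≥0∞) z.1 * (z.2 j : ℝ≥0∞) := by fun_prop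
  have h := tendsto_lintegral_two_pow_mul (m := α.prod ρ) hFm hZm
  have h1 : ∫⁻ z, expNeg (∑ i, H i z.1 * z.2 i) * (B.indicator (1 : 𝕏 → ℝ≥0∞) z.1 * (z.2 j : ℝ≥0∞))
      ∂(α.prod ρ) =
      ∫⁻ y, B.indicator 1 y * jumpMoment ρ (Pi.single j 1) (fun i => H i y) ∂α := by
    rw [lintegral_prod _ (by fun_prop)]
    refine lintegral_congr fun y => ?_
    have := jumpMoment_add_single (ρ := ρ) 0 j fun i => H i y
    rw [zero_add] at this
    rw [this, ← lintegral_const_mul _ (by fun_prop)]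
    refine lintegral_congr fun w => ?_
    simp only [Pi.zero_apply, pow_zero, Finset.prod_const_one]
    ring
  rw [h1] at h
  refine h.congr fun n => ?_
  rw [lintegral_prod _ (by fun_prop), ← lintegral_const_mul']
  · refine lintegral_congr fun y => ?_
    rw [← lintegral_const_mul' _ _ (two_pow_ne_top n)]
    refine lintegral_congr fun w => ?_
    simp only [mul_assoc, ← Finset.mul_sum, sum_coordIndicator_mul]
    ring
  · exact two_pow_ne_top n

/-- Monotonicity of the quotients is read off the expectation that this exponential represents,
while their limit is computed from the exponent. The lower bound `c` makes the derivative of the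
exponent finite. -/
lemma hasSlope_expNeg_exponent [SFinite ρ] [IsFiniteMeasure α] [IsProbabilityMeasure P]
    (hρ : ∀ j, ∫⁻ w, min 1 (w j : ℝ≥0∞) ∂ρ ≠ ∞) (hμ : ∀ j, Measurable (μ j))
    (hL : ∀ H : Fin d → 𝕏 → ℝ≥0∞, (∀ j, Measurable (H j)) →
      ∫⁻ ω, expNeg (pairing H fun j => μ j ω) ∂P = expNeg (exponent ρ α H))
    {H : Fin d → 𝕏 → ℝ≥0∞} (hH : ∀ j, Measurable (H j)) {c : ℝ≥0∞} (hc : c ≠ 0)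
    (hcH : ∀ j y, c ≤ H j y) (j : Fin d) {B : Set 𝕏} (hB : MeasurableSet B) :
    HasSlope (expNeg (exponent ρ α H)) (fun n => expNeg (exponent ρ α (bump H j B n)))
      (expNeg (exponent ρ α H) *
        ∫⁻ y, B.indicator 1 y * jumpMoment ρ (Pi.single j 1) (fun i => H i y) ∂α) := by
  have hμ' : Measurable fun ω j => μ j ω := measurable_pi_lambda _ hμ
  have hF : Measurable fun ω => expNeg (pairing H fun j => μ j ω) :=
    (measurable_expNeg.comp (measurable_pairing hH)).comp hμ'
  have hZ : Measurable fun ω => μ j ω B := (Measure.measurable_coe hB).comp (hμ j)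
  have hn : ∀ n, expNeg (exponent ρ α (bump H j B n)) =
      ∫⁻ ω, expNeg (pairing H fun j => μ j ω) * expNeg ((2 ^ n)⁻¹ * μ j ω B) ∂P := fun n => by
    rw [← hL _ (measurable_bump hH j hB n)]
    refine lintegral_congr fun ω => ?_
    rw [pairing_bump hH j hB, expNeg_add]
  have hfin : ∫⁻ y, B.indicator 1 y * jumpMoment ρ (Pi.single j 1) (fun i => H i y) ∂α ≠ ∞ := by
    have hk : (Pi.single j 1 : Fin d → ℕ) ≠ 0 := by simp
    have h1 := jumpMoment_ne_top hρ hk (θ := fun _ => c) fun _ => hc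
    refine ne_top_of_le_ne_top (ENNReal.mul_ne_top h1 (measure_ne_top α univ)) ?_
    rw [← lintegral_const]
    refine lintegral_mono fun y => ?_
    exact mul_le_of_le_one_of_le (indicator_le_self' (fun _ _ => zero_le) _)
      (jumpMoment_antitone _ fun i => hcH i y)
  have hne : ∫⁻ ω, expNeg (pairing H fun j => μ j ω) ∂P ≠ ∞ := by
    rw [hL H hH]
    exact expNeg_ne_top _
  refine ⟨expNeg_ne_top _, ENNReal.mul_ne_top (expNeg_ne_top _) hfin, fun n => ?_, ?_, ?_, ?_⟩
  · rw [hn, ← hL H hH]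
    exact lintegral_mono fun _ => mul_le_of_le_one_right' (expNeg_le_one _)
  · simp_rw [hn]
    exact monotone_lintegral_mul_expNeg
  · simp_rw [hn, ← hL H hH]
    exact monotone_slope_lintegral hF hZ hne
  · have h1 := ENNReal.Tendsto.const_mul (tendsto_two_pow_mul_one_sub hfin
      (tendsto_two_pow_mul_exponent_increment hH j hB))
      (Or.inr (expNeg_ne_top (exponent ρ α H)))
    refine h1.congr fun n => ?_
    have h2 : exponent ρ α (bump H j B n) = _ :=
      exponent_add hH fun i y => (2 ^ n)⁻¹ * coordIndicator j B i y
    rw [h2, expNeg_add]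
    conv_rhs => rw [← mul_one (expNeg (exponent ρ α H)), mul_assoc, one_mul,
      ← ENNReal.mul_sub fun _ _ => expNeg_ne_top _]
    ring

open Classical in
/-- The slope of the density of the observed points, in terms of the densities with one more
point. -/
lemma hasSlope_labelLaplace [SFinite ρ] [IsFiniteMeasure α] [NullSingletonClass α]
    [IsProbabilityMeasure P]
    (hρ : ∀ j, ∫⁻ w, min 1 (w j : ℝ≥0∞) ∂ρ ≠ ∞) (hμ : ∀ j, Measurable (μ j))
    (hL : ∀ H : Fin d → 𝕏 → ℝ≥0∞, (∀ j, Measurable (H j)) →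
      ∫⁻ ω, expNeg (pairing H fun j => μ j ω) ∂P = expNeg (exponent ρ α H))
    {H : Fin d → 𝕏 → ℝ≥0∞} (hH : ∀ j, Measurable (H j)) {c : ℝ≥0∞} (hc : c ≠ 0)
    (hcH : ∀ j y, c ≤ H j y) {q : ℕ} (g : Fin (q + 1) → Fin d) {B : Set 𝕏} (hB : MeasurableSet B)
    (x : Fin q → 𝕏) :
    HasSlope (labelLaplace ρ α (fun p => g p.succ) x H)
      (fun n => labelLaplace ρ α (fun p => g p.succ) x (bump H (g 0) B n))
      (∫⁻ y, B.indicator 1 y * labelLaplace ρ α g (Fin.cons y x) H ∂α +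
        ∑ a ∈ Finset.univ.image x, B.indicator 1 a * labelLaplace ρ α g (Fin.cons a x) H) := by
  have hH0 : ∀ a j, H j a ≠ 0 := fun a j h => hc (le_antisymm (h ▸ hcH j a) zero_le)
  -- The product rule gives two kinds of terms: the exponential yields a new point, each moment
  -- factor a repetition of its value.
  have h1 := (hasSlope_expNeg_exponent hρ hμ hL hH hc hcH (g 0) hB).mul
    (HasSlope.prod (Finset.univ.image x) fun a ha =>
      hasSlope_jumpMoment hρ (occurrences_ne_zero (g := fun p => g p.succ) ha) H (hH0 a) (g 0) B)
  refine Eq.subst (motive := HasSlope _ _) ?_ h1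
  refine Eq.symm ?_
  congr 1
  · have h2 : ∀ᵐ y ∂α, y ∉ Finset.univ.image x := by
      have := (Finset.univ.image x).measure_zero α
      exact measure_eq_zero_iff_ae_notMem.1 this
    have hm : Measurable fun y => B.indicator 1 y *
        jumpMoment ρ (Pi.single (g 0) 1) (fun i => H i y) :=
      (measurable_one.indicator hB).mul (measurable_jumpMoment _ (measurable_pi_lambda _ hH))
    have h3 : ∫⁻ y, B.indicator 1 y * labelLaplace ρ α g (Fin.cons y x) H ∂α =
        ∫⁻ y, B.indicator 1 y * jumpMoment ρ (Pi.single (g 0) 1) (fun i => H i y) *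
          labelLaplace ρ α (fun p => g p.succ) x H ∂α := by
      refine lintegral_congr_ae ?_
      filter_upwards [h2] with y hy
      rw [labelLaplace_cons_of_notMem g hy, mul_assoc]
    rw [h3, lintegral_mul_const _ hm, labelLaplace]
    ring
  · rw [Finset.mul_sum]
    refine Finset.sum_congr rfl fun a ha => ?_
    rw [labelLaplace_cons_of_mem g ha]
    ring

/-- The moments of a random vector of measures with the Laplace functional of a compound vector. -/
theorem exists_moment_measure [MeasurableEq 𝕏] [SFinite ρ] [IsFiniteMeasure α]
    [NullSingletonClass α] [IsProbabilityMeasure P]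
    (hρ : ∀ j, ∫⁻ w, min 1 (w j : ℝ≥0∞) ∂ρ ≠ ∞) (hμ : ∀ j, Measurable (μ j))
    (hL : ∀ H : Fin d → 𝕏 → ℝ≥0∞, (∀ j, Measurable (H j)) →
      ∫⁻ ω, expNeg (pairing H fun j => μ j ω) ∂P = expNeg (exponent ρ α H))
    {q : ℕ} (g : Fin q → Fin d) :
    ∃ D : Measure (Fin q → 𝕏), IsFiniteMeasure D ∧
      ∀ H : Fin d → 𝕏 → ℝ≥0∞, (∀ j, Measurable (H j)) → ∀ c : ℝ≥0∞, c ≠ 0 → (∀ j y, c ≤ H j y) →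
        ∀ B : Fin q → Set 𝕏, (∀ p, MeasurableSet (B p)) →
          ∫⁻ ω, expNeg (pairing H fun j => μ j ω) * ∏ p, μ (g p) ω (B p) ∂P =
            ∫⁻ x, (∏ p, (B p).indicator 1 (x p)) * labelLaplace ρ α g x H ∂D := by
  classical
  induction q with
  | zero =>
    refine ⟨Measure.dirac Fin.elim0, inferInstance, fun H hH c _ _ B _ => ?_⟩
    have hx : ∀ x : Fin 0 → 𝕏, x = Fin.elim0 := fun x => Subsingleton.elim _ _
    have h : ∀ x : Fin 0 → 𝕏, (∏ p, (B p).indicator 1 (x p)) * labelLaplace ρ α g x H =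
        expNeg (exponent ρ α H) := fun x => by
      simp [labelLaplace]
    simp_rw [h, Finset.univ_eq_empty, Finset.prod_empty, mul_one, hL H hH]
    simp
  | succ q ih =>
    obtain ⟨D, hD, h⟩ := ih fun p => g p.succ
    have hcons : Measurable fun z : (Fin q → 𝕏) × 𝕏 =>
        (Fin.cons z.2 z.1 : Fin (q + 1) → 𝕏) := by
      refine measurable_pi_lambda _ fun p => ?_
      refine Fin.cases ?_ (fun p => ?_) p
      · simpa using measurable_snd
      · simp only [Fin.cons_succ]
        exact (measurable_pi_apply p).comp measurable_fst
    have hrep : ∀ p, Measurable fun x : Fin q → 𝕏 => (Fin.cons (x p) x : Fin (q + 1) → 𝕏) :=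
      fun p => hcons.comp (measurable_id.prodMk (measurable_pi_apply p))
    -- The added point is either governed by `α` or equal to one of the earlier distinct values,
    -- each taken once through its first index.
    refine ⟨(D.prod α).map (fun z => Fin.cons z.2 z.1) +
      ∑ p, (D.restrict {x | IsFirst x p}).map (fun x => Fin.cons (x p) x), ?_, ?_⟩
    · infer_instance
    intro H hH c hc hcH B hB
    set Y : (Fin (q + 1) → 𝕏) → ℝ≥0∞ := fun x =>
      (∏ p, (B p).indicator 1 (x p)) * labelLaplace ρ α g x H with hY
    have hind : ∀ p, Measurable fun x : Fin (q + 1) → 𝕏 => (B p).indicator (1 : 𝕏 → ℝ≥0∞) (x p) :=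
      fun p => (measurable_one.indicator (hB p)).comp (measurable_pi_apply p)
    have hYm : Measurable Y := (Finset.measurable_fun_prod _ fun p _ => hind p).mul
      (measurable_labelLaplace g measurable_id fun j => (hH j).comp measurable_snd)
    let β : (Fin q → 𝕏) → ℝ≥0∞ := fun x => ∏ p : Fin q, (B p.succ).indicator 1 (x p)
    have hβ : Measurable β := Finset.measurable_fun_prod _ fun p _ =>
      (measurable_one.indicator (hB p.succ)).comp (measurable_pi_apply p)
    have hYc : ∀ y (x : Fin q → 𝕏), Y (Fin.cons y x) =
        β x * ((B 0).indicator 1 y * labelLaplace ρ α g (Fin.cons y x) H) := fun y x => by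
      simp only [hY, β, Fin.prod_univ_succ, Fin.cons_zero, Fin.cons_succ]
      ring
    let S : (Fin q → 𝕏) → ℝ≥0∞ := fun x =>
      ∫⁻ y, (B 0).indicator 1 y * labelLaplace ρ α g (Fin.cons y x) H ∂α +
        ∑ a ∈ Finset.univ.image x, (B 0).indicator 1 a * labelLaplace ρ α g (Fin.cons a x) H
    have hlc : Measurable fun z : (Fin q → 𝕏) × 𝕏 =>
        (B 0).indicator 1 z.2 * labelLaplace ρ α g (Fin.cons z.2 z.1) H :=
      ((measurable_one.indicator (hB 0)).comp measurable_snd).mul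
        (measurable_labelLaplace g hcons fun j => (hH j).comp measurable_snd)
    have hrhs : ∫⁻ x, Y x ∂((D.prod α).map (fun z => Fin.cons z.2 z.1) +
        ∑ p, (D.restrict {x | IsFirst x p}).map (fun x => Fin.cons (x p) x)) =
        ∫⁻ x, β x * S x ∂D := by
      have hYcm : Measurable fun z : (Fin q → 𝕏) × 𝕏 => Y (Fin.cons z.2 z.1) := hYm.comp hcons
      rw [lintegral_add_measure, lintegral_finsetSum_measure, lintegral_map hYm hcons,
        lintegral_prod _ hYcm.aemeasurable]
      simp_rw [lintegral_map hYm (hrep _), hYc]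
      have e1 : ∀ p, ∫⁻ x in {x | IsFirst x p}, β x * ((B 0).indicator 1 (x p) *
          labelLaplace ρ α g (Fin.cons (x p) x) H) ∂D = ∫⁻ x, β x * (if IsFirst x p then
            (B 0).indicator 1 (x p) * labelLaplace ρ α g (Fin.cons (x p) x) H else 0) ∂D := by
        intro p
        rw [← lintegral_indicator (measurableSet_isFirst p)]
        refine lintegral_congr fun x => ?_
        by_cases hx : IsFirst x p
        · rw [if_pos hx, indicator_of_mem (by exact hx)]
        · rw [if_neg hx, indicator_of_notMem (by exact hx), mul_zero]
      have em : ∀ p, Measurable fun x : Fin q → 𝕏 => β x * (if IsFirst x p then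
            (B 0).indicator 1 (x p) * labelLaplace ρ α g (Fin.cons (x p) x) H else 0) := fun p =>
        hβ.mul (Measurable.ite (measurableSet_isFirst p)
          (hlc.comp (measurable_id.prodMk (measurable_pi_apply p))) measurable_const)
      simp_rw [e1]
      rw [← lintegral_finsetSum _ fun p _ => em p, ← lintegral_add_right _
        (Finset.measurable_fun_sum _ fun p _ => em p)]
      refine lintegral_congr fun x => ?_
      have hx : Measurable fun y => (B 0).indicator 1 y * labelLaplace ρ α g (Fin.cons y x) H :=
        hlc.comp measurable_prodMk_left
      rw [← Finset.mul_sum, ← sum_image_eq x fun a => (B 0).indicator 1 a *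
        labelLaplace ρ α g (Fin.cons a x) H, lintegral_const_mul _ hx, ← mul_add]
    rw [hrhs]
    let F : Ω → ℝ≥0∞ := fun ω => expNeg (pairing H fun j => μ j ω) *
      ∏ p : Fin q, μ (g p.succ) ω (B p.succ)
    have hμ' : Measurable fun ω j => μ j ω := measurable_pi_lambda _ hμ
    have hF : Measurable F := ((measurable_expNeg.comp (measurable_pairing hH)).comp hμ').mul
      (Finset.measurable_fun_prod _ fun p _ => (Measure.measurable_coe (hB p.succ)).comp (hμ _))
    have hZ : Measurable fun ω => μ (g 0) ω (B 0) := (Measure.measurable_coe (hB 0)).comp (hμ _)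
    have hFfin : ∫⁻ ω, F ω ∂P ≠ ∞ := by
      obtain ⟨C, hC, hle⟩ := exists_expNeg_pairing_mul_prod_le (fun p => g p.succ)
        (fun p => B p.succ) hc
      refine ne_top_of_le_ne_top hC ?_
      calc _ ≤ ∫⁻ _, C ∂P := lintegral_mono fun ω => hle H hH hcH _
        _ = C := by simp
    have hF0 : ∫⁻ ω, F ω ∂P =
        ∫⁻ x, β x * labelLaplace ρ α (fun p => g p.succ) x H ∂D := h H hH c hc hcH (fun p => B p.succ) fun p => hB _
    -- The induction hypothesis applies to the bumped function with the same `D` and the same `c`.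
    -- Independence of `D` from `H` is what allows differentiation under the integral.
    have hFn : ∀ n, ∫⁻ ω, F ω * expNeg ((2 ^ n)⁻¹ * μ (g 0) ω (B 0)) ∂P =
        ∫⁻ x, β x * labelLaplace ρ α (fun p => g p.succ) x (bump H (g 0) (B 0) n) ∂D := fun n => by
      rw [← h _ (measurable_bump hH (g 0) (hB 0) n) c hc
        (fun j y => (hcH j y).trans le_self_add) (fun p => B p.succ) fun p => hB _]
      refine lintegral_congr fun ω => ?_
      rw [pairing_bump hH _ (hB 0), expNeg_add]
      simp only [F]
      ring
    have hsl := fun x => hasSlope_labelLaplace hρ hμ hL hH hc hcH g (hB 0) x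
    have hlm : ∀ H : Fin d → 𝕏 → ℝ≥0∞, (∀ j, Measurable (H j)) →
        Measurable fun x : Fin q → 𝕏 => labelLaplace ρ α (fun p => g p.succ) x H := fun H hH =>
      measurable_labelLaplace (fun p : Fin q => g p.succ) (x := fun x => x) measurable_id
        (H := fun _ => H) fun j => (hH j).comp measurable_snd
    -- The limit of the same difference quotients is computed twice: over `ω` it brings down the
    -- mass of `B 0`, and over `x` it yields the slopes of the densities.
    have hlim := tendsto_slope_lintegral hF hZ hFfin
    have hlim' : Tendsto (fun n : ℕ => 2 ^ n * (∫⁻ ω, F ω ∂P -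
        ∫⁻ ω, F ω * expNeg ((2 ^ n)⁻¹ * μ (g 0) ω (B 0)) ∂P)) atTop
        (𝓝 (∫⁻ x, β x * S x ∂D)) := by
      have e2 : ∀ n, 2 ^ n * (∫⁻ ω, F ω ∂P -
          ∫⁻ ω, F ω * expNeg ((2 ^ n)⁻¹ * μ (g 0) ω (B 0)) ∂P) =
          ∫⁻ x, β x * (2 ^ n * (labelLaplace ρ α (fun p => g p.succ) x H -
            labelLaplace ρ α (fun p => g p.succ) x (bump H (g 0) (B 0) n))) ∂D := fun n => by
        have hle : ∀ x, β x * labelLaplace ρ α (fun p => g p.succ) x (bump H (g 0) (B 0) n) ≤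
            β x * labelLaplace ρ α (fun p => g p.succ) x H := fun x =>
          mul_le_mul_right ((hsl x).le n) _
        have hm1 := hlm _ (measurable_bump hH (g 0) (hB 0) n)
        have hm2 := hlm _ hH
        have hm3 : Measurable fun x => β x *
            labelLaplace ρ α (fun p => g p.succ) x (bump H (g 0) (B 0) n) := hβ.mul hm1
        rw [hFn, hF0, ← lintegral_sub hm3 _ (ae_of_all _ hle),
          ← lintegral_const_mul _ (by fun_prop)]
        · refine lintegral_congr fun x => ?_
          rw [← ENNReal.mul_sub]
          · exact mul_left_comm _ _ _
          · intro _ _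
            refine ENNReal.prod_ne_top fun p _ => ?_
            exact ne_top_of_le_ne_top ENNReal.one_ne_top
              (indicator_le_self' (fun _ _ => zero_le) _)
        · rw [← hFn]
          exact ne_top_of_le_ne_top hFfin
            (lintegral_mono fun _ => mul_le_of_le_one_right' (expNeg_le_one _))
      simp_rw [e2]
      refine lintegral_tendsto_of_tendsto_of_monotone (fun n => ?_) (ae_of_all _ fun x a b hab =>
        mul_le_mul_right ((hsl x).slope_mono hab) _) (ae_of_all _ fun x => ?_)
      · have hm1 := hlm _ (measurable_bump hH (g 0) (hB 0) n)
        have hm2 := hlm _ hH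
        fun_prop
      · refine ENNReal.Tendsto.const_mul (hsl x).tendsto_slope (Or.inr ?_)
        refine ENNReal.prod_ne_top fun p _ => ?_
        exact ne_top_of_le_ne_top ENNReal.one_ne_top (indicator_le_self' (fun _ _ => zero_le) _)
    rw [← tendsto_nhds_unique hlim hlim']
    refine lintegral_congr fun ω => ?_
    rw [Fin.prod_univ_succ]
    simp only [F]
    ring

end Moments

end

end CoRM

/-! ### Total masses are almost surely positive and finite -/

namespace CoRM

open Filter Topology

noncomputable section

section TotalMass

variable {𝕏 : Type*} [MeasurableSpace 𝕏] {d : ℕ} {ρ : Measure (Fin d → ℝ≥0)} {α : Measure 𝕏}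
  {Ω : Type*} [MeasurableSpace Ω] {P : Measure Ω} {μ : Fin d → Ω → Measure 𝕏}

lemma exponent_const_single (j : Fin d) (c : ℝ≥0∞) :
    exponent ρ α (fun i _ => if i = j then c else 0) =
      (∫⁻ w, (1 - expNeg (c * w j)) ∂ρ) * α univ := by
  rw [exponent_const]
  simp

lemma lintegral_expNeg_total
    (hL : ∀ H : Fin d → 𝕏 → ℝ≥0∞, (∀ j, Measurable (H j)) →
      ∫⁻ ω, expNeg (pairing H fun j => μ j ω) ∂P = expNeg (exponent ρ α H)) (j : Fin d) (c : ℝ≥0∞) :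
    ∫⁻ ω, expNeg (c * μ j ω univ) ∂P = expNeg ((∫⁻ w, (1 - expNeg (c * w j)) ∂ρ) * α univ) := by
  rw [← exponent_const_single, ← hL _ fun i => measurable_const]
  refine lintegral_congr fun ω => ?_
  congr 1
  simp only [pairing, lintegral_const]
  simp

/-- At `c = ∞` the function `e^{-c T}` is the indicator of `T = 0`. Its expectation is `exp(-ρ(univ)
α(univ)) = 0` because `ρ` is infinite with positive coordinates. -/
lemma ae_total_ne_zero [IsProbabilityMeasure P] (hμ : ∀ j, Measurable (μ j))
    (hL : ∀ H : Fin d → 𝕏 → ℝ≥0∞, (∀ j, Measurable (H j)) →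
      ∫⁻ ω, expNeg (pairing H fun j => μ j ω) ∂P = expNeg (exponent ρ α H))
    (hα : α ≠ 0) (hρ0 : ∀ᵐ w ∂ρ, ∀ j, 0 < w j) (hρ : ρ univ = ∞) (j : Fin d) :
    ∀ᵐ ω ∂P, μ j ω univ ≠ 0 := by
  have hT : Measurable fun ω => μ j ω univ := (Measure.measurable_coe MeasurableSet.univ).comp (hμ j)
  have h1 := lintegral_expNeg_total hL j ∞
  have h2 : ∫⁻ w, (1 - expNeg (∞ * w j)) ∂ρ = ∞ := by
    have : ∫⁻ w, (1 - expNeg (∞ * w j)) ∂ρ = ∫⁻ _, 1 ∂ρ := by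
      refine lintegral_congr_ae ?_
      filter_upwards [hρ0] with w hw
      have : (w j : ℝ≥0∞) ≠ 0 := by simpa using (hw j).ne'
      rw [ENNReal.top_mul this, expNeg_top, tsub_zero]
    rw [this, lintegral_one, hρ]
  rw [h2, ENNReal.top_mul (by simpa using hα), expNeg_top,
    lintegral_eq_zero_iff (by fun_prop)] at h1
  filter_upwards [h1] with ω hω h0
  simp [h0, expNeg_zero] at hω

/-- For `c = 2⁻ⁿ` the transform of the total mass is at most the probability that it is finite, and
it tends to 1 because the exponent tends to 0 by dominated convergence. -/
lemma ae_total_ne_top [IsProbabilityMeasure P] [IsFiniteMeasure α] (hμ : ∀ j, Measurable (μ j))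
    (hL : ∀ H : Fin d → 𝕏 → ℝ≥0∞, (∀ j, Measurable (H j)) →
      ∫⁻ ω, expNeg (pairing H fun j => μ j ω) ∂P = expNeg (exponent ρ α H))
    (hρ : ∀ j, ∫⁻ w, min 1 (w j : ℝ≥0∞) ∂ρ ≠ ∞) (j : Fin d) :
    ∀ᵐ ω ∂P, μ j ω univ ≠ ∞ := by
  have hT : Measurable fun ω => μ j ω univ := (Measure.measurable_coe MeasurableSet.univ).comp (hμ j)
  have hS : MeasurableSet {ω | μ j ω univ = ∞} := hT (measurableSet_singleton ∞)
  have h1 : Tendsto (fun n : ℕ => ∫⁻ w, (1 - expNeg (((2 : ℝ≥0∞) ^ n)⁻¹ * w j)) ∂ρ) atTop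
      (𝓝 (∫⁻ _, 0 ∂ρ)) := by
    refine tendsto_lintegral_of_dominated_convergence (fun w => min 1 (w j : ℝ≥0∞))
      (fun n => by fun_prop) (fun n => ae_of_all _ fun w => ?_) (hρ j) (ae_of_all _ fun w => ?_)
    · refine (one_sub_expNeg_le _).trans (min_le_min_left _ (mul_le_of_le_one_left' ?_))
      exact ENNReal.inv_le_one.2 (one_le_pow₀ one_le_two)
    · have h2 := (continuous_expNeg.tendsto 0).comp
        (tendsto_inv_two_pow_mul (z := (w j : ℝ≥0∞)) ENNReal.coe_ne_top)
      rw [expNeg_zero] at h2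
      have h3 := ENNReal.Tendsto.sub (tendsto_const_nhds (x := (1 : ℝ≥0∞))) h2
        (Or.inl ENNReal.one_ne_top)
      simpa using h3
  have h2 : Tendsto (fun n : ℕ => ∫⁻ ω, expNeg (((2 : ℝ≥0∞) ^ n)⁻¹ * μ j ω univ) ∂P) atTop
      (𝓝 1) := by
    simp_rw [lintegral_expNeg_total hL]
    have h3 := (continuous_expNeg.tendsto _).comp
      (ENNReal.Tendsto.mul_const (b := α univ) h1 (Or.inr (measure_ne_top _ _)))
    simp only [lintegral_zero, zero_mul, expNeg_zero] at h3
    exact h3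
  have h3 : ∀ n : ℕ, ∫⁻ ω, expNeg (((2 : ℝ≥0∞) ^ n)⁻¹ * μ j ω univ) ∂P ≤
      P {ω | μ j ω univ = ∞}ᶜ := fun n => by
    rw [← lintegral_indicator_one hS.compl]
    refine lintegral_mono fun ω => ?_
    by_cases h : μ j ω univ = ∞
    · have h4 : ((2 : ℝ≥0∞) ^ n)⁻¹ * ∞ = ∞ :=
        ENNReal.mul_top (ENNReal.inv_ne_zero.2 (two_pow_ne_top n))
      simp only [h, h4, expNeg_top]
      exact zero_le
    · rw [indicator_of_mem (by exact h)]
      exact expNeg_le_one _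
  have h4 : P {ω | μ j ω univ = ∞}ᶜ = 1 := le_antisymm prob_le_one (le_of_tendsto' h2 h3)
  rw [prob_compl_eq_one_iff hS] at h4
  exact measure_eq_zero_iff_ae_notMem.1 h4

end TotalMass

/-! ### The latent gamma variables -/

section Gamma

/-- The factor of the density of a gamma variable with rate `t` that does not depend on `t`. -/
def gammaWeight (n : ℕ) (u : ℝ) : ℝ≥0∞ :=
  if 0 < u then ENNReal.ofReal (u ^ (n - 1) / Real.Gamma n) else 0

@[fun_prop]
lemma measurable_gammaWeight (n : ℕ) : Measurable (gammaWeight n) :=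
  Measurable.ite measurableSet_Ioi (by fun_prop) measurable_const

/-- The substitution `γ = t u` isolates `t^n e^{-u t}`: with `t` the total mass, `t^n` will cancel
the normalization of `n` observations and the exponential is a tilting. -/
lemma map_div_gammaMeasure {n : ℕ} (hn : 1 ≤ n) {t : ℝ} (ht : 0 < t) :
    (gammaMeasure n 1).map (fun γ => γ / t) = volume.withDensity fun u =>
      gammaWeight n u * (ENNReal.ofReal t ^ n * expNeg (ENNReal.ofReal u * ENNReal.ofReal t)) := by
  have hm : Measurable fun u => gammaWeight n u *
      (ENNReal.ofReal t ^ n * expNeg (ENNReal.ofReal u * ENNReal.ofReal t)) := by fun_prop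
  have hpdf : Measurable (gammaPDF n 1) := (measurable_gammaPDFReal _ _).ennreal_ofReal
  refine Measure.ext_of_lintegral _ fun G hG => ?_
  have hGt : Measurable fun γ => G (γ / t) := hG.comp (by fun_prop)
  rw [lintegral_map hG (by fun_prop), gammaMeasure, lintegral_withDensity_eq_lintegral_mul _ hpdf
    hGt, lintegral_withDensity_eq_lintegral_mul _ hm hG]
  have hcv := Real.smul_map_volume_mul_left ht.ne'
  conv_lhs => rw [← hcv]
  have hpG : Measurable fun u => (gammaPDF n 1 * fun γ => G (γ / t)) (t * u) :=
    (hpdf.mul hGt).comp (by fun_prop)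
  rw [lintegral_smul_measure, lintegral_map (hpdf.mul hGt) (by fun_prop),
    smul_eq_mul, ← lintegral_const_mul _ hpG]
  refine lintegral_congr_ae ?_
  -- At `u = 0` the gamma density and `gammaWeight` follow different conventions; this null set is
  -- discarded.
  have h0 : ∀ᵐ u : ℝ, u ≠ 0 := by
    simp [ae_iff]
  filter_upwards [h0] with u hu
  simp only [Pi.mul_apply, mul_div_cancel_left₀ _ ht.ne', ← mul_assoc]
  congr 1
  rcases lt_or_gt_of_ne hu with h | h
  · have h1 : ¬ (0 ≤ t * u) := not_le.2 (mul_neg_of_pos_of_neg ht h)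
    simp [gammaWeight, h.not_gt, gammaPDF, gammaPDFReal, h1]
  · have h1 : 0 ≤ t * u := (mul_pos ht h).le
    have h2 : (n : ℝ) - 1 = ((n - 1 : ℕ) : ℝ) := by
      rw [Nat.cast_sub hn, Nat.cast_one]
    have hG0 : 0 ≤ Real.Gamma n := (Real.Gamma_pos_of_pos (by exact_mod_cast hn)).le
    rw [gammaWeight, if_pos h, gammaPDF, gammaPDFReal, if_pos h1, h2, Real.one_rpow,
      Real.rpow_natCast, abs_of_pos ht, ← ENNReal.ofReal_mul h.le, expNeg_ofReal (mul_pos h ht).le,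
      ← ENNReal.ofReal_pow ht.le, ← ENNReal.ofReal_mul ht.le,
      ← ENNReal.ofReal_mul (by positivity), ← ENNReal.ofReal_mul (by positivity)]
    congr 1
    obtain ⟨m, rfl⟩ := Nat.exists_eq_add_of_le hn
    rw [Nat.add_sub_cancel_left, one_mul, mul_comm u t, mul_pow, pow_add t 1 m]
    ring

lemma lintegral_gamma_div {d : ℕ} {n : Fin d → ℕ} (hn : ∀ j, 1 ≤ n j) {t : Fin d → ℝ}
    (ht : ∀ j, 0 < t j) {G : (Fin d → ℝ) → ℝ≥0∞} (hG : Measurable G) :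
    ∫⁻ γ, G (fun j => γ j / t j) ∂(Measure.pi fun j => gammaMeasure (n j) 1) =
      ∫⁻ u, (∏ j, (gammaWeight (n j) (u j) * (ENNReal.ofReal (t j) ^ n j *
        expNeg (ENNReal.ofReal (u j) * ENNReal.ofReal (t j))))) * G u := by
  have hg : ∀ j, IsProbabilityMeasure (gammaMeasure (n j) 1) := fun j =>
    isProbabilityMeasure_gammaMeasure (by exact_mod_cast hn j) one_pos
  have hdm : ∀ j, Measurable fun γ : ℝ => γ / t j := fun j => by fun_prop
  have hp : ∀ j, IsProbabilityMeasure ((gammaMeasure (n j) 1).map fun γ => γ / t j) := fun j =>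
    Measure.isProbabilityMeasure_map (hdm j).aemeasurable
  have hw : ∀ j, Measurable fun u : ℝ => gammaWeight (n j) u * (ENNReal.ofReal (t j) ^ n j *
        expNeg (ENNReal.ofReal u * ENNReal.ofReal (t j))) := fun j => by fun_prop
  have hp' : ∀ j, IsProbabilityMeasure ((volume : Measure ℝ).withDensity fun u =>
      gammaWeight (n j) u * (ENNReal.ofReal (t j) ^ n j *
        expNeg (ENNReal.ofReal u * ENNReal.ofReal (t j)))) := fun j =>
    map_div_gammaMeasure (hn j) (ht j) ▸ hp j
  have h1 := Measure.pi_map_pi (μ := fun j => gammaMeasure (n j) 1) (f := fun j γ => γ / t j)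
    fun j => (hdm j).aemeasurable
  simp_rw [map_div_gammaMeasure (hn _) (ht _)] at h1
  rw [pi_withDensity _ hw] at h1
  have h2 : Measurable fun (γ : Fin d → ℝ) j => γ j / t j := by fun_prop
  refine (lintegral_map hG h2).symm.trans ?_
  have h3 : Measurable fun u : Fin d → ℝ => ∏ j, (gammaWeight (n j) (u j) *
      (ENNReal.ofReal (t j) ^ n j * expNeg (ENNReal.ofReal (u j) * ENNReal.ofReal (t j)))) :=
    Finset.measurable_fun_prod _ fun j _ => (hw j).comp (measurable_pi_apply j)
  rw [h1, lintegral_withDensity_eq_lintegral_mul _ h3 hG]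
  rfl

end Gamma

/-! ### From labelled points to arrays of samples -/

section Samples

variable {𝕏 : Type*} [MeasurableSpace 𝕏] {d : ℕ} {n : Fin d → ℕ}

/-- Finite measures on samples paired with a parameter agree if they agree on boxes. -/
lemma ext_samples_prod {A : Type*} [MeasurableSpace A]
    {μ ν : Measure (((j : Fin d) → Fin (n j) → 𝕏) × A)} [IsFiniteMeasure μ]
    (h : ∀ (B : (j : Fin d) → Fin (n j) → Set 𝕏) (C : Set A), (∀ j i, MeasurableSet (B j i)) →
      MeasurableSet C → μ ({x | ∀ j i, x j i ∈ B j i} ×ˢ C) = ν ({x | ∀ j i, x j i ∈ B j i} ×ˢ C)) :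
    μ = ν := by
  let 𝒞 : (j : Fin d) → Set (Set (Fin (n j) → 𝕏)) := fun j =>
    univ.pi '' univ.pi fun _ : Fin (n j) => {s : Set 𝕏 | MeasurableSet s}
  have hspan : ∀ j, IsCountablySpanning (𝒞 j) := fun j =>
    ⟨fun _ => univ, fun _ => ⟨fun _ => univ, fun _ _ => MeasurableSet.univ, by simp⟩,
      iUnion_const _⟩
  have hspan' : IsCountablySpanning (univ.pi '' univ.pi 𝒞) :=
    ⟨fun _ => univ, fun _ => ⟨fun _ => univ, fun j _ =>
      ⟨fun _ => univ, fun _ _ => MeasurableSet.univ, by simp⟩, by simp⟩, iUnion_const _⟩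
  have hbox : ∀ B : (j : Fin d) → Fin (n j) → Set 𝕏, {x : (j : Fin d) → Fin (n j) → 𝕏 |
      ∀ j i, x j i ∈ B j i} = univ.pi fun j => univ.pi (B j) := fun B => by
    ext x
    simp
  refine ext_of_generate_finite (image2 (· ×ˢ ·) (univ.pi '' univ.pi 𝒞) {s | MeasurableSet s}) ?_
    ((IsPiSystem.pi fun j => isPiSystem_pi).prod MeasurableSpace.isPiSystem_measurableSet) ?_ ?_
  · have h1 : MeasurableSpace.pi = MeasurableSpace.generateFrom (univ.pi '' univ.pi 𝒞) :=
      (generateFrom_eq_pi (fun j => generateFrom_pi) hspan).symm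
    have h2 := generateFrom_prod_eq hspan' (isCountablySpanning_measurableSet (α := A))
    rw [MeasurableSpace.generateFrom_measurableSet, ← h1] at h2
    exact h2
  · rintro _ ⟨_, ⟨b, hb, rfl⟩, C, hC, rfl⟩
    choose B hB hBb using fun j => hb j (mem_univ j)
    have hb' : b = fun j => univ.pi (B j) := funext fun j => (hBb j).symm
    simp only [hb', ← hbox B]
    exact h B C (fun j i => hB j i (mem_univ i)) hC
  · simpa using h (fun _ _ => univ) univ (fun _ _ => MeasurableSet.univ) MeasurableSet.univ

lemma measurableSet_sampleBox {B : (j : Fin d) → Fin (n j) → Set 𝕏}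
    (hB : ∀ j i, MeasurableSet (B j i)) :
    MeasurableSet {x : (j : Fin d) → Fin (n j) → 𝕏 | ∀ j i, x j i ∈ B j i} := by
  have : {x : (j : Fin d) → Fin (n j) → 𝕏 | ∀ j i, x j i ∈ B j i} =
      univ.pi fun j => univ.pi (B j) := by
    ext x
    simp
  rw [this]
  exact MeasurableSet.univ_pi fun j => MeasurableSet.univ_pi (hB j)

variable {ρ : Measure (Fin d → ℝ≥0)} {α : Measure 𝕏}

/-- The array of samples is flattened into one list, the label of an entry being its group;
occurrences then become frequencies. -/
lemma labelLaplace_eq_posteriorLaplace {q : ℕ} (e : ((j : Fin d) × Fin (n j)) ≃ Fin q)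
    (x : Fin q → 𝕏) (H : Fin d → 𝕏 → ℝ≥0∞) :
    labelLaplace ρ α (fun p => (e.symm p).1) x H =
      posteriorLaplace ρ α (fun j i => x (e ⟨j, i⟩)) H := by
  classical
  have h1 : distinctValues (fun j i => x (e ⟨j, i⟩)) = Finset.univ.image x := by
    ext a
    simp only [distinctValues, Finset.mem_image, Finset.mem_univ, true_and]
    exact ⟨fun ⟨p, hp⟩ => ⟨e p, hp⟩, fun ⟨p, hp⟩ => ⟨e.symm p, by simpa using hp⟩⟩
  have h2 : ∀ a, occurrences (fun p => (e.symm p).1) x a =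
      frequency (fun j i => x (e ⟨j, i⟩)) a := fun a => by
    funext j
    simp only [occurrences, frequency, Finset.card_filter]
    rw [← e.sum_comp, Fintype.sum_sigma]
    simp only [Equiv.symm_apply_apply]
    rw [Finset.sum_eq_single j]
    · simp
    · intro i _ hi
      simp [hi]
    · simp
  rw [labelLaplace, posteriorLaplace, h1]
  simp_rw [h2]

lemma measurable_posteriorLaplace [SFinite ρ] [SFinite α] [MeasurableEq 𝕏] {T : Type*}
    [MeasurableSpace T] {x : T → (j : Fin d) → Fin (n j) → 𝕏} (hx : Measurable x)
    {H : T → Fin d → 𝕏 → ℝ≥0∞} (hH : ∀ j, Measurable fun z : T × 𝕏 => H z.1 j z.2) :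
    Measurable fun t => posteriorLaplace ρ α (x t) (H t) := by
  let e := Fintype.equivFin ((j : Fin d) × Fin (n j))
  have h : ∀ t, posteriorLaplace ρ α (x t) (H t) = labelLaplace ρ α (fun p => (e.symm p).1)
      (fun p => x t (e.symm p).1 (e.symm p).2) (H t) := fun t => by
    rw [labelLaplace_eq_posteriorLaplace e]
    congr 1
    funext j i
    exact congrArg (fun s : (j : Fin d) × Fin (n j) => x t s.1 s.2)
      (e.symm_apply_apply ⟨j, i⟩).symm
  rw [funext h]
  have hx' : Measurable fun t p => x t (e.symm p).1 (e.symm p).2 := measurable_pi_lambda _ fun p =>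
    (measurable_pi_apply (e.symm p).2).comp ((measurable_pi_apply (e.symm p).1).comp hx)
  exact measurable_labelLaplace _ hx' hH

theorem exists_sample_moment_measure {Ω : Type*} [MeasurableSpace Ω] {P : Measure Ω}
    {μ : Fin d → Ω → Measure 𝕏} [MeasurableEq 𝕏] [SFinite ρ] [IsFiniteMeasure α]
    [NullSingletonClass α] [IsProbabilityMeasure P]
    (hρ : ∀ j, ∫⁻ w, min 1 (w j : ℝ≥0∞) ∂ρ ≠ ∞) (hμ : ∀ j, Measurable (μ j))
    (hL : ∀ H : Fin d → 𝕏 → ℝ≥0∞, (∀ j, Measurable (H j)) →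
      ∫⁻ ω, expNeg (pairing H fun j => μ j ω) ∂P = expNeg (exponent ρ α H)) (n : Fin d → ℕ) :
    ∃ D : Measure ((j : Fin d) → Fin (n j) → 𝕏), IsFiniteMeasure D ∧
      ∀ H : Fin d → 𝕏 → ℝ≥0∞, (∀ j, Measurable (H j)) → ∀ c : ℝ≥0∞, c ≠ 0 → (∀ j y, c ≤ H j y) →
        ∀ B : (j : Fin d) → Fin (n j) → Set 𝕏, (∀ j i, MeasurableSet (B j i)) →
          ∫⁻ ω, expNeg (pairing H fun j => μ j ω) * ∏ j, ∏ i, μ j ω (B j i) ∂P =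
            ∫⁻ x in {x | ∀ j i, x j i ∈ B j i}, posteriorLaplace ρ α x H ∂D := by
  classical
  let e := Fintype.equivFin ((j : Fin d) × Fin (n j))
  obtain ⟨D, hD, h⟩ := exists_moment_measure hρ hμ hL fun p => (e.symm p).1
  have hem : Measurable fun (x : Fin (Fintype.card ((j : Fin d) × Fin (n j))) → 𝕏) (j : Fin d)
      (i : Fin (n j)) => x (e ⟨j, i⟩) :=
    measurable_pi_lambda _ fun j => measurable_pi_lambda _ fun i => measurable_pi_apply _
  refine ⟨D.map fun x j i => x (e ⟨j, i⟩), inferInstance, fun H hH c hc hcH B hB => ?_⟩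
  have hBm := measurableSet_sampleBox hB
  have h1 := h H hH c hc hcH (fun p => B (e.symm p).1 (e.symm p).2) fun p => hB _ _
  have hm : Measurable fun x : (j : Fin d) → Fin (n j) → 𝕏 => posteriorLaplace ρ α x H :=
    measurable_posteriorLaplace (x := fun x => x) measurable_id (H := fun _ => H)
      fun j => (hH j).comp measurable_snd
  rw [setLIntegral_map hBm hm hem, ← lintegral_indicator (hem hBm)]
  have h2 : ∀ ω, ∏ p, μ (e.symm p).1 ω (B (e.symm p).1 (e.symm p).2) =
      ∏ j, ∏ i, μ j ω (B j i) := fun ω => by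
    rw [e.symm.prod_comp fun s : (j : Fin d) × Fin (n j) => μ s.1 ω (B s.1 s.2),
      Fintype.prod_sigma]
  simp_rw [h2] at h1
  rw [h1]
  refine lintegral_congr fun x => ?_
  rw [labelLaplace_eq_posteriorLaplace]
  by_cases hx : ∀ j i, x (e ⟨j, i⟩) ∈ B j i
  · rw [indicator_of_mem (by exact hx), Finset.prod_eq_one, one_mul]
    intro p _
    refine indicator_of_mem ?_ _
    simpa using hx (e.symm p).1 (e.symm p).2
  · rw [indicator_of_notMem (by exact hx)]
    push Not at hx
    obtain ⟨j, i, hji⟩ := hx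
    rw [Finset.prod_eq_zero (Finset.mem_univ (e ⟨j, i⟩)), zero_mul]
    refine indicator_of_notMem ?_ _
    rw [Equiv.symm_apply_apply]
    exact hji

end Samples

end

end CoRM

/-! ### Joint law of the samples and the latent variables -/

namespace CoRM

open Filter Topology

noncomputable section

section Latent

variable {Ω : Type*} [MeasurableSpace Ω] {P : Measure Ω} [IsProbabilityMeasure P]
  {𝕏 : Type*} [MeasurableSpace 𝕏] {d : ℕ} {n : Fin d → ℕ}
  {μ : Fin d → Ω → Measure 𝕏} {X : (j : Fin d) → Fin (n j) → Ω → 𝕏}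

lemma measurable_total (j : Fin d) : Measurable fun m : Fin d → Measure 𝕏 => m j univ :=
  (Measure.measurable_coe MeasurableSet.univ).comp (measurable_pi_apply j)

lemma measurable_prod_box {B : (j : Fin d) → Fin (n j) → Set 𝕏}
    (hB : ∀ j i, MeasurableSet (B j i)) :
    Measurable fun m : Fin d → Measure 𝕏 => ∏ j, ∏ i, m j (B j i) :=
  Finset.measurable_fun_prod _ fun j _ => Finset.measurable_fun_prod _ fun i _ =>
    (Measure.measurable_coe (hB j i)).comp (measurable_pi_apply j)

lemma measurable_prod_normalized {B : (j : Fin d) → Fin (n j) → Set 𝕏}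
    (hB : ∀ j i, MeasurableSet (B j i)) :
    Measurable fun m : Fin d → Measure 𝕏 => ∏ j, ∏ i, normalized (m j) (B j i) :=
  Finset.measurable_fun_prod _ fun j _ => Finset.measurable_fun_prod _ fun i _ =>
    (measurable_total j).inv.mul ((Measure.measurable_coe (hB j i)).comp (measurable_pi_apply j))

omit [IsProbabilityMeasure P] in
-- As `C` varies, the conditional law states that two measures on vectors of measures agree; both
-- are then integrated against `F`.
lemma IsSample.setLIntegral (hμ : ∀ j, Measurable (μ j)) (hX : IsSample P μ X)
    {F : (Fin d → Measure 𝕏) → ℝ≥0∞} (hF : Measurable F) {B : (j : Fin d) → Fin (n j) → Set 𝕏}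
    (hB : ∀ j i, MeasurableSet (B j i)) :
    ∫⁻ ω in {ω | ∀ j i, X j i ω ∈ B j i}, F (fun j => μ j ω) ∂P =
      ∫⁻ ω, (∏ j, ∏ i, normalized (μ j ω) (B j i)) * F (fun j => μ j ω) ∂P := by
  have hμ' : Measurable fun ω j => μ j ω := measurable_pi_lambda _ hμ
  have hw : Measurable fun ω => ∏ j, ∏ i, normalized (μ j ω) (B j i) :=
    (measurable_prod_normalized hB).comp hμ'
  have h : (P.restrict {ω | ∀ j i, X j i ω ∈ B j i}).map (fun ω j => μ j ω) =
      (P.withDensity fun ω => ∏ j, ∏ i, normalized (μ j ω) (B j i)).map fun ω j => μ j ω := by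
    ext C hC
    rw [Measure.map_apply hμ' hC, Measure.map_apply hμ' hC, Measure.restrict_apply (hμ' hC),
      withDensity_apply _ (hμ' hC)]
    exact hX.condLaw C hC B hB
  have h1 := congrArg (fun κ => ∫⁻ m, F m ∂κ) h
  simp only [lintegral_map hF hμ'] at h1
  exact h1.trans (lintegral_withDensity_eq_lintegral_mul _ hw (hF.comp hμ'))

variable {Γ : Fin d → Ω → ℝ} {U : Fin d → Ω → ℝ}

/-- The joint law of the vector of measures, the samples and the latent variables. -/
lemma IsSample.lintegral_latent (hμ : ∀ j, Measurable (μ j)) (hX : IsSample P μ X)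
    (hT0 : ∀ᵐ ω ∂P, ∀ j, μ j ω univ ≠ 0) (hT1 : ∀ᵐ ω ∂P, ∀ j, μ j ω univ ≠ ∞)
    (hn : ∀ j, 1 ≤ n j) (hΓ : ∀ j, Measurable (Γ j))
    (hΓ_law : ∀ j, P.map (Γ j) = gammaMeasure (n j) 1) (hΓ_indep : iIndepFun Γ P)
    (hΓ_indep' : IndepFun (fun ω j => Γ j ω) (fun ω => (fun j => μ j ω, fun j i => X j i ω)) P)
    (hU : ∀ j ω, U j ω = Γ j ω / (μ j ω univ).toReal)
    {F : (Fin d → Measure 𝕏) → ℝ≥0∞} (hF : Measurable F) {G : (Fin d → ℝ) → ℝ≥0∞}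
    (hG : Measurable G) {B : (j : Fin d) → Fin (n j) → Set 𝕏} (hB : ∀ j i, MeasurableSet (B j i)) :
    ∫⁻ ω in {ω | ∀ j i, X j i ω ∈ B j i}, F (fun j => μ j ω) * G (fun j => U j ω) ∂P =
      ∫⁻ ω, ∫⁻ u, (∏ j, gammaWeight (n j) (u j)) * G u * (F (fun j => μ j ω) *
        expNeg (∑ j, ENNReal.ofReal (u j) * μ j ω univ) * ∏ j, ∏ i, μ j ω (B j i)) ∂volume ∂P := by
  have hμ' : Measurable fun ω j => μ j ω := measurable_pi_lambda _ hμ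
  have hX' : Measurable fun ω j i => X j i ω :=
    measurable_pi_lambda _ fun j => measurable_pi_lambda _ fun i => hX.measurable j i
  have hΓ' : Measurable fun ω j => Γ j ω := measurable_pi_lambda _ hΓ
  have hBm := measurableSet_sampleBox hB
  have hlawΓ : P.map (fun ω j => Γ j ω) = Measure.pi fun j => gammaMeasure (n j) 1 := by
    rw [(iIndepFun_iff_map_fun_eq_pi_map fun j => (hΓ j).aemeasurable).1 hΓ_indep]
    simp_rw [hΓ_law]
  have hlaw := (indepFun_iff_map_prod_eq_prod_map_map hΓ'.aemeasurable
    (hμ'.prodMk hX').aemeasurable).1 hΓ_indep'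
  have hprob : IsProbabilityMeasure (P.map fun ω => (fun j => μ j ω, fun j i => X j i ω)) :=
    Measure.isProbabilityMeasure_map (hμ'.prodMk hX').aemeasurable
  have hg : ∀ j, IsProbabilityMeasure (gammaMeasure (n j) 1) := fun j =>
    isProbabilityMeasure_gammaMeasure (by exact_mod_cast hn j) one_pos
  have hquot : Measurable fun q : (Fin d → ℝ) × (Fin d → Measure 𝕏) =>
      G fun j => q.1 j / (q.2 j univ).toReal := by
    refine hG.comp (measurable_pi_lambda _ fun j => ?_)
    exact ((measurable_pi_apply j).comp measurable_fst).div
      ((measurable_total j).comp measurable_snd).ennreal_toReal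
  -- The gamma variables are independent of the measures and samples jointly, so they can be
  -- integrated out first.
  let K : (Fin d → Measure 𝕏) → ℝ≥0∞ := fun m =>
    ∫⁻ γ, G (fun j => γ j / (m j univ).toReal) ∂(Measure.pi fun j => gammaMeasure (n j) 1)
  have hK : Measurable K := hquot.lintegral_prod_left'
  let h : (Fin d → ℝ) × ((Fin d → Measure 𝕏) × ((j : Fin d) → Fin (n j) → 𝕏)) → ℝ≥0∞ := fun q =>
    {x : (j : Fin d) → Fin (n j) → 𝕏 | ∀ j i, x j i ∈ B j i}.indicator 1 q.2.2 *
      (F q.2.1 * G fun j => q.1 j / (q.2.1 j univ).toReal)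
  have hq1 : Measurable fun q : (Fin d → ℝ) × ((Fin d → Measure 𝕏) ×
      ((j : Fin d) → Fin (n j) → 𝕏)) => (q.1, q.2.1) := by fun_prop
  have hGm : Measurable fun q : (Fin d → ℝ) × ((Fin d → Measure 𝕏) ×
      ((j : Fin d) → Fin (n j) → 𝕏)) => G fun j => q.1 j / (q.2.1 j univ).toReal := hquot.comp hq1
  have hFm : Measurable fun q : (Fin d → ℝ) × ((Fin d → Measure 𝕏) ×
      ((j : Fin d) → Fin (n j) → 𝕏)) => F q.2.1 :=
    hF.comp (measurable_fst.comp measurable_snd)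
  have hIm : Measurable fun q : (Fin d → ℝ) × ((Fin d → Measure 𝕏) ×
      ((j : Fin d) → Fin (n j) → 𝕏)) =>
      {x : (j : Fin d) → Fin (n j) → 𝕏 | ∀ j i, x j i ∈ B j i}.indicator
        (1 : ((j : Fin d) → Fin (n j) → 𝕏) → ℝ≥0∞) q.2.2 :=
    (measurable_one.indicator hBm).comp (measurable_snd.comp measurable_snd)
  have hh : Measurable h := hIm.mul (hFm.mul hGm)
  have hS : MeasurableSet {ω | ∀ j i, X j i ω ∈ B j i} := hX' hBm
  have e1 : ∫⁻ ω in {ω | ∀ j i, X j i ω ∈ B j i}, F (fun j => μ j ω) * G (fun j => U j ω) ∂P =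
      ∫⁻ ω, h (fun j => Γ j ω, (fun j => μ j ω, fun j i => X j i ω)) ∂P := by
    rw [← lintegral_indicator hS]
    refine lintegral_congr fun ω => ?_
    simp only [h, ← hU]
    by_cases hx : ∀ j i, X j i ω ∈ B j i
    · rw [indicator_of_mem (by exact hx), indicator_of_mem (by exact hx), Pi.one_apply, one_mul]
    · rw [indicator_of_notMem (by exact hx), indicator_of_notMem (by exact hx), zero_mul]
  have e2 : ∫⁻ ω, h (fun j => Γ j ω, (fun j => μ j ω, fun j i => X j i ω)) ∂P =
      ∫⁻ ω in {ω | ∀ j i, X j i ω ∈ B j i}, F (fun j => μ j ω) * K (fun j => μ j ω) ∂P := by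
    refine (lintegral_map hh (hΓ'.prodMk (hμ'.prodMk hX'))).symm.trans ?_
    rw [hlaw, hlawΓ, lintegral_prod_symm' _ hh]
    have hin : Measurable fun r : (Fin d → Measure 𝕏) × ((j : Fin d) → Fin (n j) → 𝕏) =>
        ∫⁻ γ, h (γ, r) ∂(Measure.pi fun j => gammaMeasure (n j) 1) := hh.lintegral_prod_left'
    rw [lintegral_map hin (hμ'.prodMk hX'), ← lintegral_indicator hS]
    refine lintegral_congr fun ω => ?_
    have hGω : Measurable fun γ : Fin d → ℝ => G fun j => γ j / (μ j ω univ).toReal :=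
      hG.comp (by fun_prop)
    simp only [h]
    rw [lintegral_const_mul _ (hGω.const_mul _), lintegral_const_mul _ hGω]
    by_cases hx : ∀ j i, X j i ω ∈ B j i
    · rw [indicator_of_mem (by exact hx), indicator_of_mem (by exact hx), Pi.one_apply, one_mul]
    · rw [indicator_of_notMem (by exact hx), indicator_of_notMem (by exact hx), zero_mul]
  rw [e1, e2, hX.setLIntegral hμ (F := fun m => F m * K m) (hF.mul hK) hB]
  refine lintegral_congr_ae ?_
  filter_upwards [hT0, hT1] with ω h0 h1
  have ht : ∀ j, 0 < (μ j ω univ).toReal := fun j => ENNReal.toReal_pos (h0 j) (h1 j)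
  have hKω : K (fun j => μ j ω) = ∫⁻ u, (∏ j, μ j ω univ ^ n j) *
      ((∏ j, gammaWeight (n j) (u j)) * G u *
        expNeg (∑ j, ENNReal.ofReal (u j) * μ j ω univ)) := by
    simp only [K]
    rw [lintegral_gamma_div hn ht hG]
    refine lintegral_congr fun u => ?_
    simp only [ENNReal.ofReal_toReal (h1 _), Finset.prod_mul_distrib, expNeg_sum]
    ring
  have hm : Measurable fun u : Fin d → ℝ => (∏ j, gammaWeight (n j) (u j)) * G u *
      expNeg (∑ j, ENNReal.ofReal (u j) * μ j ω univ) := by fun_prop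
  have hnorm : ∏ j, ∏ i, normalized (μ j ω) (B j i) =
      (∏ j, (μ j ω univ)⁻¹ ^ n j) * ∏ j, ∏ i, μ j ω (B j i) := by
    simp only [normalized, Measure.smul_apply, smul_eq_mul, Finset.prod_mul_distrib,
      Finset.prod_const, Finset.card_univ, Fintype.card_fin]
  -- The purpose of the latent variables: the powers of the total masses from the gamma densities
  -- cancel the normalizations.
  have hcancel : (∏ j, (μ j ω univ)⁻¹ ^ n j) * ∏ j, μ j ω univ ^ n j = 1 := by
    rw [← Finset.prod_mul_distrib]
    refine Finset.prod_eq_one fun j _ => ?_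
    rw [← mul_pow, ENNReal.inv_mul_cancel (h0 j) (h1 j), one_pow]
  rw [hKω, hnorm, lintegral_const_mul _ hm]
  calc _ = ((∏ j, (μ j ω univ)⁻¹ ^ n j) * ∏ j, μ j ω univ ^ n j) * ((F (fun j => μ j ω) *
        ∏ j, ∏ i, μ j ω (B j i)) * ∫⁻ u, (∏ j, gammaWeight (n j) (u j)) * G u *
        expNeg (∑ j, ENNReal.ofReal (u j) * μ j ω univ)) := by ring
    _ = _ := by
      rw [hcancel, one_mul, ← lintegral_const_mul _ hm]
      refine lintegral_congr fun u => ?_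
      ring

variable {ρ : Measure (Fin d → ℝ≥0)} {α : Measure 𝕏}


/-- The law of the samples and the latent variables, weighted by the exponential of a pairing. -/
theorem map_withDensity_expNeg_pairing [MeasurableEq 𝕏] [SFinite ρ] [SFinite α]
    (hμ : ∀ j, Measurable (μ j)) (hX : IsSample P μ X)
    (hT0 : ∀ᵐ ω ∂P, ∀ j, μ j ω univ ≠ 0) (hT1 : ∀ᵐ ω ∂P, ∀ j, μ j ω univ ≠ ∞)
    (hn : ∀ j, 1 ≤ n j) (hΓ : ∀ j, Measurable (Γ j))
    (hΓ_law : ∀ j, P.map (Γ j) = gammaMeasure (n j) 1) (hΓ_indep : iIndepFun Γ P)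
    (hΓ_indep' : IndepFun (fun ω j => Γ j ω) (fun ω => (fun j => μ j ω, fun j i => X j i ω)) P)
    (hU : ∀ j ω, U j ω = Γ j ω / (μ j ω univ).toReal)
    {D : Measure ((j : Fin d) → Fin (n j) → 𝕏)} [IsFiniteMeasure D]
    (hD : ∀ H : Fin d → 𝕏 → ℝ≥0∞, (∀ j, Measurable (H j)) →
      ∀ c : ℝ≥0∞, c ≠ 0 → (∀ j y, c ≤ H j y) →
        ∀ B : (j : Fin d) → Fin (n j) → Set 𝕏, (∀ j i, MeasurableSet (B j i)) →
          ∫⁻ ω, expNeg (pairing H fun j => μ j ω) * ∏ j, ∏ i, μ j ω (B j i) ∂P =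
            ∫⁻ x in {x | ∀ j i, x j i ∈ B j i}, posteriorLaplace ρ α x H ∂D)
    {H : Fin d → 𝕏 → ℝ≥0∞} (hH : ∀ j, Measurable (H j)) :
    (P.withDensity fun ω => expNeg (pairing H fun j => μ j ω)).map
        (fun ω => (fun j i => X j i ω, fun j => U j ω)) =
      (D.prod volume).withDensity fun y : ((j : Fin d) → Fin (n j) → 𝕏) × (Fin d → ℝ) =>
        (∏ j, gammaWeight (n j) (y.2 j)) *
          posteriorLaplace ρ α y.1 fun j z => H j z + ENNReal.ofReal (y.2 j) := by
  have hμ' : Measurable fun ω j => μ j ω := measurable_pi_lambda _ hμ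
  have hX' : Measurable fun ω j i => X j i ω :=
    measurable_pi_lambda _ fun j => measurable_pi_lambda _ fun i => hX.measurable j i
  have hU' : Measurable fun ω j => U j ω := measurable_pi_lambda _ fun j => by
    have : U j = fun ω => Γ j ω / (μ j ω univ).toReal := funext (hU j)
    rw [this]
    exact (hΓ j).div ((measurable_total j).comp hμ').ennreal_toReal
  have hEm : Measurable fun m : Fin d → Measure 𝕏 => expNeg (pairing H m) :=
    measurable_expNeg.comp (measurable_pairing hH)
  have hE : Measurable fun ω => expNeg (pairing H fun j => μ j ω) := hEm.comp hμ'
  have hfin : IsFiniteMeasure (P.withDensity fun ω => expNeg (pairing H fun j => μ j ω)) := by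
    refine isFiniteMeasure_withDensity (ne_top_of_le_ne_top ENNReal.one_ne_top ?_)
    calc _ ≤ ∫⁻ _, 1 ∂P := lintegral_mono fun ω => expNeg_le_one _
      _ = 1 := by simp
  have hΦ : Measurable fun y : ((j : Fin d) → Fin (n j) → 𝕏) × (Fin d → ℝ) =>
      posteriorLaplace ρ α y.1 fun j z => H j z + ENNReal.ofReal (y.2 j) := by
    refine measurable_posteriorLaplace (x := Prod.fst) measurable_fst
      (H := fun (y : ((j : Fin d) → Fin (n j) → 𝕏) × (Fin d → ℝ)) j z =>
        H j z + ENNReal.ofReal (y.2 j)) fun j => ?_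
    exact ((hH j).comp measurable_snd).add
      ((measurable_pi_apply j).comp (measurable_snd.comp measurable_fst)).ennreal_ofReal
  have hγ : Measurable fun u : Fin d → ℝ => ∏ j, gammaWeight (n j) (u j) := by fun_prop
  have hγ' : Measurable fun y : ((j : Fin d) → Fin (n j) → 𝕏) × (Fin d → ℝ) =>
      ∏ j, gammaWeight (n j) (y.2 j) := hγ.comp measurable_snd
  have hdens : Measurable fun y : ((j : Fin d) → Fin (n j) → 𝕏) × (Fin d → ℝ) =>
      (∏ j, gammaWeight (n j) (y.2 j)) *
        posteriorLaplace ρ α y.1 fun j z => H j z + ENNReal.ofReal (y.2 j) := hγ'.mul hΦ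
  refine ext_samples_prod fun B C hB hC => ?_
  have hBm := measurableSet_sampleBox hB
  have hS : MeasurableSet {ω | ∀ j i, X j i ω ∈ B j i} := hX' hBm
  have hSC : MeasurableSet {ω | (∀ j i, X j i ω ∈ B j i) ∧ (fun j => U j ω) ∈ C} :=
    hS.inter (hU' hC)
  have hGm : Measurable (C.indicator (1 : (Fin d → ℝ) → ℝ≥0∞)) := measurable_one.indicator hC
  rw [Measure.map_apply (hX'.prodMk hU') (hBm.prod hC), withDensity_apply _ (hBm.prod hC)]
  have e1 : (P.withDensity fun ω => expNeg (pairing H fun j => μ j ω))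
      ((fun ω => (fun j i => X j i ω, fun j => U j ω)) ⁻¹' ({x | ∀ j i, x j i ∈ B j i} ×ˢ C)) =
      ∫⁻ ω in {ω | ∀ j i, X j i ω ∈ B j i},
        expNeg (pairing H fun j => μ j ω) * C.indicator 1 (fun j => U j ω) ∂P := by
    have : ((fun ω => (fun j i => X j i ω, fun j => U j ω)) ⁻¹' ({x | ∀ j i, x j i ∈ B j i} ×ˢ C)) =
        {ω | (∀ j i, X j i ω ∈ B j i) ∧ (fun j => U j ω) ∈ C} := rfl
    rw [this, withDensity_apply _ hSC, ← lintegral_indicator hSC, ← lintegral_indicator hS]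
    refine lintegral_congr fun ω => ?_
    by_cases hx : ∀ j i, X j i ω ∈ B j i
    · rw [indicator_of_mem (s := {ω | ∀ j i, X j i ω ∈ B j i}) (by exact hx)]
      by_cases hu : (fun j => U j ω) ∈ C
      · rw [indicator_of_mem (by exact ⟨hx, hu⟩), indicator_of_mem hu, Pi.one_apply, mul_one]
      · rw [indicator_of_notMem fun h => hu h.2, indicator_of_notMem hu, mul_zero]
    · rw [indicator_of_notMem fun h => hx h.1,
        indicator_of_notMem (s := {ω | ∀ j i, X j i ω ∈ B j i}) (by exact hx)]
  rw [e1, hX.lintegral_latent hμ hT0 hT1 hn hΓ hΓ_law hΓ_indep hΓ_indep' hU hEm hGm hB]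
  have hpB : Measurable fun q : Ω × (Fin d → ℝ) => ∏ j, ∏ i, μ j q.1 (B j i) :=
    (measurable_prod_box hB).comp (hμ'.comp measurable_fst)
  have hE1 : Measurable fun q : Ω × (Fin d → ℝ) => expNeg (pairing H fun j => μ j q.1) :=
    hE.comp measurable_fst
  have htot : ∀ j, Measurable fun q : Ω × (Fin d → ℝ) => μ j q.1 univ := fun j =>
    (measurable_total j).comp (hμ'.comp measurable_fst)
  have hγ2 : Measurable fun q : Ω × (Fin d → ℝ) =>
      (∏ j, gammaWeight (n j) (q.2 j)) * C.indicator (1 : (Fin d → ℝ) → ℝ≥0∞) q.2 :=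
    (hγ.comp measurable_snd).mul (hGm.comp measurable_snd)
  have hjoint : Measurable fun q : Ω × (Fin d → ℝ) =>
      (∏ j, gammaWeight (n j) (q.2 j)) * C.indicator (1 : (Fin d → ℝ) → ℝ≥0∞) q.2 *
        (expNeg (pairing H fun j => μ j q.1) *
        expNeg (∑ j, ENNReal.ofReal (q.2 j) * μ j q.1 univ) * ∏ j, ∏ i, μ j q.1 (B j i)) := by
    exact hγ2.mul ((hE1.mul (measurable_expNeg.comp (Finset.measurable_fun_sum _ fun j _ =>
      Measurable.mul (by fun_prop) (htot j)))).mul hpB)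
  rw [lintegral_lintegral_swap hjoint.aemeasurable, ← Measure.prod_restrict,
    lintegral_prod_symm' _ hdens, ← lintegral_indicator hC]
  refine lintegral_congr fun u => ?_
  by_cases hu : u ∈ C
  swap
  · rw [indicator_of_notMem hu]
    simp [indicator_of_notMem hu]
  rw [indicator_of_mem hu]
  simp only [indicator_of_mem hu, Pi.one_apply, mul_one]
  -- For a fixed value `u` the exponential in the total masses adds `u` to `H`. If some `u j ≤ 0`
  -- both sides vanish with the weight.
  by_cases hpos : ∀ j, 0 < u j
  swap
  · push Not at hpos
    obtain ⟨j, hj⟩ := hpos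
    have h0 : ∏ j, gammaWeight (n j) (u j) = 0 :=
      Finset.prod_eq_zero (Finset.mem_univ j) (if_neg (not_lt.2 hj))
    simp [h0]
  have hH' : ∀ j, Measurable fun z => H j z + ENNReal.ofReal (u j) := fun j => (hH j).add_const _
  -- The minimum of the `u j` is a positive lower bound for `H + u`, as the moment formula requires.
  have hDu := hD (fun j z => H j z + ENNReal.ofReal (u j)) hH'
    (Finset.univ.inf fun j => ENNReal.ofReal (u j))
    ((Finset.lt_inf_iff (by simp)).2 fun j _ => by simpa using hpos j).ne'
    (fun j y => (Finset.inf_le (Finset.mem_univ j)).trans le_add_self) B hB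
  have hm1 : Measurable fun ω => expNeg (pairing H fun j => μ j ω) *
      expNeg (∑ j, ENNReal.ofReal (u j) * μ j ω univ) * ∏ j, ∏ i, μ j ω (B j i) := by
    have h1 : Measurable fun ω => ∏ j, ∏ i, μ j ω (B j i) := (measurable_prod_box hB).comp hμ'
    have h2 : ∀ j, Measurable fun ω => μ j ω univ := fun j => (measurable_total j).comp hμ'
    exact (hE.mul (measurable_expNeg.comp (Finset.measurable_fun_sum _ fun j _ =>
      (h2 j).const_mul _))).mul h1
  have hm2 : Measurable fun x : (j : Fin d) → Fin (n j) → 𝕏 =>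
      posteriorLaplace ρ α x fun j z => H j z + ENNReal.ofReal (u j) :=
    measurable_posteriorLaplace (x := fun x => x) measurable_id
      (H := fun _ j z => H j z + ENNReal.ofReal (u j)) fun j => (hH' j).comp measurable_snd
  rw [lintegral_const_mul _ hm1, lintegral_const_mul _ hm2, ← hDu]
  congr 1
  refine lintegral_congr fun ω => ?_
  rw [← expNeg_add]
  congr 2
  simp only [pairing]
  rw [← Finset.sum_add_distrib]
  refine Finset.sum_congr rfl fun j _ => ?_
  rw [lintegral_add_left (hH j), lintegral_const]

end Latent

end

end CoRM

/-! ### The posterior kernel -/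

namespace CoRM

noncomputable section

section Kernel

variable {𝕏 : Type*} [MeasurableSpace 𝕏] {d : ℕ} {n : Fin d → ℕ} {ρ : Measure (Fin d → ℝ≥0)}
  {α : Measure 𝕏}

lemma posteriorLaplace_ne_top (hρ : ∀ j, ∫⁻ w, min 1 (w j : ℝ≥0∞) ∂ρ ≠ ∞)
    (x : (j : Fin d) → Fin (n j) → 𝕏) {θ : Fin d → ℝ≥0∞} (hθ : ∀ j, θ j ≠ 0) :
    posteriorLaplace ρ α x (fun j _ => θ j) ≠ ∞ :=
  ENNReal.mul_ne_top (expNeg_ne_top _) (ENNReal.prod_ne_top fun a ha =>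
    jumpMoment_ne_top hρ (frequency_ne_zero ⟨a, ha⟩) hθ)

lemma posteriorLaplace_ne_zero [IsFiniteMeasure α] (hρ : ∀ j, ∫⁻ w, min 1 (w j : ℝ≥0∞) ∂ρ ≠ ∞)
    (hρ0 : ∀ᵐ w ∂ρ, ∀ j, 0 < w j) (hρ1 : ρ ≠ 0) (x : (j : Fin d) → Fin (n j) → 𝕏)
    {θ : Fin d → ℝ≥0∞} (hθ : ∀ j, θ j ≠ ∞) : posteriorLaplace ρ α x (fun j _ => θ j) ≠ 0 :=
  mul_ne_zero (expNeg_eq_zero_iff.not.2 (exponent_const_ne_top hρ hθ))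
    (Finset.prod_ne_zero_iff.2 fun _ _ => jumpMoment_ne_zero hρ0 hρ1 _ hθ)

/-- A family of laws with the Laplace functionals of the posterior laws is measurable. -/
lemma measurable_of_posteriorLaplace [MeasurableEq 𝕏] [SFinite ρ] [SFinite α]
    {q : ((j : Fin d) → Fin (n j) → 𝕏) × (Fin d → ℝ) → Measure (Fin d → Measure 𝕏)}
    [∀ y, IsProbabilityMeasure (q y)]
    (h0 : ∀ y : ((j : Fin d) → Fin (n j) → 𝕏) × (Fin d → ℝ),
      (∀ j, 0 < y.2 j) → posteriorLaplace ρ α y.1 (fun j _ => ENNReal.ofReal (y.2 j)) ≠ 0)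
    (h1 : ∀ y : ((j : Fin d) → Fin (n j) → 𝕏) × (Fin d → ℝ),
      (∀ j, 0 < y.2 j) → posteriorLaplace ρ α y.1 (fun j _ => ENNReal.ofReal (y.2 j)) ≠ ∞)
    (hq : ∀ y : ((j : Fin d) → Fin (n j) → 𝕏) × (Fin d → ℝ),
      (∀ j, 0 < y.2 j) → ∀ H : Fin d → 𝕏 → ℝ≥0∞, (∀ j, Measurable (H j)) →
      posteriorLaplace ρ α y.1 (fun j _ => ENNReal.ofReal (y.2 j)) *
        ∫⁻ μ, expNeg (pairing H μ) ∂(q y) =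
      posteriorLaplace ρ α y.1 fun j z => H j z + ENNReal.ofReal (y.2 j))
    (hq' : ∀ y : ((j : Fin d) → Fin (n j) → 𝕏) × (Fin d → ℝ),
      ¬ (∀ j, 0 < y.2 j) → q y = Measure.dirac 0) : Measurable q := by
  classical
  refine measurable_of_laplace_pairing q fun H hH => ?_
  have hΦ : ∀ H : Fin d → 𝕏 → ℝ≥0∞, (∀ j, Measurable (H j)) →
      Measurable fun y : ((j : Fin d) → Fin (n j) → 𝕏) × (Fin d → ℝ) =>
        posteriorLaplace ρ α y.1 fun j z => H j z + ENNReal.ofReal (y.2 j) := fun H hH =>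
    measurable_posteriorLaplace (x := Prod.fst) measurable_fst
      (H := fun (y : ((j : Fin d) → Fin (n j) → 𝕏) × (Fin d → ℝ)) j z =>
        H j z + ENNReal.ofReal (y.2 j)) fun j => ((hH j).comp measurable_snd).add
      ((measurable_pi_apply j).comp (measurable_snd.comp measurable_fst)).ennreal_ofReal
  have hΦ0 : Measurable fun y : ((j : Fin d) → Fin (n j) → 𝕏) × (Fin d → ℝ) =>
      posteriorLaplace ρ α y.1 fun j _ => ENNReal.ofReal (y.2 j) := by
    have := hΦ (fun _ _ => 0) fun _ => measurable_const
    simpa only [zero_add] using this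
  have hS : MeasurableSet {y : ((j : Fin d) → Fin (n j) → 𝕏) × (Fin d → ℝ) | ∀ j, 0 < y.2 j} := by
    have : {y : ((j : Fin d) → Fin (n j) → 𝕏) × (Fin d → ℝ) | ∀ j, 0 < y.2 j} =
        ⋂ j, {y | 0 < y.2 j} := by
      ext y
      simp
    rw [this]
    exact MeasurableSet.iInter fun j =>
      measurableSet_lt measurable_const ((measurable_pi_apply j).comp measurable_snd)
  have hE : Measurable fun μ : Fin d → Measure 𝕏 => expNeg (pairing H μ) :=
    measurable_expNeg.comp (measurable_pairing hH)
  have hΨ : Measurable fun y : ((j : Fin d) → Fin (n j) → 𝕏) × (Fin d → ℝ) =>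
      (posteriorLaplace ρ α y.1 fun j _ => ENNReal.ofReal (y.2 j))⁻¹ *
        posteriorLaplace ρ α y.1 fun j z => H j z + ENNReal.ofReal (y.2 j) :=
    hΦ0.inv.mul (hΦ H hH)
  have hm : Measurable fun y : ((j : Fin d) → Fin (n j) → 𝕏) × (Fin d → ℝ) =>
      if ∀ j, 0 < y.2 j then (posteriorLaplace ρ α y.1 fun j _ => ENNReal.ofReal (y.2 j))⁻¹ *
        posteriorLaplace ρ α y.1 fun j z => H j z + ENNReal.ofReal (y.2 j)
      else expNeg (pairing H 0) := Measurable.ite hS hΨ measurable_const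
  refine (congrArg Measurable (funext fun y => ?_)).mpr hm
  by_cases hy : ∀ j, 0 < y.2 j
  · rw [if_pos (by exact hy), ← hq y hy H hH, ← mul_assoc,
      ENNReal.inv_mul_cancel (h0 y hy) (h1 y hy), one_mul]
  · rw [if_neg (by exact hy), hq' y hy, lintegral_dirac' _ hE]

/-- A kernel with the Laplace functionals of the posterior laws disintegrates the joint law. -/
lemma map_eq_compProd_of_posteriorLaplace [MeasurableEq 𝕏] [SFinite ρ] [SFinite α]
    {Ω : Type*} [MeasurableSpace Ω] {P : Measure Ω} [IsProbabilityMeasure P]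
    {μ : Ω → Fin d → Measure 𝕏} (hμ : Measurable μ)
    {Y : Ω → ((j : Fin d) → Fin (n j) → 𝕏) × (Fin d → ℝ)} (hY : Measurable Y)
    {D : Measure ((j : Fin d) → Fin (n j) → 𝕏)} [IsFiniteMeasure D]
    (hlaw : ∀ H : Fin d → 𝕏 → ℝ≥0∞, (∀ j, Measurable (H j)) →
      (P.withDensity fun ω => expNeg (pairing H (μ ω))).map Y =
      (D.prod volume).withDensity fun y : ((j : Fin d) → Fin (n j) → 𝕏) × (Fin d → ℝ) =>
        (∏ j, gammaWeight (n j) (y.2 j)) *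
          posteriorLaplace ρ α y.1 fun j z => H j z + ENNReal.ofReal (y.2 j))
    (Q : Kernel (((j : Fin d) → Fin (n j) → 𝕏) × (Fin d → ℝ)) (Fin d → Measure 𝕏))
    [IsMarkovKernel Q]
    (hQ : ∀ y, (∀ j, 0 < y.2 j) → ∀ H : Fin d → 𝕏 → ℝ≥0∞, (∀ j, Measurable (H j)) →
      posteriorLaplace ρ α y.1 (fun j _ => ENNReal.ofReal (y.2 j)) *
        ∫⁻ μ, expNeg (pairing H μ) ∂(Q y) =
      posteriorLaplace ρ α y.1 fun j z => H j z + ENNReal.ofReal (y.2 j)) :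
    P.map (fun ω => (Y ω, μ ω)) = P.map Y ⊗ₘ Q ∧ ∀ᵐ y ∂(P.map Y), ∀ j, 0 < y.2 j := by
  have hγ : Measurable fun y : ((j : Fin d) → Fin (n j) → 𝕏) × (Fin d → ℝ) =>
      ∏ j, gammaWeight (n j) (y.2 j) := by
    have : Measurable fun u : Fin d → ℝ => ∏ j, gammaWeight (n j) (u j) := by fun_prop
    exact this.comp measurable_snd
  have hΦ0 : Measurable fun y : ((j : Fin d) → Fin (n j) → 𝕏) × (Fin d → ℝ) =>
      posteriorLaplace ρ α y.1 fun j _ => ENNReal.ofReal (y.2 j) :=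
    measurable_posteriorLaplace (x := Prod.fst) measurable_fst
      (H := fun (y : ((j : Fin d) → Fin (n j) → 𝕏) × (Fin d → ℝ)) j _ =>
        ENNReal.ofReal (y.2 j)) fun j =>
      ((measurable_pi_apply j).comp (measurable_snd.comp measurable_fst)).ennreal_ofReal
  have hdens : Measurable fun y : ((j : Fin d) → Fin (n j) → 𝕏) × (Fin d → ℝ) =>
      (∏ j, gammaWeight (n j) (y.2 j)) *
        posteriorLaplace ρ α y.1 fun j _ => ENNReal.ofReal (y.2 j) := hγ.mul hΦ0
  -- The case `H = 0` gives the marginal density, by which the conditional Laplace functional is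
  -- normalized.
  have hlaw0 : P.map Y =
      (D.prod volume).withDensity fun y : ((j : Fin d) → Fin (n j) → 𝕏) × (Fin d → ℝ) =>
        (∏ j, gammaWeight (n j) (y.2 j)) *
          posteriorLaplace ρ α y.1 fun j _ => ENNReal.ofReal (y.2 j) := by
    have := hlaw (fun _ _ => 0) fun _ => measurable_const
    simp only [pairing, lintegral_zero, Finset.sum_const_zero, expNeg_zero, zero_add] at this
    rw [← this]
    congr 1
    exact withDensity_one.symm
  have hweight : ∀ y : ((j : Fin d) → Fin (n j) → 𝕏) × (Fin d → ℝ), ¬ (∀ j, 0 < y.2 j) →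
      ∏ j, gammaWeight (n j) (y.2 j) = 0 := fun y hy => by
    push Not at hy
    obtain ⟨j, hj⟩ := hy
    exact Finset.prod_eq_zero (Finset.mem_univ j) (if_neg (not_lt.2 hj))
  have hprob : IsProbabilityMeasure (P.map Y) := Measure.isProbabilityMeasure_map hY.aemeasurable
  have hYμ : Measurable fun ω => (Y ω, μ ω) := hY.prodMk hμ
  constructor
  · have hfin : IsProbabilityMeasure (P.map fun ω => (Y ω, μ ω)) :=
      Measure.isProbabilityMeasure_map hYμ.aemeasurable
    refine Measure.ext_prod fun {S} {C} hS hC => ?_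
    have hSω : MeasurableSet (Y ⁻¹' S) := hY hS
    -- For each event `Y ∈ S`, Laplace functionals are compared: multiplying the density at `u` by
    -- the transform of `Q` gives the density at `H + u`.
    have h : (P.restrict (Y ⁻¹' S)).map μ = ((P.map Y).restrict S).bind Q := by
      have : IsFiniteMeasure (((P.map Y).restrict S).bind Q) := inferInstance
      refine ext_of_laplace_pairing _ _ fun H hH => ?_
      have hE : Measurable fun μ : Fin d → Measure 𝕏 => expNeg (pairing H μ) :=
        measurable_expNeg.comp (measurable_pairing hH)
      rw [Measure.lintegral_bind Q.aemeasurable hE.aemeasurable, lintegral_map hE hμ,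
        ← withDensity_apply _ hSω, ← Measure.map_apply hY hS, hlaw H hH, withDensity_apply _ hS,
        hlaw0, restrict_withDensity hS, lintegral_withDensity_eq_lintegral_mul _ hdens
          (hE.lintegral_kernel)]
      refine lintegral_congr fun y => ?_
      rw [Pi.mul_apply]
      by_cases hy : ∀ j, 0 < y.2 j
      · rw [mul_assoc, hQ y hy H hH]
      · rw [hweight y hy, zero_mul, zero_mul, zero_mul]
    have h1 := congrArg (fun κ => κ C) h
    simp only [Measure.map_apply hμ hC, Measure.bind_apply hC Q.aemeasurable] at h1
    rw [Measure.map_apply hYμ (hS.prod hC), Measure.compProd_apply_prod hS hC, ← h1,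
      Measure.restrict_apply (hμ hC), inter_comm]
    rfl
  · rw [hlaw0, ae_withDensity_iff hdens]
    refine ae_of_all _ fun y hy => ?_
    by_contra h
    exact hy (by rw [hweight y h, zero_mul])

end Kernel

end

end CoRM

/-! ### The posterior representation -/

/-- Posterior representation of normalized compound random measures with i.i.d. scores. -/
theorem theorem1 {𝕏 : Type u} [TopologicalSpace 𝕏] [PolishSpace 𝕏] [MeasurableSpace 𝕏]
    [BorelSpace 𝕏] {Ω : Type v} [MeasurableSpace Ω] (P : Measure Ω) [IsProbabilityMeasure P]
    -- the centering measure: finite, non-zero and diffuse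
    (α : Measure 𝕏) [IsFiniteMeasure α] [NullSingletonClass α] (hα : α ≠ 0)
    -- the directing Lévy measure on `(0, ∞)`
    (ν : Measure ℝ) (hν : ν (Iic 0) = 0)
    (hνLevy : ∫⁻ s, ENNReal.ofReal (min s 1) ∂ν < ∞)
    -- the density of the scores on `(0, ∞)`
    (f : ℝ → ℝ≥0) (hf : Measurable f) (hf_one : ∫⁻ m in Ioi (0 : ℝ), (f m : ℝ≥0∞) = 1)
    (d : ℕ) (hd : 1 ≤ d)
    -- regularity of the multivariate Lévy intensity
    (hA1 : ∫⁻ z, (∫⁻ s in (univ.pi fun _ : Fin d => Ioi (0 : ℝ)),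
      ENNReal.ofReal ((z ^ d)⁻¹ * min 1 ‖WithLp.toLp 2 s‖) *
        ∏ j, (f (s j / z) : ℝ≥0∞) ∂volume) ∂ν < ∞)
    -- the marginal Lévy measures are infinite
    (hA3 : ∫⁻ z, (∫⁻ s in Ioi (0 : ℝ), ENNReal.ofReal z⁻¹ * (f (s / z) : ℝ≥0∞) ∂volume) ∂ν = ∞)
    -- the vector of compound random measures, and the samples from its normalization
    (μ : Fin d → Ω → Measure 𝕏) (hμ : CoRM.IsCompoundVector P (fun _ _ => CoRM.scoreLaw f) ν α μ)
    (n : Fin d → ℕ) (hn : ∀ j, 1 ≤ n j)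
    (X : (j : Fin d) → Fin (n j) → Ω → 𝕏) (hX : CoRM.IsSample P μ X)
    -- the latent variables
    (Γ : Fin d → Ω → ℝ) (hΓ : ∀ j, Measurable (Γ j))
    (hΓ_law : ∀ j, P.map (Γ j) = gammaMeasure (n j) 1) (hΓ_indep : iIndepFun Γ P)
    (hΓ_indep' : IndepFun (fun ω j => Γ j ω) (fun ω => (fun j => μ j ω, fun j i => X j i ω)) P)
    (U : Fin d → Ω → ℝ) (hU : ∀ j ω, U j ω = Γ j ω / (μ j ω univ).toReal) :
    -- a regular conditional distribution of the vector given the samples and latent variables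
    ∃ Q : Kernel (((j : Fin d) → Fin (n j) → 𝕏) × (Fin d → ℝ)) (Fin d → Measure 𝕏),
      IsMarkovKernel Q ∧
      P.map (fun ω => ((fun j i => X j i ω, fun j => U j ω), fun j => μ j ω)) =
        (P.map fun ω => (fun j i => X j i ω, fun j => U j ω)) ⊗ₘ Q ∧
      ∀ᵐ y ∂(P.map fun ω => (fun j i => X j i ω, fun j => U j ω)),
        (∃ (Ω' : Type u) (_ : MeasurableSpace Ω') (P' : Measure Ω') (_ : IsProbabilityMeasure P')
          (μ' : Fin d → Ω' → Measure 𝕏) (σ : CoRM.distinctValues y.1 → Ω' → ℝ)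
          (T : CoRM.distinctValues y.1 → Fin d → Ω' → ℝ),
          CoRM.IsPosteriorRepresentation P' f ν α y.1 y.2 μ' σ T ∧
            Q y = P'.map (CoRM.posteriorVector y.1 μ' σ T)) ∧
        (∀ (Ω' : Type w) (_ : MeasurableSpace Ω') (P' : Measure Ω') (_ : IsProbabilityMeasure P')
          (μ' : Fin d → Ω' → Measure 𝕏) (σ : CoRM.distinctValues y.1 → Ω' → ℝ)
          (T : CoRM.distinctValues y.1 → Fin d → Ω' → ℝ),
          CoRM.IsPosteriorRepresentation P' f ν α y.1 y.2 μ' σ T →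
            Q y = P'.map (CoRM.posteriorVector y.1 μ' σ T)) := by
  have hν' : SFinite ν := CoRM.sFinite_of_levy hν hνLevy
  have hρs : SFinite (CoRM.jumpMeasure d f ν) := CoRM.sFinite_jumpMeasure hf_one
  have hρ := CoRM.lintegral_min_one_jumpMeasure_ne_top hf hf_one hν hA1
  have hρ0 := CoRM.jumpMeasure_ae_pos (d := d) hf hf_one hν
  have hρtop : CoRM.jumpMeasure d f ν univ = ∞ := by
    rw [CoRM.jumpMeasure_univ hf_one, CoRM.levy_univ_eq_top hf hf_one hν hA3]
  have hρne : CoRM.jumpMeasure d f ν ≠ 0 := fun h => by simp [h] at hρtop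
  have hL : ∀ H : Fin d → 𝕏 → ℝ≥0∞, (∀ j, Measurable (H j)) →
      ∫⁻ ω, CoRM.expNeg (CoRM.pairing H fun j => μ j ω) ∂P =
        CoRM.expNeg (CoRM.exponent (CoRM.jumpMeasure d f ν) α H) := fun H hH =>
    CoRM.laplace_iid hf_one hν hμ hH
  have hT0 : ∀ᵐ ω ∂P, ∀ j, μ j ω univ ≠ 0 := ae_all_iff.2 fun j =>
    CoRM.ae_total_ne_zero hμ.measurable hL hα hρ0 hρtop j
  have hT1 : ∀ᵐ ω ∂P, ∀ j, μ j ω univ ≠ ∞ := ae_all_iff.2 fun j =>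
    CoRM.ae_total_ne_top hμ.measurable hL hρ j
  obtain ⟨D, hDfin, hD⟩ := CoRM.exists_sample_moment_measure hρ hμ.measurable hL n
  have hlaw := fun H hH => CoRM.map_withDensity_expNeg_pairing hμ.measurable hX hT0 hT1 hn hΓ hΓ_law
    hΓ_indep hΓ_indep' hU hD (H := H) hH
  have hμm : Measurable fun ω j => μ j ω := measurable_pi_lambda _ hμ.measurable
  have hUm : Measurable fun ω j => U j ω := measurable_pi_lambda _ fun j => by
    have : U j = fun ω => Γ j ω / (μ j ω univ).toReal := funext (hU j)
    rw [this]
    exact (hΓ j).div ((CoRM.measurable_total j).comp hμm).ennreal_toReal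
  have hYm : Measurable fun ω => (fun j i => X j i ω, fun j => U j ω) :=
    (measurable_pi_lambda _ fun j => measurable_pi_lambda _ fun i => hX.measurable j i).prodMk hUm
  have h0 : ∀ u : Fin d → ℝ, ∀ k, CoRM.jumpMoment (CoRM.jumpMeasure d f ν) k
      (fun j => ENNReal.ofReal (u j)) ≠ 0 := fun u k =>
    CoRM.jumpMoment_ne_zero hρ0 hρne k fun _ => ENNReal.ofReal_ne_top
  have h1 : ∀ u : Fin d → ℝ, (∀ j, 0 < u j) → ∀ k, k ≠ 0 →
      CoRM.jumpMoment (CoRM.jumpMeasure d f ν) k (fun j => ENNReal.ofReal (u j)) ≠ ∞ :=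
    fun u hu k hk => CoRM.jumpMoment_ne_top hρ hk fun j => by simpa using hu j
  have hrep : ∀ y : ((j : Fin d) → Fin (n j) → 𝕏) × (Fin d → ℝ), (∀ j, 0 < y.2 j) →
      ∃ (Ω' : Type u) (_ : MeasurableSpace Ω') (P' : Measure Ω') (_ : IsProbabilityMeasure P')
        (μ' : Fin d → Ω' → Measure 𝕏) (σ : CoRM.distinctValues y.1 → Ω' → ℝ)
        (T : CoRM.distinctValues y.1 → Fin d → Ω' → ℝ),
        CoRM.IsPosteriorRepresentation P' f ν α y.1 y.2 μ' σ T := fun y hy =>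
    CoRM.exists_posteriorRepresentation hf hf_one hν hμ hy
      (CoRM.exponent_const_ne_top hρ fun _ => ENNReal.ofReal_ne_top) (h0 y.2) (h1 y.2 hy) y.1
  -- A representation is chosen separately for each positive `u`; elsewhere, on a null set for the
  -- law of the data, the value is an arbitrary default. The choice need not be measurable in `y`:
  -- measurability comes afterwards from the explicit Laplace functional.
  have hex : ∀ y : ((j : Fin d) → Fin (n j) → 𝕏) × (Fin d → ℝ),
      ∃ q : Measure (Fin d → Measure 𝕏), IsProbabilityMeasure q ∧
        ((∀ j, 0 < y.2 j) →
          ∃ (Ω' : Type u) (_ : MeasurableSpace Ω') (P' : Measure Ω') (_ : IsProbabilityMeasure P')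
            (μ' : Fin d → Ω' → Measure 𝕏) (σ : CoRM.distinctValues y.1 → Ω' → ℝ)
            (T : CoRM.distinctValues y.1 → Fin d → Ω' → ℝ),
            CoRM.IsPosteriorRepresentation P' f ν α y.1 y.2 μ' σ T ∧
              q = P'.map (CoRM.posteriorVector y.1 μ' σ T)) ∧
        (¬ (∀ j, 0 < y.2 j) → q = Measure.dirac 0) := fun y => by
    by_cases hy : ∀ j, 0 < y.2 j
    · obtain ⟨Ω', _, P', hP', μ', σ, T, h⟩ := hrep y hy
      exact ⟨_, Measure.isProbabilityMeasure_map (CoRM.measurable_posteriorVector h).aemeasurable,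
        fun _ => ⟨Ω', _, P', hP', μ', σ, T, h, rfl⟩, fun h' => absurd hy h'⟩
    · exact ⟨Measure.dirac 0, inferInstance, fun h' => absurd h' hy, fun _ => rfl⟩
  choose q hq hqrep hqdirac using hex
  have hlap : ∀ y, (∀ j, 0 < y.2 j) → ∀ H : Fin d → 𝕏 → ℝ≥0∞, (∀ j, Measurable (H j)) →
      CoRM.posteriorLaplace (CoRM.jumpMeasure d f ν) α y.1 (fun j _ => ENNReal.ofReal (y.2 j)) *
        ∫⁻ μ, CoRM.expNeg (CoRM.pairing H μ) ∂(q y) =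
      CoRM.posteriorLaplace (CoRM.jumpMeasure d f ν) α y.1
        fun j z => H j z + ENNReal.ofReal (y.2 j) := fun y hy H hH => by
    obtain ⟨Ω', _, P', hP', μ', σ, T, h, hqy⟩ := hqrep y hy
    rw [hqy]
    exact h.laplace hf hf_one hν hy (h0 y.2) (h1 y.2 hy) hH
  have hΦ0 : ∀ y : ((j : Fin d) → Fin (n j) → 𝕏) × (Fin d → ℝ), (∀ j, 0 < y.2 j) →
      CoRM.posteriorLaplace (CoRM.jumpMeasure d f ν) α y.1
        (fun j _ => ENNReal.ofReal (y.2 j)) ≠ 0 := fun y _ =>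
    CoRM.posteriorLaplace_ne_zero hρ hρ0 hρne y.1 fun _ => ENNReal.ofReal_ne_top
  have hΦ1 : ∀ y : ((j : Fin d) → Fin (n j) → 𝕏) × (Fin d → ℝ), (∀ j, 0 < y.2 j) →
      CoRM.posteriorLaplace (CoRM.jumpMeasure d f ν) α y.1
        (fun j _ => ENNReal.ofReal (y.2 j)) ≠ ∞ := fun y hy =>
    CoRM.posteriorLaplace_ne_top hρ y.1 fun j => by simpa using hy j
  let Q : Kernel (((j : Fin d) → Fin (n j) → 𝕏) × (Fin d → ℝ)) (Fin d → Measure 𝕏) :=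
    ⟨q, CoRM.measurable_of_posteriorLaplace hΦ0 hΦ1 hlap hqdirac⟩
  have hQ : IsMarkovKernel Q := ⟨hq⟩
  obtain ⟨hjoint, hpos⟩ := CoRM.map_eq_compProd_of_posteriorLaplace hμm hYm hlaw Q hlap
  refine ⟨Q, hQ, hjoint, ?_⟩
  filter_upwards [hpos] with y hy
  refine ⟨hqrep y hy, fun Ω' _ P' hP' μ' σ T h => ?_⟩
  have := Measure.isProbabilityMeasure_map (μ := P')
    (CoRM.measurable_posteriorVector h).aemeasurable
  refine CoRM.ext_of_laplace_pairing (q y) _ fun H hH => ?_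
  -- Every representation satisfies the same Laplace identity, and its prefactor is neither zero nor
  -- infinite, so it cancels.
  exact (ENNReal.mul_right_inj (hΦ0 y hy) (hΦ1 y hy)).1 ((hlap y hy H hH).trans
    (h.laplace hf hf_one hν hy (h0 y.2) (h1 y.2 hy) hH).symm)
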